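/- **Setting.** Let $\mathbb{k}$ be a field and $R=\bigoplus_{i\ge 0}R_i$ a commutative $\mathbb{N}$-graded ring with $R_0=\mathbb{k}$, finitely generated as a $\mathbb{k}$-algebra. Put $d=\dim R$, $\mathfrak{m}=\bigoplus_{i>0}R_i$ and $w=\max\{t : [\mathfrak{m}/\mathfrak{m}^2]_t\neq 0\}$ (with $w=0$ if $\mathfrak m=0$). Let $D_{R|\mathbb{k}}=\bigcup_n D^n_{R|\mathbb{k}}\subseteq \mathrm{End}_{\mathbb{k}}(R)$ be the ring of $\mathbb{k}$-linear differential operators, where $D^n_{R|\mathbb{k}}$ consists of those of order at most $n$; an operator $\delta$ is homogeneous of degree $e\in\mathbb{Z}$ if $\delta(R_i)\subseteq R_{i+e}$ for all $i$. For a real number $a>w$, the generalized Bernstein filtration of slope $a$ is $$\mathcal{B}^a_i=\mathbb{k}\text{-span of }\{\delta\in D_{R|\mathbb{k}}\ \text{homogeneous} : \deg\delta+a\,\mathrm{ord}(\delta)\le i\}\qquad(i\in\mathbb{N}).$$ **Definitions.** A filtration on a $\mathbb{k}$-algebra $A$ is an ascending exhaustive sequence $F_\bullet=(F_i)_{i\in\mathbb{N}}$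 of finite-dimensional subspaces with $F_0=\mathbb{k}$ and $F_iF_j\subseteq F_{i+j}$. A compatible filtration on a left $A$-module is an ascending exhaustive sequence $G_\bullet$ of finite-dimensional subspaces with $F_iG_j\subseteq G_{i+j}$. For such sequences let $$\mathrm{Dim}(G_\bullet)=\inf\{t\in\mathbb{R}_{\ge 0} : \lim_{i\to\infty} \dim G_i/i^t=0\}\in[0,\infty],\qquad \mathrm{e}(G_\bullet)=\limsup_{i\to\infty} \dim G_i/i^{\mathrm{Dim}(G_\bullet)},$$ with $\mathrm{e}(G_\bullet)=\infty$ if $\mathrm{Dim}(G_\bullet)=\infty$. The pair $(A,F_\bullet)$ is linearly simple if there is an integer $C\geq 1$ such that $1\in F_{Ci}\,\delta\,F_{Ci}$ (the span of the products) for all $i\in\mathbb{N}$ and $0\ne\delta\in F_i$. If $(A,F_\bullet)$ is linearly simple with $\mathrm{Dim}(F_\bullet)<\infty$ and $0<\mathrm{e}(F_\bullet)<\infty$, then a left $A$-module is holonomic if it is zero or has a compatible filtration $G_\bullet$ with $\mathrm{Dim}(G_\bullet)=\frac12\mathrm{Dim}(F_\bullet)$ and $\mathrm{e}(G_\bullet)<\infty$.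 The differential signature of $R$ is $$\mathrm{s}^{\mathrm{diff}}(R)=\limsup_{i\to\infty}\frac{d!\,\dim_{\mathbb{k}}R/\mathfrak{m}^{\langle i\rangle}}{i^d},\qquad \mathfrak{m}^{\langle i\rangle}=\{f\in R : \delta(f)\in\mathfrak{m}\ \text{for all}\ \delta\in D^{i-1}_{R|\mathbb{k}}\}.$$ $R$ is a Bernstein algebra if, for every $a>w$, $(D_{R|\mathbb{k}},\mathcal{B}^a_\bullet)$ is linearly simple, $\mathrm{Dim}(\mathcal{B}^a_\bullet)=2\dim R$ and $0<\mathrm{e}(\mathcal{B}^a_\bullet)<\infty$. **Theorem.** Suppose that $\mathrm{s}^{\mathrm{diff}}(R)>0$ and that $(D_{R|\mathbb{k}},\mathcal{B}^a_\bullet)$ is linearly simple for some $a>w$. Then $R$ is a Bernstein algebra. Moreover, for every $b>w$: 1. With respect to $\mathcal{B}^b_\bullet$, the following left $D_{R|\mathbb{k}}$-modules are holonomic: $R$; the localization $R_f$ for every $f\in R$ (each operator acts through its unique extension to a differential operator on $R_f$); and the local cohomology module $H^j_I(R)$ for every ideal $I\subseteq R$ and $j\in\mathbb{N}$, i.e.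 the $j$-th cohomology of the Čech complex of $R$ on any finite generating sequence of $I$, with the $D_{R|\mathbb{k}}$-structure inherited from the localizations. 2. If $\mathbb{k}$ has characteristic zero, put $R(s)=\mathbb{k}(s)\otimes_{\mathbb{k}}R$ and $R_f(s)=\mathbb{k}(s)\otimes_{\mathbb{k}}R_f$, with $s$ an indeterminate. For every nonzero $f\in R$, the $D_{R(s)|\mathbb{k}(s)}$-module $R_f(s)\boldsymbol{f^s}$, with action $$\delta\bullet u\boldsymbol{f^s}=\sum_{i=0}^{\mathrm{ord}(\delta)}\binom{s}{i}f^{-i}\delta^{(i)}(u)\,\boldsymbol{f^s},\qquad \delta^{(0)}=\delta,\quad \delta^{(i)}=[\delta^{(i-1)},f],$$ is holonomic with respect to the filtration $(\mathbb{k}(s)\otimes_{\mathbb{k}}\mathcal{B}^b_i)_i$ on $D_{R(s)|\mathbb{k}(s)}$. -/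

import Mathlib

namespace BernsteinAlg

open scoped TensorProduct ENNReal NNReal
open Filter Topology

/-! ### Filtrations, dimension, multiplicity, linear simplicity -/

section Filtrations

variable {k : Type*} [Field k]

/-- A filtration on a `k`-algebra `A`: ascending, exhaustive, by finite-dimensional subspaces indexed
by the natural numbers, with `F 0 = k` and `F i * F j ⊆ F (i + j)`. -/
structure IsAlgFiltration {A : Type*} [Ring A] [Algebra k A] (F : ℕ → Submodule k A) : Prop where
  mono : Monotone F
  exhaustive : ∀ x : A, ∃ i, x ∈ F i
  finite : ∀ i, Module.Finite k (F i)
  zero : F 0 = 1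
  mul_le : ∀ i j, F i * F j ≤ F (i + j)

/-- A filtration on a left `A`-module `M` compatible with the filtration `F` on `A`. -/
structure IsModFiltration {A : Type*} [Ring A] [Algebra k A] (F : ℕ → Submodule k A)
    {M : Type*} [AddCommGroup M] [Module k M] [Module A M] (G : ℕ → Submodule k M) : Prop where
  mono : Monotone G
  exhaustive : ∀ x : M, ∃ i, x ∈ G i
  finite : ∀ i, Module.Finite k (G i)
  smul_mem : ∀ i j, ∀ a ∈ F i, ∀ x ∈ G j, a • x ∈ G (i + j)

/-- The dimension `Dim G ∈ [0, ∞]` of a sequence of finite-dimensional subspaces: the infimum of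
the real `t ≥ 0` with `dim (G i) / i ^ t → 0` (and `∞` if there is no such `t`). -/
noncomputable def filtDim {V : Type*} [AddCommGroup V] [Module k V]
    (G : ℕ → Submodule k V) : ℝ≥0∞ :=
  ⨅ t ∈ {t : ℝ≥0 | Tendsto (fun i : ℕ => (Module.finrank k (G i) : ℝ) / (i : ℝ) ^ (t : ℝ))
    atTop (𝓝 0)}, (t : ℝ≥0∞)

open Classical in
/-- The multiplicity `e(G) = limsup dim (G i) / i ^ d` with `d = Dim G`, and `∞` if `d = ∞`. -/
noncomputable def filtMult {V : Type*} [AddCommGroup V] [Module k V]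
    (G : ℕ → Submodule k V) : ℝ≥0∞ :=
  if filtDim G = ⊤ then ⊤
  else limsup (fun i : ℕ =>
    (Module.finrank k (G i) : ℝ≥0∞) / (i : ℝ≥0∞) ^ (filtDim G).toReal) atTop

/-- `(A, F)` is linearly simple: there is a positive integer `C` such that
`1 ∈ F (C i) · δ · F (C i)` for every `i` and every nonzero `δ ∈ F i`. -/
def IsLinearlySimple {A : Type*} [Ring A] [Algebra k A] (F : ℕ → Submodule k A) : Prop :=
  ∃ C : ℕ, 0 < C ∧ ∀ i, ∀ δ ∈ F i, δ ≠ 0 →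
    (1 : A) ∈ F (C * i) * Submodule.span k {δ} * F (C * i)

/-- The standing conditions under which holonomic modules are defined: `(A, F)` is a linearly simple
filtered algebra of finite dimension and of positive finite multiplicity. -/
structure IsHolonomicSetting {A : Type*} [Ring A] [Algebra k A] (F : ℕ → Submodule k A) : Prop where
  filtration : IsAlgFiltration F
  linearlySimple : IsLinearlySimple F
  dim_lt_top : filtDim F < ⊤
  mult_pos : 0 < filtMult F
  mult_lt_top : filtMult F < ⊤

/-- `M` is a holonomic `(A, F)`-module: the standing conditions hold for `(A, F)`, and `M` is zero or
admits a compatible filtration of dimension `Dim F / 2` and finite multiplicity. -/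
def IsHolonomic {A : Type*} [Ring A] [Algebra k A] (F : ℕ → Submodule k A)
    (M : Type*) [AddCommGroup M] [Module k M] [Module A M] [IsScalarTower k A M] : Prop :=
  IsHolonomicSetting F ∧
    (Subsingleton M ∨ ∃ G : ℕ → Submodule k M,
      IsModFiltration F G ∧ filtDim G = filtDim F / 2 ∧ filtMult G < ⊤)

end Filtrations

/-! ### Differential operators -/

section DiffOps

variable (k R M : Type*) [Field k] [CommRing R] [Algebra k R]
  [AddCommGroup M] [Module k M] [Module R M] [IsScalarTower k R M]

/-- The commutator `[P, r] = P ∘ r - r ∘ P` of a `k`-linear endomorphism of an `R`-module with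
multiplication by `r`, as a linear function of `P`. -/
def bracket (r : R) : Module.End k M →ₗ[k] Module.End k M :=
  LinearMap.mulRight k (Algebra.lsmul k k M r) - LinearMap.mulLeft k (Algebra.lsmul k k M r)

variable {k R M}

theorem bracket_eq (r : R) (P : Module.End k M) :
    bracket k R M r P = P * Algebra.lsmul k k M r - Algebra.lsmul k k M r * P := rfl

@[simp] theorem bracket_apply (r : R) (P : Module.End k M) (x : M) :
    bracket k R M r P x = P (r • x) - r • P x := rfl

variable (k R M)

/-- The `k`-linear differential operators of order `≤ n` on the `R`-module `M`: those `P` all of whose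
`(n + 1)`-fold commutators with elements of `R` vanish. For `M = R` these of order `≤ 0` are
the multiplications by elements of `R`, see `mem_diffOpLE_zero_iff`. -/
def diffOpLE : ℕ → Submodule k (Module.End k M)
  | 0 => ⨅ r : R, LinearMap.ker (bracket k R M r)
  | n + 1 => ⨅ r : R, (diffOpLE n).comap (bracket k R M r)

variable {k R M}

theorem mem_zero {P : Module.End k M} :
    P ∈ diffOpLE k R M 0 ↔ ∀ r : R, bracket k R M r P = 0 := by
  simp [diffOpLE]

theorem mem_succ {n : ℕ} {P : Module.End k M} :
    P ∈ diffOpLE k R M (n + 1) ↔ ∀ r : R, bracket k R M r P ∈ diffOpLE k R M n := by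
  simp [diffOpLE]

theorem mem_diffOpLE_zero_iff {P : Module.End k R} :
    P ∈ diffOpLE k R R 0 ↔ ∃ a : R, ∀ x, P x = a * x := by
  rw [mem_zero]
  constructor
  · intro h
    refine ⟨P 1, fun x => ?_⟩
    have := LinearMap.congr_fun (h x) 1
    simp only [bracket_apply, smul_eq_mul, mul_one, LinearMap.zero_apply] at this
    rw [sub_eq_zero.1 this, mul_comm]
  · rintro ⟨a, ha⟩ r
    ext x
    simp only [bracket_apply, smul_eq_mul, ha, LinearMap.zero_apply]
    ring

theorem diffOpLE_le_succ (n : ℕ) : diffOpLE k R M n ≤ diffOpLE k R M (n + 1) := by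
  induction n with
  | zero =>
    intro P hP
    rw [mem_succ]
    intro r
    rw [mem_zero.1 hP r]
    exact zero_mem _
  | succ n ih =>
    intro P hP
    rw [mem_succ] at hP ⊢
    exact fun r => ih (hP r)

theorem diffOpLE_mono : Monotone (diffOpLE k R M) := monotone_nat_of_le_succ diffOpLE_le_succ

theorem lsmul_mem (r : R) : (Algebra.lsmul k k M r : Module.End k M) ∈ diffOpLE k R M 0 := by
  rw [mem_zero]
  intro s
  ext x
  simp [smul_comm r s x]

theorem bracket_mul (r : R) (P Q : Module.End k M) :
    bracket k R M r (P * Q) = P * bracket k R M r Q + bracket k R M r P * Q := by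
  simp only [bracket_eq]
  noncomm_ring

theorem mul_mem_aux (N : ℕ) : ∀ m n : ℕ, m + n = N → ∀ P ∈ diffOpLE k R M m,
    ∀ Q ∈ diffOpLE k R M n, P * Q ∈ diffOpLE k R M N := by
  induction N with
  | zero =>
    intro m n h P hP Q hQ
    obtain ⟨rfl, rfl⟩ : m = 0 ∧ n = 0 := by omega
    rw [mem_zero] at *
    intro r
    rw [bracket_mul, hP, hQ]
    simp
  | succ N ih =>
    intro m n h P hP Q hQ
    rw [mem_succ]
    intro r
    rw [bracket_mul]
    refine add_mem ?_ ?_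
    · cases n with
      | zero => rw [mem_zero.1 hQ r, mul_zero]; exact zero_mem _
      | succ n => exact ih m n (by omega) P hP _ (mem_succ.1 hQ r)
    · cases m with
      | zero => rw [mem_zero.1 hP r, zero_mul]; exact zero_mem _
      | succ m => exact ih m n (by omega) _ (mem_succ.1 hP r) Q hQ

theorem mul_mem_diffOpLE {m n : ℕ} {P Q : Module.End k M} (hP : P ∈ diffOpLE k R M m)
    (hQ : Q ∈ diffOpLE k R M n) : P * Q ∈ diffOpLE k R M (m + n) :=
  mul_mem_aux _ m n rfl P hP Q hQ

variable (k R)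

/-- The differential operators of all orders, as a subalgebra of `End_k(R)`. -/
def dSubalgebra : Subalgebra k (Module.End k R) where
  carrier := {P | ∃ n, P ∈ diffOpLE k R R n}
  mul_mem' := by
    rintro P Q ⟨m, hP⟩ ⟨n, hQ⟩
    exact ⟨m + n, mul_mem_diffOpLE hP hQ⟩
  add_mem' := by
    rintro P Q ⟨m, hP⟩ ⟨n, hQ⟩
    exact ⟨max m n, add_mem (diffOpLE_mono (le_max_left m n) hP)
      (diffOpLE_mono (le_max_right m n) hQ)⟩
  algebraMap_mem' c := by
    refine ⟨0, ?_⟩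
    rw [mem_zero]
    intro r
    ext x
    simp

variable {k R}

/-- The ring `D_{R|k}` of `k`-linear differential operators on `R`. -/
def DRing (k R : Type*) [Field k] [CommRing R] [Algebra k R] : Type _ := dSubalgebra k R

noncomputable instance : Ring (DRing k R) := inferInstanceAs (Ring (dSubalgebra k R))

noncomputable instance : Algebra k (DRing k R) := inferInstanceAs (Algebra k (dSubalgebra k R))

/-- A differential operator, as a `k`-linear endomorphism of `R`. -/
noncomputable def DRing.toEnd : DRing k R →ₐ[k] Module.End k R := (dSubalgebra k R).val

theorem DRing.toEnd_injective : Function.Injective (DRing.toEnd : DRing k R → Module.End k R) :=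
  Subtype.val_injective

theorem DRing.exists_mem (δ : DRing k R) : ∃ n, δ.toEnd ∈ diffOpLE k R R n := δ.2

/-- `R` is a left `D_{R|k}`-module by evaluation of differential operators. -/
noncomputable instance : Module (DRing k R) R :=
  Module.compHom R (DRing.toEnd : DRing k R →ₐ[k] Module.End k R).toRingHom

theorem DRing.smul_def (δ : DRing k R) (x : R) : δ • x = δ.toEnd x := rfl

instance : IsScalarTower k (DRing k R) R where
  smul_assoc c δ x := by
    rw [DRing.smul_def, DRing.smul_def, map_smul, LinearMap.smul_apply]

/-- The order of a differential operator. -/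
noncomputable def ord (δ : DRing k R) : ℕ := sInf {n | δ.toEnd ∈ diffOpLE k R R n}

theorem mem_ord (δ : DRing k R) : δ.toEnd ∈ diffOpLE k R R (ord δ) :=
  Nat.sInf_mem (s := {n | δ.toEnd ∈ diffOpLE k R R n}) δ.exists_mem

theorem ord_le {δ : DRing k R} {n : ℕ} (h : δ.toEnd ∈ diffOpLE k R R n) : ord δ ≤ n :=
  Nat.sInf_le h

/-- A differential operator of order `≤ n`, as an element of `D_{R|k}`. -/
def DRing.mk (P : Module.End k R) (n : ℕ) (h : P ∈ diffOpLE k R R n) : DRing k R := ⟨P, n, h⟩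

@[simp] theorem DRing.toEnd_mk (P : Module.End k R) (n : ℕ) (h : P ∈ diffOpLE k R R n) :
    (DRing.mk P n h).toEnd = P := rfl

variable (k)

/-- Multiplication by `r ∈ R`, as a differential operator. -/
def mulOp (r : R) : DRing k R := DRing.mk (Algebra.lsmul k k R r) 0 (lsmul_mem r)

variable {k}

theorem toEnd_bracket (f : R) (δ : DRing k R) :
    (δ * mulOp k f - mulOp k f * δ).toEnd = bracket k R R f δ.toEnd := by
  rw [map_sub, map_mul, map_mul]
  rfl

/-- The iterated commutators `δ⁽⁰⁾ = δ`, `δ⁽ⁱ⁺¹⁾ = [δ⁽ⁱ⁾, f]`. -/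
noncomputable def iterComm (f : R) (δ : DRing k R) : ℕ → DRing k R
  | 0 => δ
  | i + 1 => iterComm f δ i * mulOp k f - mulOp k f * iterComm f δ i

end DiffOps

/-! ### The action of differential operators on localizations -/

section Localization

variable {k R : Type*} [Field k] [CommRing R] [Algebra k R]

/-- A differential operator on a localization that vanishes on the image of `R` is zero. -/
theorem eq_zero_of_vanish (S : Submonoid R) (L : Type*) [CommRing L] [Algebra R L]
    [Algebra k L] [IsScalarTower k R L] [IsLocalization S L] (n : ℕ) : ∀ P ∈ diffOpLE k R L n,
    (∀ x : R, P (algebraMap R L x) = 0) → P = 0 := by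
  have key : ∀ P : Module.End k L, (∀ r : R, bracket k R L r P = 0) →
      (∀ x : R, P (algebraMap R L x) = 0) → P = 0 := by
    intro P hP h0
    ext x
    obtain ⟨⟨v, s⟩, hx⟩ := IsLocalization.surj S x
    have h1 := LinearMap.congr_fun (hP s) x
    simp only [bracket_apply, LinearMap.zero_apply, Algebra.smul_def] at h1
    simp only at hx
    rw [mul_comm, hx, h0, zero_sub, neg_eq_zero] at h1
    exact (IsLocalization.map_units L s).mul_right_eq_zero.1 h1
  induction n with
  | zero => exact fun P hP h0 => key P (mem_zero.1 hP) h0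
  | succ n ih =>
    intro P hP h0
    refine key P (fun r => ih _ (mem_succ.1 hP r) fun x => ?_) h0
    have : r • algebraMap R L x = algebraMap R L (r * x) := by
      rw [Algebra.smul_def, map_mul]
    rw [bracket_apply, this, h0, h0, smul_zero, sub_zero]

theorem eq_of_agree (S : Submonoid R) (L : Type*) [CommRing L] [Algebra R L]
    [Algebra k L] [IsScalarTower k R L] [IsLocalization S L] {m n : ℕ} {P Q : Module.End k L} (hP : P ∈ diffOpLE k R L m)
    (hQ : Q ∈ diffOpLE k R L n)
    (h : ∀ x : R, P (algebraMap R L x) = Q (algebraMap R L x)) : P = Q := by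
  refine sub_eq_zero.1 (eq_zero_of_vanish S L (max m n) (P - Q) (sub_mem
    (diffOpLE_mono (le_max_left m n) hP) (diffOpLE_mono (le_max_right m n) hQ)) fun x => ?_)
  simp [h]

theorem algebraMap_smul' (L : Type*) [CommRing L] [Algebra R L] [Algebra k L] [IsScalarTower k R L]
    (c : k) (v : R) : algebraMap R L (c • v) = c • algebraMap R L v :=
  map_smul (IsScalarTower.toAlgHom k R L) c v

/-- Every differential operator on `R` extends to a localization. The extension of `δ` is
constructed by the rule `δ (v / s) = (δ v - [δ, s] (v / s)) / s`. -/
theorem exists_extension (S : Submonoid R) (L : Type*) [CommRing L] [Algebra R L]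
    [Algebra k L] [IsScalarTower k R L] [IsLocalization S L] (n : ℕ) : ∀ δ ∈ diffOpLE k R R n, ∃ P ∈ diffOpLE k R L n,
    ∀ x : R, P (algebraMap R L x) = algebraMap R L (δ x) := by
  induction n with
  | zero =>
    intro δ hδ
    obtain ⟨a, ha⟩ := mem_diffOpLE_zero_iff.1 hδ
    exact ⟨Algebra.lsmul k k L a, lsmul_mem a, fun x => by simp [ha, Algebra.smul_def]⟩
  | succ n ih =>
    intro δ hδ
    have hδ' := mem_succ.1 hδ
    have sd : ∀ (r : R) (x : L), r • x = algebraMap R L r * x := fun r x => Algebra.smul_def r x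
    choose E hE hEx using fun r : R => ih _ (hδ' r)
    have hrel : ∀ r s : R, E r * Algebra.lsmul k k L s + Algebra.lsmul k k L r * E s
        = E s * Algebra.lsmul k k L r + Algebra.lsmul k k L s * E r := by
      intro r s
      have h1 : ∀ r s : R, E r * Algebra.lsmul k k L s + Algebra.lsmul k k L r * E s
          ∈ diffOpLE k R L n := fun r s => by
        refine add_mem ?_ ?_
        · simpa using mul_mem_diffOpLE (hE r) (lsmul_mem (k := k) (M := L) s)
        · simpa using mul_mem_diffOpLE (lsmul_mem (k := k) (M := L) r) (hE s)
      refine eq_of_agree S L (h1 r s) (h1 s r) fun x => ?_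
      simp only [LinearMap.add_apply, Module.End.mul_apply, Algebra.lsmul_coe, sd,
        ← map_mul, hEx, ← map_add, bracket_apply, smul_eq_mul]
      congr 1
      rw [mul_left_comm r s x]
      ring
    have hex : ∀ x : L, ∃ y : L, ∀ (s : S) (v : R), algebraMap R L s * x = algebraMap R L v →
        algebraMap R L s * y = algebraMap R L (δ v) - E s x := by
      intro x
      obtain ⟨⟨v, s⟩, hx⟩ := IsLocalization.surj S x
      simp only at hx
      rw [mul_comm] at hx
      obtain ⟨y, hy⟩ : ∃ y, algebraMap R L s * y = algebraMap R L (δ v) - E s x :=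
        ((IsLocalization.map_units L s).dvd : _)
          |>.elim fun y h => ⟨y, h.symm⟩
      refine ⟨y, fun t u hu => ?_⟩
      have huv : algebraMap R L (s * u) = algebraMap R L (t * v) := by
        rw [map_mul, map_mul, ← hu, ← hx]; ring
      obtain ⟨c, hc⟩ := (IsLocalization.eq_iff_exists S L).1 huv
      have e1 := congrArg (algebraMap R L) (congrArg δ hc)
      have e2 := fun r : R => fun z : R => hEx r z
      simp only [bracket_apply, smul_eq_mul, map_sub, map_mul] at e2
      have h2 : ∀ (a b z : R), algebraMap R L (δ (a * (b * z)))
          = E a (algebraMap R L (b * z)) + algebraMap R L a * (E b (algebraMap R L z)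
            + algebraMap R L b * algebraMap R L (δ z)) := by
        intro a b z
        rw [e2, e2]; ring
      rw [h2, h2] at e1
      have e3 := LinearMap.congr_fun (hrel s t) x
      simp only [LinearMap.add_apply, Module.End.mul_apply, Algebra.lsmul_coe, sd]
        at e3
      rw [huv] at e1
      have e4 := add_left_cancel e1
      have e5 := (IsLocalization.map_units L c).mul_left_cancel e4
      rw [← hu, ← hx] at e5
      apply (IsLocalization.map_units L s).mul_left_cancel
      have : algebraMap R L s * (algebraMap R L t * y)
          = algebraMap R L t * (algebraMap R L s * y) := by ring
      rw [this, hy]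
      linear_combination e3 - e5
    choose Y hY using hex
    let P : Module.End k L :=
      { toFun := Y
        map_add' := by
          intro x x'
          obtain ⟨⟨v, s⟩, hx⟩ := IsLocalization.surj S x
          obtain ⟨⟨v', s'⟩, hx'⟩ := IsLocalization.surj S x'
          simp only at hx hx'
          have a1 : algebraMap R L ((s * s' : S) : R) * x = algebraMap R L (s' * v) := by
            rw [map_mul, ← hx]; simp; ring
          have a2 : algebraMap R L ((s * s' : S) : R) * x' = algebraMap R L (s * v') := by
            rw [map_mul, ← hx']; simp; ring
          have a3 : algebraMap R L ((s * s' : S) : R) * (x + x')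
              = algebraMap R L (s' * v + s * v') := by
            rw [mul_add, a1, a2, map_add]
          apply (IsLocalization.map_units L (s * s')).mul_left_cancel
          rw [hY _ _ _ a3, mul_add, hY _ _ _ a1, hY _ _ _ a2]
          simp only [map_add]
          ring
        map_smul' := by
          intro c x
          obtain ⟨⟨v, s⟩, hx⟩ := IsLocalization.surj S x
          simp only at hx
          rw [mul_comm] at hx
          have a1 : algebraMap R L s * (c • x) = algebraMap R L (c • v) := by
            rw [mul_smul_comm, hx, algebraMap_smul']
          apply (IsLocalization.map_units L s).mul_left_cancel
          rw [hY _ _ _ a1, RingHom.id_apply, mul_smul_comm, hY _ _ _ hx, map_smul δ,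
            map_smul (E s), smul_sub, algebraMap_smul'] }
    have hP : ∀ x, P x = Y x := fun _ => rfl
    refine ⟨P, ?_, fun x => ?_⟩
    · rw [mem_succ]
      intro r
      have : bracket k R L r P = E r := by
        ext x
        obtain ⟨⟨v, s⟩, hx⟩ := IsLocalization.surj S x
        simp only at hx
        rw [mul_comm] at hx
        have a1 : algebraMap R L s * (r • x) = algebraMap R L (r * v) := by
          rw [sd, map_mul, ← hx]; ring
        apply (IsLocalization.map_units L s).mul_left_cancel
        have e3 := LinearMap.congr_fun (hrel r s) x
        have e4 := hEx r v
        simp only [LinearMap.add_apply, Module.End.mul_apply, Algebra.lsmul_coe, sd,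
          bracket_apply, smul_eq_mul, map_sub, map_mul] at e3 e4
        rw [← hx] at e4
        rw [bracket_apply, hP, hP, mul_sub, hY _ _ _ a1, sd, sd, mul_left_comm,
          hY _ _ _ hx]
        linear_combination e3 - e4
      rw [this]
      exact hE r
    · have h1 : E 1 = 0 := by
        refine eq_of_agree S L (hE 1) (zero_mem (diffOpLE k R L 0)) fun x => ?_
        rw [hEx]; simp
      have := hY (algebraMap R L x) 1 x (by simp)
      simpa [h1, hP] using this

variable (S : Submonoid R) (L : Type*) [CommRing L] [Algebra R L] [Algebra k L]
  [IsScalarTower k R L] [IsLocalization S L]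

/-- The unique extension of a differential operator on `R` to one on `S⁻¹R`. -/
noncomputable def extendFun (δ : DRing k R) : Module.End k L :=
  (exists_extension S L (ord δ) δ.toEnd (mem_ord δ)).choose

theorem extendFun_mem (δ : DRing k R) : extendFun S L δ ∈ diffOpLE k R L (ord δ) :=
  (exists_extension S L (ord δ) δ.toEnd (mem_ord δ)).choose_spec.1

theorem extendFun_algebraMap (δ : DRing k R) (x : R) :
    extendFun S L δ (algebraMap R L x) = algebraMap R L (δ.toEnd x) :=
  (exists_extension S L (ord δ) δ.toEnd (mem_ord δ)).choose_spec.2 x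

/-- The homomorphism `D_{R|k} → End_k(S⁻¹R)` giving the action of differential operators on `S⁻¹R`:
`δ` goes to the unique differential operator on `S⁻¹R` extending `δ`. -/
noncomputable def extend : DRing k R →ₐ[k] Module.End k L :=
  AlgHom.ofLinearMap
    { toFun := extendFun S L
      map_add' := fun α β => by
        refine eq_of_agree S L (n := max (ord α) (ord β)) (extendFun_mem S L _)
          (add_mem (diffOpLE_mono (le_max_left _ _) (extendFun_mem S L α))
            (diffOpLE_mono (le_max_right _ _) (extendFun_mem S L β))) fun x => ?_
        rw [LinearMap.add_apply]
        simp only [extendFun_algebraMap, LinearMap.add_apply, map_add]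
      map_smul' := fun c α => by
        refine eq_of_agree S L (extendFun_mem S L _)
          (Submodule.smul_mem _ c (extendFun_mem S L α)) fun x => ?_
        rw [RingHom.id_apply, LinearMap.smul_apply]
        simp only [extendFun_algebraMap, map_smul, LinearMap.smul_apply, algebraMap_smul'] }
    (by
      have h : (1 : Module.End k L) ∈ diffOpLE k R L 0 := by
        simpa using lsmul_mem (k := k) (M := L) (1 : R)
      refine eq_of_agree S L (extendFun_mem S L 1) h fun x => ?_
      simp [extendFun_algebraMap])
    (fun α β => by
      refine eq_of_agree S L (extendFun_mem S L (α * β))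
        (mul_mem_diffOpLE (extendFun_mem S L α) (extendFun_mem S L β)) fun x => ?_
      change extendFun S L (α * β) (algebraMap R L x)
        = extendFun S L α (extendFun S L β (algebraMap R L x))
      simp only [extendFun_algebraMap, map_mul, Module.End.mul_apply])

theorem extend_mem (δ : DRing k R) : extend S L δ ∈ diffOpLE k R L (ord δ) :=
  extendFun_mem S L δ

theorem extend_algebraMap (δ : DRing k R) (x : R) :
    extend S L δ (algebraMap R L x) = algebraMap R L (δ.toEnd x) :=
  extendFun_algebraMap S L δ x

theorem extend_mulOp (r : R) : extend S L (mulOp k r) = Algebra.lsmul k k L r := by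
  refine eq_of_agree S L (extend_mem S L _) (lsmul_mem r) fun x => ?_
  rw [extend_algebraMap]
  simp [mulOp, Algebra.smul_def]

end Localization

/-! ### Localizations and Čech cohomology of `R` as modules over `D_{R|k}` -/

section LocModule

variable (k : Type*) {R : Type*} [Field k] [CommRing R] [Algebra k R]

/-- The localization `S⁻¹R`, to be regarded as a left `D_{R|k}`-module. -/
def LocModule (_ : Type*) {R : Type*} [CommRing R] (S : Submonoid R) : Type _ := Localization S

noncomputable instance (S : Submonoid R) : AddCommGroup (LocModule k S) :=
  inferInstanceAs (AddCommGroup (Localization S))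

noncomputable instance (S : Submonoid R) : Module k (LocModule k S) :=
  inferInstanceAs (Module k (Localization S))

/-- `δ ∈ D_{R|k}` acts on `S⁻¹R` by its unique extension to a differential operator on `S⁻¹R`. -/
noncomputable instance (S : Submonoid R) : Module (DRing k R) (LocModule k S) :=
  Module.compHom (Localization S) (extend (k := k) S (Localization S)).toRingHom

theorem LocModule.smul_def {S : Submonoid R} (δ : DRing k R) (x : LocModule k S) :
    δ • x = (extend S (Localization S) δ (x : Localization S) : Localization S) := rfl

instance (S : Submonoid R) : IsScalarTower k (DRing k R) (LocModule k S) where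
  smul_assoc c δ x := by
    rw [LocModule.smul_def, LocModule.smul_def, map_smul]
    rfl

/-- The localization map `R_a → R_b` for `a ∣ b`, as a homomorphism of rings. -/
noncomputable def awayMap {a b : R} (h : a ∣ b) :
    Localization (Submonoid.powers a) →+* Localization (Submonoid.powers b) :=
  IsLocalization.Away.lift a (g := algebraMap R (Localization (Submonoid.powers b)))
    (isUnit_of_dvd_unit (map_dvd _ h)
      (IsLocalization.map_units _ (⟨b, Submonoid.mem_powers b⟩ : Submonoid.powers b)))

theorem awayMap_algebraMap {a b : R} (h : a ∣ b) (x : R) :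
    awayMap h (algebraMap R _ x) = algebraMap R (Localization (Submonoid.powers b)) x :=
  IsLocalization.Away.lift_eq _ _ _

theorem awayMap_extend {a b : R} (h : a ∣ b) (n : ℕ) : ∀ δ : DRing k R,
    δ.toEnd ∈ diffOpLE k R R n → ∀ x,
    awayMap h (extend (Submonoid.powers a) (Localization (Submonoid.powers a)) δ x)
      = extend (Submonoid.powers b) (Localization (Submonoid.powers b)) δ (awayMap h x) := by
  have main : ∀ δ : DRing k R, (∀ r : R, ∀ x,
      awayMap h (extend (Submonoid.powers a) (Localization (Submonoid.powers a))
        (δ * mulOp k r - mulOp k r * δ) x)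
      = extend (Submonoid.powers b) (Localization (Submonoid.powers b))
        (δ * mulOp k r - mulOp k r * δ) (awayMap h x)) → ∀ x,
      awayMap h (extend (Submonoid.powers a) (Localization (Submonoid.powers a)) δ x)
        = extend (Submonoid.powers b) (Localization (Submonoid.powers b)) δ (awayMap h x) := by
    intro δ hδ x
    obtain ⟨⟨v, s⟩, hx⟩ := IsLocalization.surj (Submonoid.powers a) x
    have hs : IsUnit (algebraMap R (Localization (Submonoid.powers b)) s) := by
      rw [← awayMap_algebraMap h]
      exact (IsLocalization.map_units _ s).map _
    have h1 := hδ s x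
    have hx' : algebraMap R _ (s : R) * awayMap h x = algebraMap R _ v := by
      rw [← awayMap_algebraMap h, ← awayMap_algebraMap h, ← map_mul, mul_comm, hx]
    rw [mul_comm] at hx
    simp only [map_sub, map_mul, extend_mulOp, LinearMap.sub_apply, Module.End.mul_apply,
      Algebra.lsmul_coe] at h1
    rw [Algebra.smul_def, Algebra.smul_def, Algebra.smul_def, Algebra.smul_def, hx, hx', map_mul,
      extend_algebraMap, extend_algebraMap, awayMap_algebraMap, awayMap_algebraMap] at h1
    exact hs.mul_left_cancel (sub_right_injective h1)
  induction n with
  | zero =>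
    intro δ hδ
    refine main δ fun r x => ?_
    have : δ * mulOp k r - mulOp k r * δ = 0 := DRing.toEnd_injective (by
      rw [toEnd_bracket, mem_zero.1 hδ r, map_zero])
    simp [this]
  | succ n ih =>
    intro δ hδ
    refine main δ fun r x => ih _ ?_ x
    rw [toEnd_bracket]
    exact mem_succ.1 hδ r

/-- The localization map `R_a → R_b` for `a ∣ b`, as a homomorphism of `D_{R|k}`-modules. -/
noncomputable def locMap {a b : R} (h : a ∣ b) :
    LocModule k (Submonoid.powers a) →ₗ[DRing k R] LocModule k (Submonoid.powers b) where
  toFun := awayMap h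
  map_add' := map_add (awayMap h)
  map_smul' δ x := awayMap_extend k h (ord δ) δ (mem_ord δ) x

variable {ℓ : ℕ} (g : Fin ℓ → R)

/-- The term of degree `p` of the Čech complex of `R` with respect to `g₁, …, g_ℓ`: the direct sum
of the localizations of `R` at `∏_{i ∈ T} g_i`, over the `p`-element sets `T` of indices. -/
abbrev CechObj (p : ℕ) : Type _ :=
  (T : {T : Finset (Fin ℓ) // T.card = p}) → LocModule k (Submonoid.powers (∏ i ∈ T.1, g i))

/-- The component of the Čech complex at an index set `T \ {i}`, followed by the localization map to
the component at `T`. -/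
noncomputable def cechFace (p : ℕ) (T : {T : Finset (Fin ℓ) // T.card = p + 1}) (i : T.1) :
    CechObj k g p →ₗ[DRing k R] LocModule k (Submonoid.powers (∏ i ∈ T.1, g i)) :=
  have hc : (T.1.erase i.1).card = p := by
    rw [Finset.card_erase_of_mem i.2, T.2, Nat.add_sub_cancel]
  have hd : (∏ j ∈ T.1.erase i.1, g j) ∣ ∏ j ∈ T.1, g j :=
    Finset.prod_dvd_prod_of_subset _ _ g (Finset.erase_subset i.1 T.1)
  (locMap k hd).comp (LinearMap.proj (R := DRing k R)
    (φ := fun T : {T : Finset (Fin ℓ) // T.card = p} =>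
      LocModule k (Submonoid.powers (∏ i ∈ T.1, g i))) ⟨T.1.erase i.1, hc⟩)

/-- The differential of the Čech complex: its `T`-component is the alternating sum of the
localization maps from the components `T \ {i}` with `i ∈ T`, where the sign is `-1` to the number
of elements of `T` smaller than `i`. -/
noncomputable def cechD (p : ℕ) : CechObj k g p →ₗ[DRing k R] CechObj k g (p + 1) :=
  LinearMap.pi fun T => ∑ i : T.1,
    (-1 : ℤ) ^ (T.1.filter (fun j => j < i.1)).card • cechFace k g p T i

theorem awayMap_comp {a b c : R} (h : a ∣ b) (h' : b ∣ c) (x : Localization (Submonoid.powers a)) :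
    awayMap h' (awayMap h x) = awayMap (h.trans h') x := by
  have : (awayMap h').comp (awayMap h) = awayMap (h.trans h') :=
    IsLocalization.ringHom_ext (Submonoid.powers a) (by
      ext y
      simp [awayMap_algebraMap])
  exact RingHom.congr_fun this x

/-- The Čech complex is a complex. -/
theorem cechD_cechD (p : ℕ) (x : CechObj k g p) : cechD k g (p + 1) (cechD k g p x) = 0 := by
  ext T
  have hcard : ∀ i j : T.1, i ≠ j → ((T.1.erase i.1).erase j.1).card = p := by
    intro i j h
    rw [Finset.card_erase_of_mem (Finset.mem_erase.2 ⟨fun e => h (Subtype.ext e.symm), j.2⟩),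
      Finset.card_erase_of_mem i.2, T.2]
    rfl
  have hdvd : ∀ i j : T.1, (∏ t ∈ (T.1.erase i.1).erase j.1, g t) ∣ ∏ t ∈ T.1, g t := fun i j =>
    Finset.prod_dvd_prod_of_subset _ _ g
      ((Finset.erase_subset _ _).trans (Finset.erase_subset _ _))
  let v : T.1 → T.1 → LocModule k (Submonoid.powers (∏ t ∈ T.1, g t)) := fun i j =>
    if h : i ≠ j then locMap k (hdvd i j) (x ⟨(T.1.erase i.1).erase j.1, hcard i j h⟩) else 0
  have hv : ∀ i j, v i j = v j i := by
    intro i j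
    by_cases h : i = j
    · rw [h]
    have aux : ∀ (U V : Finset (Fin ℓ)) (hU : U.card = p) (hV : V.card = p)
        (dU : (∏ t ∈ U, g t) ∣ ∏ t ∈ T.1, g t) (dV : (∏ t ∈ V, g t) ∣ ∏ t ∈ T.1, g t), U = V →
        locMap k dU (x ⟨U, hU⟩) = locMap k dV (x ⟨V, hV⟩) := by
      rintro U V hU hV dU dV rfl
      rfl
    simp only [v, dif_pos h, dif_pos (Ne.symm h)]
    exact aux _ _ _ _ _ _ Finset.erase_right_comm
  let sg : Finset (Fin ℓ) → Fin ℓ → ℤ := fun U i => (-1) ^ (U.filter (fun t => t < i)).card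
  have hsg : ∀ i j : T.1, i.1 < j.1 →
      sg T.1 i.1 * sg (T.1.erase i.1) j.1 = -(sg T.1 j.1 * sg (T.1.erase j.1) i.1) := by
    intro i j h
    have e1 : (T.1.erase j.1).filter (fun t => t < i.1) = T.1.filter (fun t => t < i.1) := by
      ext t
      simp only [Finset.mem_filter, Finset.mem_erase]
      exact ⟨fun ht => ⟨ht.1.2, ht.2⟩, fun ht => ⟨⟨(ht.2.trans h).ne, ht.1⟩, ht.2⟩⟩
    have e2 : (T.1.filter (fun t => t < j.1)).card
        = ((T.1.erase i.1).filter (fun t => t < j.1)).card + 1 := by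
      rw [Finset.filter_erase, Finset.card_erase_add_one]
      exact Finset.mem_filter.2 ⟨i.2, h⟩
    simp only [sg, e1, e2, pow_succ]
    ring
  have hsum : cechD k g (p + 1) (cechD k g p x) T
      = ∑ i : T.1, ∑ j : T.1, (sg T.1 i.1 * sg (T.1.erase i.1) j.1) • v i j := by
    rw [cechD, LinearMap.pi_apply, LinearMap.sum_apply]
    refine Finset.sum_congr rfl fun i _ => ?_
    have hc : (T.1.erase i.1).card = p + 1 := by
      rw [Finset.card_erase_of_mem i.2, T.2, Nat.add_sub_cancel]
    have hd : (∏ j ∈ T.1.erase i.1, g j) ∣ ∏ j ∈ T.1, g j :=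
      Finset.prod_dvd_prod_of_subset _ _ g (Finset.erase_subset i.1 T.1)
    have h1 : cechFace k g (p + 1) T i (cechD k g p x)
        = locMap k hd (cechD k g p x ⟨T.1.erase i.1, hc⟩) := rfl
    rw [LinearMap.smul_apply, h1, cechD, LinearMap.pi_apply, LinearMap.sum_apply, map_sum,
      Finset.smul_sum]
    have h2 : ∀ j : {t // t ∈ T.1.erase i.1},
        sg T.1 i.1 • locMap k hd ((sg (T.1.erase i.1) j.1 •
          cechFace k g p ⟨T.1.erase i.1, hc⟩ j) x)
        = (sg T.1 i.1 * sg (T.1.erase i.1) j.1) • v i ⟨j.1, Finset.mem_of_mem_erase j.2⟩ := by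
      intro j
      have hij : i ≠ ⟨j.1, Finset.mem_of_mem_erase j.2⟩ := fun e =>
        (Finset.mem_erase.1 j.2).1 (congrArg Subtype.val e).symm
      rw [LinearMap.smul_apply, map_zsmul, smul_smul]
      simp only [v, dif_pos hij]
      congr 1
      exact awayMap_comp (Finset.prod_dvd_prod_of_subset _ _ g
        (Finset.erase_subset j.1 (T.1.erase i.1))) hd _
    refine (Finset.sum_congr rfl fun j _ => h2 j).trans ?_
    have h3 : v i i = 0 := by simp [v]
    refine Finset.sum_of_injOn (fun j => ⟨j.1, Finset.mem_of_mem_erase j.2⟩) ?_ ?_ ?_ ?_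
    · intro a _ b _ hab
      exact Subtype.ext (congrArg (fun t : T.1 => t.1) hab)
    · intro a _
      exact Finset.mem_coe.2 (Finset.mem_univ _)
    · intro j _ hj
      by_cases hij : j = i
      · rw [hij, h3, smul_zero]
      · refine absurd ?_ hj
        exact ⟨⟨j.1, Finset.mem_erase.2 ⟨fun e => hij (Subtype.ext e), j.2⟩⟩,
          Finset.mem_coe.2 (Finset.mem_univ _), rfl⟩
    · intro j _
      rfl
  rw [hsum, ← Finset.sum_product']
  refine Finset.sum_involution (fun ij _ => (ij.2, ij.1)) ?_ ?_ (fun _ _ => by simp)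
    (fun _ _ => rfl)
  · rintro ⟨i, j⟩ _
    dsimp only
    rcases lt_trichotomy i.1 j.1 with h | h | h
    · rw [hsg i j h, hv i j, neg_smul, neg_add_cancel]
    · have : i = j := Subtype.ext h
      subst this
      simp [v]
    · rw [hsg j i h, hv i j, neg_smul, add_neg_cancel]
  · rintro ⟨i, j⟩ _ hne heq
    have : j = i := congrArg Prod.fst heq
    subst this
    exact hne (by simp [v])

/-- The coboundaries in the Čech complex. -/
noncomputable def cechB : (p : ℕ) → Submodule (DRing k R) (CechObj k g p)
  | 0 => ⊥
  | p + 1 => LinearMap.range (cechD k g p)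

/-- The Čech cohomology module `H^p(Č(g; R))`, with its structure of a left `D_{R|k}`-module. It is
the local cohomology module `H^p_I(R)` for the ideal `I` generated by the `g_i`. -/
abbrev CechCohomology (p : ℕ) : Type _ :=
  LinearMap.ker (cechD k g p) ⧸ (cechB k g p).submoduleOf (LinearMap.ker (cechD k g p))

end LocModule

/-! ### The module `R_f(s) f^s` -/

section Fs

variable {K A : Type*} [Field K] [CommRing A] [Algebra K A]

/-- The binomial coefficient `s (s - 1) ⋯ (s - i + 1) / i!` of an element `s` of a field. -/
def binom (s : K) (i : ℕ) : K := (∏ j ∈ Finset.range i, (s - (j : K))) / (i.factorial : K)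

/-- The inverse of `f` in `A_f`. -/
noncomputable def invAway (f : A) : Localization (Submonoid.powers f) :=
  IsLocalization.Away.invSelf f

/-- The action of `δ ∈ D_{A|K}` on `A_f · f^s`, for `s ∈ K`, given by
`δ • (u f^s) = (∑_{i ≤ ord δ} binom(s, i) f^{-i} δ⁽ⁱ⁾(u)) f^s`. -/
noncomputable def fsAct (f : A) (s : K) (δ : DRing K A) :
    Module.End K (Localization (Submonoid.powers f)) :=
  ∑ i ∈ Finset.range (ord δ + 1), binom s i •
    ((Algebra.lsmul K K (Localization (Submonoid.powers f)) (invAway f ^ i)) *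
      extend (Submonoid.powers f) (Localization (Submonoid.powers f)) (iterComm f δ i))

/-- `X ↦ f⁻¹ X f - X` on `K`-linear endomorphisms of `A_f`. -/
noncomputable def conjSub (f : A) : Module.End K (Module.End K (Localization (Submonoid.powers f))) :=
  (LinearMap.mulLeft K (Algebra.lsmul K K (Localization (Submonoid.powers f)) (invAway f))).comp
    (LinearMap.mulRight K (Algebra.lsmul K K (Localization (Submonoid.powers f)) f)) - 1

theorem lsmul_inv_mul (f : A) :
    (Algebra.lsmul K K (Localization (Submonoid.powers f)) (invAway f) : Module.End K _) *
      Algebra.lsmul K K (Localization (Submonoid.powers f)) f = 1 := by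
  ext x
  have h := IsLocalization.Away.mul_invSelf (S := Localization (Submonoid.powers f)) f
  simp only [Module.End.mul_apply, Algebra.lsmul_coe, Algebra.smul_def,
    Module.End.one_apply, invAway]
  linear_combination x * h

theorem lsmul_mul_inv (f : A) :
    (Algebra.lsmul K K (Localization (Submonoid.powers f)) f : Module.End K _) *
      Algebra.lsmul K K (Localization (Submonoid.powers f)) (invAway f) = 1 := by
  ext x
  have h := IsLocalization.Away.mul_invSelf (S := Localization (Submonoid.powers f)) f
  simp only [Module.End.mul_apply, Algebra.lsmul_coe, Algebra.smul_def,
    Module.End.one_apply, invAway]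
  linear_combination x * h

theorem conjSub_apply (f : A) (X : Module.End K (Localization (Submonoid.powers f))) :
    conjSub f X = Algebra.lsmul K K (Localization (Submonoid.powers f)) (invAway f) *
      (X * Algebra.lsmul K K (Localization (Submonoid.powers f)) f) - X := rfl

theorem conjSub_pow (f : A) (δ : DRing K A) (i : ℕ) :
    (conjSub f ^ i) (extend (Submonoid.powers f) (Localization (Submonoid.powers f)) δ)
      = Algebra.lsmul K K (Localization (Submonoid.powers f)) (invAway f ^ i) *
        extend (Submonoid.powers f) (Localization (Submonoid.powers f)) (iterComm f δ i) := by
  induction i with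
  | zero => simp [iterComm]
  | succ i ih =>
    rw [pow_succ', Module.End.mul_apply, ih, conjSub_apply, iterComm, map_sub, map_mul, map_mul,
      extend_mulOp, pow_succ, map_mul]
    have h := lsmul_inv_mul (K := K) f
    have h2 : Commute (Algebra.lsmul K K (Localization (Submonoid.powers f)) (invAway f))
        (Algebra.lsmul K K (Localization (Submonoid.powers f)) (invAway f ^ i)) :=
      (Commute.pow_right (Commute.refl (invAway f)) i).map _
    generalize Algebra.lsmul K K (Localization (Submonoid.powers f)) (invAway f ^ i) = a at *
    generalize Algebra.lsmul K K (Localization (Submonoid.powers f)) (invAway f) = b at *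
    generalize Algebra.lsmul K K (Localization (Submonoid.powers f)) f = c at *
    generalize extend (Submonoid.powers f) (Localization (Submonoid.powers f))
      (iterComm f δ i) = Y at *
    have h3 : a * b * (c * Y) = a * Y := by
      rw [mul_assoc, ← mul_assoc b, h, one_mul]
    rw [mul_sub, h3, mul_assoc a Y c, ← mul_assoc b a, h2.eq, mul_assoc]

theorem iterComm_succ' (f : A) (δ : DRing K A) (i : ℕ) :
    iterComm f δ (i + 1) = iterComm f (δ * mulOp K f - mulOp K f * δ) i := by
  induction i with
  | zero => rfl
  | succ i ih =>
    rw [iterComm, ih]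
    rfl

theorem iterComm_zero (f : A) (i : ℕ) : iterComm f (0 : DRing K A) i = 0 := by
  induction i with
  | zero => rfl
  | succ i ih => rw [iterComm, ih]; simp

theorem iterComm_eq_zero (f : A) (n : ℕ) : ∀ δ : DRing K A, δ.toEnd ∈ diffOpLE K A A n →
    ∀ i, n < i → iterComm f δ i = 0 := by
  induction n with
  | zero =>
    intro δ hδ i hi
    obtain ⟨i, rfl⟩ : ∃ j, i = j + 1 := ⟨i - 1, by omega⟩
    have : δ * mulOp K f - mulOp K f * δ = 0 := DRing.toEnd_injective (by
      rw [toEnd_bracket, mem_zero.1 hδ f, map_zero])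
    rw [iterComm_succ', this, iterComm_zero]
  | succ n ih =>
    intro δ hδ i hi
    obtain ⟨i, rfl⟩ : ∃ j, i = j + 1 := ⟨i - 1, by omega⟩
    rw [iterComm_succ']
    refine ih _ ?_ i (by omega)
    rw [toEnd_bracket]
    exact mem_succ.1 hδ f

theorem conjSub_pow_eq_zero (f : A) (δ : DRing K A) (i : ℕ) (hi : ord δ < i) :
    (conjSub f ^ i) (extend (Submonoid.powers f) (Localization (Submonoid.powers f)) δ) = 0 := by
  rw [conjSub_pow, iterComm_eq_zero f (ord δ) δ (mem_ord δ) i hi, map_zero, mul_zero]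

/-- The truncated binomial series for `X ↦ f^{-s} X f^s`. -/
noncomputable def conjPow (f : A) (s : K) (n : ℕ)
    (X : Module.End K (Localization (Submonoid.powers f))) :
    Module.End K (Localization (Submonoid.powers f)) :=
  ∑ i ∈ Finset.range n, binom s i • (conjSub f ^ i) X

theorem fsAct_eq (f : A) (s : K) (δ : DRing K A) (n : ℕ) (hn : ord δ < n) :
    fsAct f s δ = conjPow f s n
      (extend (Submonoid.powers f) (Localization (Submonoid.powers f)) δ) := by
  rw [fsAct, conjPow]
  simp only [← conjSub_pow]
  refine Finset.sum_subset (Finset.range_mono hn) fun i _ hi => ?_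
  rw [conjSub_pow_eq_zero f δ i (by simpa using hi), smul_zero]

theorem binom_natCast [CharZero K] (t i : ℕ) : binom (t : K) i = (t.choose i : K) := by
  rw [binom, ← descPochhammer_eval_eq_prod_range, descPochhammer_eval_eq_descFactorial,
    Nat.descFactorial_eq_factorial_mul_choose, Nat.cast_mul, mul_div_cancel_left₀]
  exact_mod_cast i.factorial_ne_zero

theorem conjPow_natCast [CharZero K] (f : A) (t n : ℕ)
    (X : Module.End K (Localization (Submonoid.powers f)))
    (hX : ∀ i, n ≤ i → (conjSub f ^ i) X = 0) :
    conjPow f (t : K) n X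
      = (Algebra.lsmul K K (Localization (Submonoid.powers f)) (invAway f)) ^ t * X *
        (Algebra.lsmul K K (Localization (Submonoid.powers f)) f) ^ t := by
  have h1 : ∀ Y, (conjSub (K := K) f + 1) Y =
      Algebra.lsmul K K (Localization (Submonoid.powers f)) (invAway f) *
      (Y * Algebra.lsmul K K (Localization (Submonoid.powers f)) f) := fun Y => by
    rw [LinearMap.add_apply, conjSub_apply, Module.End.one_apply, sub_add_cancel]
  have h2 : ((conjSub (K := K) f + 1) ^ t) X =
      (Algebra.lsmul K K (Localization (Submonoid.powers f)) (invAway f)) ^ t * X *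
        (Algebra.lsmul K K (Localization (Submonoid.powers f)) f) ^ t := by
    induction t with
    | zero => simp
    | succ t ih =>
      rw [pow_succ', Module.End.mul_apply, ih, h1, pow_succ', pow_succ]
      simp only [mul_assoc]
  rw [← h2, (Commute.one_right (conjSub (K := K) f)).add_pow, conjPow]
  rw [LinearMap.sum_apply]
  have h3 : ∀ i, ((conjSub (K := K) f ^ i * 1 ^ (t - i) *
      ((t.choose i : ℕ) : Module.End K (Module.End K (Localization (Submonoid.powers f))))) X)
      = binom (t : K) i • (conjSub f ^ i) X := fun i => by
    rw [binom_natCast, one_pow, mul_one, ← (Nat.cast_commute _ _).eq, Module.End.mul_apply,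
      Module.End.natCast_apply, Nat.cast_smul_eq_nsmul]
  simp only [h3]
  rw [Finset.sum_subset (Finset.range_mono (le_max_left n (t + 1)))]
  · symm
    refine Finset.sum_subset (Finset.range_mono (le_max_right n (t + 1))) fun i _ hi => ?_
    rw [binom_natCast, Nat.choose_eq_zero_of_lt (by simpa using hi), Nat.cast_zero, zero_smul]
  · intro i _ hi
    rw [hX i (by simpa using hi), smul_zero]

/-- The polynomial whose value at `s` is `binom s i`. -/
noncomputable def binomPoly (K : Type*) [Field K] (i : ℕ) : Polynomial K :=
  Polynomial.C ((i.factorial : K)⁻¹) * descPochhammer K i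

theorem eval_binomPoly (s : K) (i : ℕ) : (binomPoly K i).eval s = binom s i := by
  rw [binomPoly, Polynomial.eval_mul, Polynomial.eval_C, descPochhammer_eval_eq_prod_range, binom,
    div_eq_inv_mul]

theorem conjPow_mul [CharZero K] (f : A) (s : K) (n : ℕ)
    (X Y : Module.End K (Localization (Submonoid.powers f)))
    (hX : ∀ i, n ≤ i → (conjSub f ^ i) X = 0) (hY : ∀ i, n ≤ i → (conjSub f ^ i) Y = 0)
    (hXY : ∀ i, n ≤ i → (conjSub f ^ i) (X * Y) = 0) :
    conjPow f s n (X * Y) = conjPow f s n X * conjPow f s n Y := by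
  rw [← sub_eq_zero, ← Module.forall_dual_apply_eq_zero_iff K]
  intro l
  let p : Polynomial K :=
    ∑ i ∈ Finset.range n, Polynomial.C (l ((conjSub f ^ i) (X * Y))) * binomPoly K i
    - ∑ i ∈ Finset.range n, ∑ j ∈ Finset.range n,
      Polynomial.C (l ((conjSub f ^ i) X * (conjSub f ^ j) Y)) * (binomPoly K i * binomPoly K j)
  have hp : ∀ z : K, p.eval z
      = l (conjPow f z n (X * Y) - conjPow f z n X * conjPow f z n Y) := by
    intro z
    simp only [p, conjPow, Polynomial.eval_sub, Polynomial.eval_finsetSum, Polynomial.eval_mul,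
      Polynomial.eval_C, eval_binomPoly, map_sub, map_sum, map_smul, smul_eq_mul,
      Finset.sum_mul_sum, smul_mul_smul_comm]
    simp only [mul_comm]
  have h0 : p = 0 := by
    refine Polynomial.eq_zero_of_infinite_isRoot p
      ((Set.infinite_range_of_injective (Nat.cast_injective (R := K))).mono ?_)
    rintro _ ⟨t, rfl⟩
    change p.eval _ = 0
    rw [hp, conjPow_natCast f t n _ hX, conjPow_natCast f t n _ hY, conjPow_natCast f t n _ hXY]
    have h : (Algebra.lsmul K K (Localization (Submonoid.powers f)) f) ^ t *
        (Algebra.lsmul K K (Localization (Submonoid.powers f)) (invAway f)) ^ t = 1 := by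
      have hc : Commute (Algebra.lsmul K K (Localization (Submonoid.powers f)) f)
          (Algebra.lsmul K K (Localization (Submonoid.powers f)) (invAway f)) := by
        rw [Commute, SemiconjBy, lsmul_mul_inv, lsmul_inv_mul]
      rw [← hc.mul_pow, lsmul_mul_inv, one_pow]
    generalize Algebra.lsmul K K (Localization (Submonoid.powers f)) (invAway f) = b at *
    generalize Algebra.lsmul K K (Localization (Submonoid.powers f)) f = c at *
    have : b ^ t * X * c ^ t * (b ^ t * Y * c ^ t) = b ^ t * (X * Y) * c ^ t := by
      rw [show b ^ t * X * c ^ t * (b ^ t * Y * c ^ t)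
        = b ^ t * X * (c ^ t * b ^ t) * Y * c ^ t by simp only [mul_assoc], h, mul_one]
      simp only [mul_assoc]
    rw [this, sub_self, map_zero]
  rw [← hp, h0, Polynomial.eval_zero]

theorem conjPow_add (f : A) (s : K) (n : ℕ)
    (X Y : Module.End K (Localization (Submonoid.powers f))) :
    conjPow f s n (X + Y) = conjPow f s n X + conjPow f s n Y := by
  simp only [conjPow, map_add, smul_add, Finset.sum_add_distrib]

theorem conjPow_smul (f : A) (s c : K) (n : ℕ)
    (X : Module.End K (Localization (Submonoid.powers f))) :
    conjPow f s n (c • X) = c • conjPow f s n X := by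
  simp only [conjPow, map_smul, Finset.smul_sum]
  exact Finset.sum_congr rfl fun i _ => smul_comm _ _ _

theorem fsAct_one (f : A) (s : K) : fsAct f s 1 = 1 := by
  have h : ord (1 : DRing K A) = 0 :=
    Nat.le_zero.1 (ord_le (by rw [map_one, mem_zero]; intro r; ext x; simp))
  rw [fsAct, h]
  simp [binom, iterComm]

theorem fsAct_mul [CharZero K] (f : A) (s : K) (α β : DRing K A) :
    fsAct f s (α * β) = fsAct f s α * fsAct f s β := by
  obtain ⟨n, h1, h2, h3⟩ : ∃ n, ord α < n ∧ ord β < n ∧ ord (α * β) < n :=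
    ⟨ord α + ord β + ord (α * β) + 1, by omega, by omega, by omega⟩
  rw [fsAct_eq f s α n h1, fsAct_eq f s β n h2, fsAct_eq f s (α * β) n h3, map_mul]
  refine conjPow_mul f s n _ _ (fun i hi => conjSub_pow_eq_zero f α i (by omega))
    (fun i hi => conjSub_pow_eq_zero f β i (by omega)) fun i hi => ?_
  rw [← map_mul]
  exact conjSub_pow_eq_zero f _ i (by omega)

theorem fsAct_add (f : A) (s : K) (α β : DRing K A) :
    fsAct f s (α + β) = fsAct f s α + fsAct f s β := by
  obtain ⟨n, h1, h2, h3⟩ : ∃ n, ord α < n ∧ ord β < n ∧ ord (α + β) < n :=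
    ⟨ord α + ord β + ord (α + β) + 1, by omega, by omega, by omega⟩
  rw [fsAct_eq f s α n h1, fsAct_eq f s β n h2, fsAct_eq f s (α + β) n h3, map_add, conjPow_add]

theorem fsAct_smul (f : A) (s c : K) (α : DRing K A) :
    fsAct f s (c • α) = c • fsAct f s α := by
  obtain ⟨n, h1, h3⟩ : ∃ n, ord α < n ∧ ord (c • α) < n :=
    ⟨ord α + ord (c • α) + 1, by omega, by omega⟩
  rw [fsAct_eq f s α n h1, fsAct_eq f s (c • α) n h3, map_smul, conjPow_smul]

/-- The action of `D_{A|K}` on `A_f · f^s`, as a homomorphism of algebras. -/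
noncomputable def fsHom [CharZero K] (f : A) (s : K) :
    DRing K A →ₐ[K] Module.End K (Localization (Submonoid.powers f)) :=
  AlgHom.ofLinearMap
    { toFun := fsAct f s
      map_add' := fsAct_add f s
      map_smul' := fun c α => fsAct_smul f s c α }
    (fsAct_one f s) (fsAct_mul f s)

/-- The `D_{A|K}`-module `A_f · f^s` for `f ∈ A` and `s ∈ K`: the elements are `u f^s` with `u` in
`A_f`, where `f^s` is a formal symbol, and `D_{A|K}` acts by `fsAct`. -/
def FsModule {K A : Type*} [CommRing A] (f : A) (_ : K) : Type _ :=
  Localization (Submonoid.powers f)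

noncomputable instance (f : A) (s : K) : AddCommGroup (FsModule f s) :=
  inferInstanceAs (AddCommGroup (Localization (Submonoid.powers f)))

noncomputable instance (f : A) (s : K) : Module K (FsModule f s) :=
  inferInstanceAs (Module K (Localization (Submonoid.powers f)))

noncomputable instance [CharZero K] (f : A) (s : K) : Module (DRing K A) (FsModule f s) :=
  Module.compHom (Localization (Submonoid.powers f)) (fsHom f s).toRingHom

theorem FsModule.smul_def [CharZero K] {f : A} {s : K} (δ : DRing K A) (x : FsModule f s) :
    δ • x = (fsAct f s δ (x : Localization (Submonoid.powers f)) :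
      Localization (Submonoid.powers f)) := rfl

instance [CharZero K] (f : A) (s : K) : IsScalarTower K (DRing K A) (FsModule f s) where
  smul_assoc c δ x := by
    rw [FsModule.smul_def, FsModule.smul_def, fsAct_smul]
    rfl

end Fs

/-! ### Base change of differential operators -/

section BaseChange

open scoped TensorProduct

variable {k R : Type*} [Field k] [CommRing R] [Algebra k R] (K : Type*) [Field K] [Algebra k K]

theorem baseChange_mem (n : ℕ) : ∀ P ∈ diffOpLE k R R n,
    P.baseChange K ∈ diffOpLE K (K ⊗[k] R) (K ⊗[k] R) n := by
  have key : ∀ (P : Module.End k R) (c : K) (r : R),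
      bracket K (K ⊗[k] R) (K ⊗[k] R) (c ⊗ₜ r) (P.baseChange K)
        = c • (bracket k R R r P).baseChange K := by
    intro P c r
    ext x
    simp [bracket_apply, TensorProduct.tmul_sub, TensorProduct.smul_tmul', smul_sub]
  have key0 : ∀ Q : Module.End K (K ⊗[k] R),
      bracket K (K ⊗[k] R) (K ⊗[k] R) 0 Q = 0 := fun Q => by ext x; simp
  have keya : ∀ (Q : Module.End K (K ⊗[k] R)) (z z' : K ⊗[k] R),
      bracket K (K ⊗[k] R) (K ⊗[k] R) (z + z') Q
        = bracket K (K ⊗[k] R) (K ⊗[k] R) z Q + bracket K (K ⊗[k] R) (K ⊗[k] R) z' Q := by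
    intro Q z z'
    simp only [bracket_eq, map_add, mul_add, add_mul]
    abel
  induction n with
  | zero =>
    intro P hP
    rw [mem_zero] at hP ⊢
    intro z
    induction z with
    | zero => exact key0 _
    | tmul c r => rw [key, hP r]; simp
    | add z z' h h' => rw [keya, h, h', add_zero]
  | succ n ih =>
    intro P hP
    rw [mem_succ] at hP ⊢
    intro z
    induction z with
    | zero => rw [key0]; exact zero_mem _
    | tmul c r => rw [key]; exact Submodule.smul_mem _ c (ih _ (hP r))
    | add z z' h h' => rw [keya]; exact add_mem h h'

/-- The differential operator `id_K ⊗ δ` on `K ⊗ R`. -/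
noncomputable def DRing.baseChange (δ : DRing k R) : DRing K (K ⊗[k] R) :=
  DRing.mk (δ.toEnd.baseChange K) (ord δ) (baseChange_mem K (ord δ) _ (mem_ord δ))

/-- The filtration `K ⊗ F_i` on `D_{K ⊗ R | K}` obtained from a filtration `F` on `D_{R|k}`. -/
noncomputable def baseChangeFilt (F : ℕ → Submodule k (DRing k R)) (i : ℕ) :
    Submodule K (DRing K (K ⊗[k] R)) :=
  Submodule.span K (DRing.baseChange K '' (F i : Set (DRing k R)))

end BaseChange

/-! ### Graded algebras -/

section Graded

variable {k R : Type*} [Field k] [CommRing R] [Algebra k R] (𝒜 : ℕ → Submodule k R)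

/-- The graded piece of degree `n ∈ ℤ`, which is zero for negative `n`. -/
def intPiece (n : ℤ) : Submodule k R := if 0 ≤ n then 𝒜 n.toNat else ⊥

/-- The differential operator `δ` is homogeneous of degree `d ∈ ℤ`: `δ(R_i) ⊆ R_{i + d}` for all `i`. -/
def IsHomogeneousOp (δ : DRing k R) (d : ℤ) : Prop :=
  ∀ i : ℕ, ∀ x ∈ 𝒜 i, δ.toEnd x ∈ intPiece 𝒜 ((i : ℤ) + d)

/-- The generalized Bernstein filtration of slope `a` on `D_{R|k}`: its `i`-th term is the `k`-span of
the homogeneous operators `δ` with `deg δ + a ord δ ≤ i`. -/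
noncomputable def genBernstein (a : ℝ) (i : ℕ) : Submodule k (DRing k R) :=
  Submodule.span k {δ | ∃ d : ℤ, IsHomogeneousOp 𝒜 δ d ∧ (d : ℝ) + a * (ord δ : ℝ) ≤ (i : ℝ)}

/-- The homogeneous maximal ideal `𝔪 = ⨁_{i > 0} R_i`. -/
noncomputable def maxIdeal [GradedAlgebra 𝒜] : Ideal R := (HomogeneousIdeal.irrelevant 𝒜).toIdeal

/-- The number `w = max {t | [𝔪 / 𝔪²]_t ≠ 0}`, the largest degree of a minimal homogeneous generator
of `R` (it is `0` if `𝔪 = 0`). The condition on `t` says that `[𝔪]_t` is not contained in `𝔪²`. -/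
noncomputable def genDegree [GradedAlgebra 𝒜] : ℕ :=
  sSup {t | ∃ x ∈ 𝒜 t, x ∈ maxIdeal 𝒜 ∧ x ∉ maxIdeal 𝒜 ^ 2}

/-- The Krull dimension as a natural number; it is finite for finitely generated nonzero algebras
over a field, see `coe_krullDim`. -/
noncomputable def krullDim (R : Type*) [CommRing R] : ℕ := ((ringKrullDim R).unbotD 0).toNat

theorem coe_krullDim (k R : Type*) [Field k] [CommRing R] [Algebra k R] [Nontrivial R]
    [Algebra.FiniteType k R] : ringKrullDim R = (krullDim R : WithBot ℕ∞) := by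
  obtain ⟨n, f, hf⟩ := Algebra.FiniteType.iff_quotient_mvPolynomial''.1
    (inferInstance : Algebra.FiniteType k R)
  have h1 : ringKrullDim R ≤ (n : WithBot ℕ∞) := by
    refine (ringKrullDim_le_of_surjective f.toRingHom hf).trans ?_
    simp [MvPolynomial.ringKrullDim_of_isNoetherianRing]
  have h2 : (0 : WithBot ℕ∞) ≤ ringKrullDim R := ringKrullDim_nonneg_of_nontrivial
  unfold krullDim
  generalize ringKrullDim R = d at *
  induction d with
  | bot => simp at h2
  | coe d =>
    have h3 : d ≤ (n : ℕ∞) := by exact_mod_cast h1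
    have h4 : d ≠ ⊤ := ne_top_of_le_ne_top (ENat.natCast_ne_top n) h3
    lift d to ℕ using h4
    rfl

/-- The `i`-th differential power `{f | δ(f) ∈ J for all δ of order ≤ i - 1}` of an ideal `J`, for
positive `i`. -/
def differentialPower (k : Type*) {R : Type*} [Field k] [CommRing R] [Algebra k R] (J : Ideal R)
    (i : ℕ) : Ideal R where
  carrier := {f | ∀ P ∈ diffOpLE k R R (i - 1), P f ∈ J}
  zero_mem' := fun P _ => by rw [map_zero]; exact J.zero_mem
  add_mem' := fun {x y} hx hy P hP => by rw [map_add]; exact J.add_mem (hx P hP) (hy P hP)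
  smul_mem' := fun r x hx P hP => by
    have h := hx (P * Algebra.lsmul k k R r) (by
      simpa using mul_mem_diffOpLE hP (lsmul_mem (k := k) (M := R) r))
    simpa using h

/-- The differential signature `limsup d! dim_k (R / 𝔪⟨i⟩) / i ^ d`, where `d = dim R`. -/
noncomputable def diffSignature [GradedAlgebra 𝒜] : ENNReal :=
  Filter.limsup (fun i : ℕ =>
    ((krullDim R).factorial : ENNReal) *
      (Module.finrank k (R ⧸ differentialPower k (maxIdeal 𝒜) i) : ENNReal) /
      (i : ENNReal) ^ krullDim R) Filter.atTop

/-- `R` is a Bernstein algebra: `D_{R|k}` with a generalized Bernstein filtration is linearly simple,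
has dimension `2 dim R`, and has finite positive multiplicity. These conditions do not depend on
the slope of the filtration, and we demand them for all slopes. -/
def IsBernsteinAlgebra [GradedAlgebra 𝒜] : Prop :=
  ∀ a : ℝ, (genDegree 𝒜 : ℝ) < a →
    IsLinearlySimple (genBernstein 𝒜 a) ∧
    filtDim (genBernstein 𝒜 a) = 2 * (krullDim R : ENNReal) ∧
    0 < filtMult (genBernstein 𝒜 a) ∧ filtMult (genBernstein 𝒜 a) < ⊤

end Graded

end BernsteinAlg

namespace BernsteinAlg

open scoped TensorProduct ENNReal NNReal
open Filter Topology

/-! ### Polynomial growth, dimension and multiplicity of filtrations. -/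

section Growth

variable {k : Type*} [Field k] {V : Type*} [AddCommGroup V] [Module k V] {G : ℕ → Submodule k V}

/-! Write d = dim R. Linear simplicity bounds the growth of D from above by i^(2d), and the
differential signature bounds it from below by the same power.

Upper bound. Let G be a compatible filtration of a module with an element x ≠ 0 in G_{i₀}. If δ ∈
F_i kills G_{Ci+i₀}, it kills F_{Ci} x, and 1 ∈ F_{Ci} δ F_{Ci} gives x = 0 unless δ = 0. So F_i
embeds into Hom(G_{Ci+i₀}, G_{(C+1)i+i₀}), and growth i^t of G forces growth at most i^(2t) of F
(`exists_bound_sq_of_linearlySimple`). For R filtered by degree, dim R_{≤n} = O(n^d) by Noether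
normalization (`exists_growth`), hence the exponent 2d. Read backwards this is Bernstein's
inequality: a nonzero module has dimension at least d, so a compatible filtration of growth O(i^d)
already proves holonomicity (`isHolonomic_of_hasGrowth`).

Lower bound. A homogeneous basis of R/𝔪⟨n⟩ has dual operators of order at most n - 1. Multiplying
them by R_{≤L} gives dim(R/𝔪⟨n⟩) · dim R_{≤L} independent dimensions in B_{L+An}
(`finrank_mul_le_finrank_genBernstein`). With L proportional to n, a positive signature yields const
· i^(2d) for infinitely many i.

Slope. An operator of order at most n vanishing on R_{≤wn} is zero, so a nonzero homogeneous one has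
degree at least -wn. For slopes above w the orders in B_i are therefore O(i); the B_i are
finite-dimensional, and filtrations of different slopes are linearly equivalent
(`genBernstein_le_slope`).

Modules. An operator of order n raises the pole order along f by at most n and the degree of the
numerator by an amount independent of the pole (`extend_bound`). Elements with denominator f^(ci)
and numerator of degree at most c'i then form a compatible filtration of growth O(i^d). The same
estimate holds for the twisted action on f^s, and Čech cohomology is a subquotient of a finite
product of localizations. For f^s the scalars are extended to k(s): dimensions do not change, and
linear simplicity survives because a counterexample over k(s) specializes to one over k
(`isLinearlySimple_baseChangeFilt`). -/

theorem filtDim_le_of_bound {C : ℝ} {D : ℝ≥0}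
    (h : ∀ᶠ i : ℕ in atTop, (Module.finrank k (G i) : ℝ) ≤ C * (i : ℝ) ^ (D : ℝ)) :
    filtDim G ≤ D := by
  -- A bound O(i^D) does not make the quotient by i^D tend to zero, so the exponents D + ε are
  -- tested instead.
  refine ENNReal.le_of_forall_pos_le_add fun ε hε _ => ?_
  rw [← ENNReal.coe_add]
  refine iInf₂_le (D + ε) ?_
  have h1 : Tendsto (fun i : ℕ => C * (i : ℝ) ^ (-(ε : ℝ))) atTop (𝓝 0) := by
    simpa using ((tendsto_rpow_neg_atTop (NNReal.coe_pos.2 hε)).comp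
      tendsto_natCast_atTop_atTop).const_mul C
  refine squeeze_zero' (Eventually.of_forall fun i => by positivity) ?_ h1
  filter_upwards [h, eventually_gt_atTop 0] with i hi hi0
  have hi0' : (0 : ℝ) < i := by exact_mod_cast hi0
  rw [div_le_iff₀ (by positivity), mul_assoc, ← Real.rpow_add hi0']
  simpa using hi

/-- An exponent t < D would make the quotient by i^t eventually smaller than c, against the bound at
a large index where it holds. Infinitely many indices suffice, which is all that a positive limsup
provides. -/
theorem le_filtDim_of_frequently {c : ℝ} (hc : 0 < c) {D : ℝ≥0}
    (h : ∃ᶠ i : ℕ in atTop, c * (i : ℝ) ^ (D : ℝ) ≤ (Module.finrank k (G i) : ℝ)) :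
    (D : ℝ≥0∞) ≤ filtDim G := by
  refine le_iInf₂ fun t ht => ?_
  by_contra! hlt
  have hlt' : (t : ℝ) ≤ D := by exact_mod_cast hlt.le
  have h1 : ∀ᶠ i : ℕ in atTop, (Module.finrank k (G i) : ℝ) / (i : ℝ) ^ (t : ℝ) < c :=
    (tendsto_order.1 ht).2 c hc
  obtain ⟨i, hi, hi2, hi1⟩ := (h.and_eventually (h1.and (eventually_ge_atTop 1))).exists
  have hi1' : (1 : ℝ) ≤ i := by exact_mod_cast hi1
  have hpos : (0 : ℝ) < (i : ℝ) ^ (t : ℝ) := Real.rpow_pos_of_pos (by linarith) _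
  rw [div_lt_iff₀ hpos] at hi2
  have := mul_le_mul_of_nonneg_left (Real.rpow_le_rpow_of_exponent_le hi1' hlt') hc.le
  linarith

theorem filtMult_lt_top_of_bound {C : ℝ} {D : ℝ≥0} (hD : filtDim G = D)
    (h : ∀ᶠ i : ℕ in atTop, (Module.finrank k (G i) : ℝ) ≤ C * (i : ℝ) ^ (D : ℝ)) :
    filtMult G < ⊤ := by
  rw [filtMult, if_neg (by simp [hD]), hD, ENNReal.coe_toReal]
  refine lt_of_le_of_lt (limsup_le_of_le (a := ENNReal.ofReal C) (by isBoundedDefault) ?_)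
    ENNReal.ofReal_lt_top
  filter_upwards [h, eventually_gt_atTop 0] with i hi hi0
  have hi0' : (0 : ℝ) < i := by exact_mod_cast hi0
  refine ENNReal.div_le_of_le_mul ?_
  rw [← ENNReal.ofReal_natCast, ← ENNReal.ofReal_natCast, ENNReal.ofReal_rpow_of_pos hi0',
    ← ENNReal.ofReal_mul' (by positivity)]
  exact ENNReal.ofReal_le_ofReal hi

theorem filtMult_pos_of_frequently {c : ℝ} (hc : 0 < c) {D : ℝ≥0} (hD : filtDim G = D)
    (h : ∃ᶠ i : ℕ in atTop, c * (i : ℝ) ^ (D : ℝ) ≤ (Module.finrank k (G i) : ℝ)) :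
    0 < filtMult G := by
  rw [filtMult, if_neg (by simp [hD]), hD, ENNReal.coe_toReal]
  refine lt_of_lt_of_le (ENNReal.ofReal_pos.2 hc)
    (le_limsup_of_frequently_le ?_ (by isBoundedDefault))
  refine (h.and_eventually (eventually_gt_atTop 0)).mono ?_
  rintro i ⟨hi, hi0⟩
  have hi0' : (0 : ℝ) < i := by exact_mod_cast hi0
  rw [ENNReal.le_div_iff_mul_le (by left; simp [hi0.ne']) (by left; simp [hi0.ne']),
    ← ENNReal.ofReal_natCast, ← ENNReal.ofReal_natCast, ENNReal.ofReal_rpow_of_pos hi0',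
    ← ENNReal.ofReal_mul hc.le]
  exact ENNReal.ofReal_le_ofReal hi

theorem exists_bound_of_tendsto {t : ℝ≥0}
    (h : Tendsto (fun i : ℕ => (Module.finrank k (G i) : ℝ) / (i : ℝ) ^ (t : ℝ)) atTop (𝓝 0)) :
    ∀ᶠ i : ℕ in atTop, (Module.finrank k (G i) : ℝ) ≤ (i : ℝ) ^ (t : ℝ) := by
  filter_upwards [(tendsto_order.1 h).2 1 one_pos, eventually_gt_atTop 0] with i hi hi0
  have hi0' : (0 : ℝ) < i := by exact_mod_cast hi0
  rw [div_lt_one (by positivity)] at hi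
  exact hi.le

end Growth

/-! ### Bernstein's inequality and a growth criterion for holonomicity. -/

section Bernstein

variable {k : Type*} [Field k] {A : Type*} [Ring A] [Algebra k A] {F : ℕ → Submodule k A}
  {M : Type*} [AddCommGroup M] [Module k M] [Module A M] [IsScalarTower k A M]
  {G : ℕ → Submodule k M}

/-- Writing 1 as a sum of products p δ q with q ∈ W gives x = ∑ p δ (q x) = 0. -/
theorem eq_zero_of_kills {U W : Submodule k A} {δ : A} (h1 : (1 : A) ∈ U * Submodule.span k {δ} * W)
    {x : M} (hx : ∀ q ∈ W, δ • q • x = 0) : x = 0 := by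
  have key : ∀ z ∈ U * Submodule.span k {δ} * W, z • x = 0 := by
    intro z hz
    induction hz using Submodule.mul_induction_on' with
    | mem_mul_mem m hm q hq =>
      induction hm using Submodule.mul_induction_on' with
      | mem_mul_mem p hp d hd =>
        obtain ⟨c, rfl⟩ := Submodule.mem_span_singleton.1 hd
        rw [mul_smul, mul_smul, smul_assoc, hx q hq, smul_zero, smul_zero]
      | add y _ z _ hy hz => rw [add_mul, add_smul, hy, hz, add_zero]
    | add y _ z _ hy hz => rw [add_smul, hy, hz, add_zero]
  simpa using key 1 h1

/-- The dimension estimate behind Bernstein's inequality. -/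
theorem finrank_le_mul_of_linearlySimple [Nontrivial M] (hG : IsModFiltration F G) {C : ℕ}
    (hC : ∀ i, ∀ δ ∈ F i, δ ≠ 0 → (1 : A) ∈ F (C * i) * Submodule.span k {δ} * F (C * i)) :
    ∃ i₀ : ℕ, ∀ i, Module.finrank k (F i)
      ≤ Module.finrank k (G (C * i + i₀)) * Module.finrank k (G (i + (C * i + i₀))) := by
  obtain ⟨x, hx⟩ := exists_ne (0 : M)
  obtain ⟨i₀, hi₀⟩ := hG.exhaustive x
  refine ⟨i₀, fun i => ?_⟩
  have := hG.finite
  -- The index C i + i₀ leaves room for F (C i) • x, on which an operator in the kernel of Θ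
  -- vanishes; linear simplicity then forces x = 0 unless that operator is zero.
  let Θ : F i →ₗ[k] G (C * i + i₀) →ₗ[k] G (i + (C * i + i₀)) :=
    LinearMap.mk₂ k (fun a y => ⟨a.1 • y.1, hG.smul_mem _ _ _ a.2 _ y.2⟩)
      (fun a b y => Subtype.ext (add_smul a.1 b.1 y.1))
      (fun c a y => Subtype.ext (smul_assoc c a.1 y.1))
      (fun a y z => Subtype.ext (smul_add a.1 y.1 z.1))
      (fun c a y => Subtype.ext (by
        change a.1 • (c • y.1) = c • (a.1 • y.1)
        rw [← algebraMap_smul A c y.1, ← mul_smul, ← Algebra.commutes, mul_smul, algebraMap_smul]))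
  have hinj : Function.Injective Θ := by
    rw [injective_iff_map_eq_zero]
    intro a ha
    by_contra hne
    refine hx (eq_zero_of_kills (hC i a.1 a.2 fun h => hne (Subtype.ext h)) fun q hq => ?_)
    exact congrArg Subtype.val (LinearMap.congr_fun ha ⟨q • x, hG.smul_mem _ _ _ hq _ hi₀⟩)
  refine (LinearMap.finrank_le_finrank_of_injective hinj).trans ?_
  rw [Module.finrank_linearMap]

theorem tendsto_mul_add_atTop {C : ℕ} (hC : 0 < C) (i₀ : ℕ) :
    Tendsto (fun i : ℕ => C * i + i₀) atTop atTop :=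
  tendsto_atTop_mono (fun i => by dsimp only [id]; nlinarith [Nat.zero_le i₀]) tendsto_id

/-- If the terms of a compatible filtration grow at most like `i ^ t`, then the terms of a linearly
simple filtration grow at most like `i ^ (2 t)`. -/
theorem exists_bound_sq_of_linearlySimple [Nontrivial M] (hF : IsLinearlySimple F)
    (hG : IsModFiltration F G) {K : ℝ} {t : ℝ≥0}
    (h : ∀ᶠ i : ℕ in atTop, (Module.finrank k (G i) : ℝ) ≤ K * (i : ℝ) ^ (t : ℝ)) :
    ∃ K' : ℝ, ∀ᶠ i : ℕ in atTop,
      (Module.finrank k (F i) : ℝ) ≤ K' * (i : ℝ) ^ ((2 * t : ℝ≥0) : ℝ) := by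
  obtain ⟨C, hC0, hC⟩ := hF
  obtain ⟨i₀, hi₀⟩ := finrank_le_mul_of_linearlySimple hG hC
  -- For i ≥ 1 both C i + i₀ and (C + 1) i + i₀ are at most B i. The absolute value of K appears
  -- because the sign of K is not known.
  let B : ℕ := C + 1 + i₀
  refine ⟨(|K| * (B : ℝ) ^ (t : ℝ)) * (|K| * (B : ℝ) ^ (t : ℝ)), ?_⟩
  have e1 := (tendsto_mul_add_atTop hC0 i₀).eventually h
  have e2 := (tendsto_mul_add_atTop (C := C + 1) (by omega) i₀).eventually h
  filter_upwards [e1, e2, eventually_ge_atTop 1] with i h1 h2 h3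
  have h3' : (0 : ℝ) < i := by exact_mod_cast h3
  have aux : ∀ m : ℕ, m ≤ B * i → (Module.finrank k (G m) : ℝ) ≤ K * (m : ℝ) ^ (t : ℝ) →
      (Module.finrank k (G m) : ℝ) ≤ |K| * (B : ℝ) ^ (t : ℝ) * (i : ℝ) ^ (t : ℝ) := by
    intro m hm hm2
    have hm' : (m : ℝ) ≤ B * i := by exact_mod_cast hm
    rw [mul_assoc, ← Real.mul_rpow (by positivity) (by positivity)]
    refine hm2.trans ?_
    gcongr
    exact le_abs_self K
  have a1 := aux (C * i + i₀) (by simp only [B]; nlinarith) h1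
  have a2 := aux ((C + 1) * i + i₀) (by simp only [B]; nlinarith) h2
  have e3 : i + (C * i + i₀) = (C + 1) * i + i₀ := by ring
  have h4 := hi₀ i
  rw [e3] at h4
  have h4' : (Module.finrank k (F i) : ℝ) ≤ Module.finrank k (G (C * i + i₀)) *
    Module.finrank k (G ((C + 1) * i + i₀)) := by exact_mod_cast h4
  refine h4'.trans ((mul_le_mul a1 a2 (by positivity) (by positivity)).trans (le_of_eq ?_))
  rw [NNReal.coe_mul, NNReal.coe_ofNat, two_mul, Real.rpow_add h3']
  ring

/-- Bernstein's inequality: twice any exponent admissible for G bounds Dim F, and then the infimum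
over these exponents is taken. -/
theorem filtDim_le_two_mul [Nontrivial M] (hF : IsLinearlySimple F) (hG : IsModFiltration F G) :
    filtDim F ≤ 2 * filtDim G := by
  conv_rhs => rw [filtDim]
  rw [ENNReal.mul_iInf_of_ne (by simp) (by simp)]
  refine le_iInf fun t => ?_
  rw [ENNReal.mul_iInf_of_ne (by simp) (by simp)]
  refine le_iInf fun ht => ?_
  obtain ⟨K, hK⟩ := exists_bound_sq_of_linearlySimple hF hG (K := 1) (t := t)
    (by simpa using exists_bound_of_tendsto ht)
  simpa using filtDim_le_of_bound hK

/-- `M` has a compatible filtration whose terms have dimension `O(i ^ d)`. -/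
def HasGrowth (F : ℕ → Submodule k A) (d : ℕ) (M : Type*) [AddCommGroup M] [Module k M]
    [Module A M] : Prop :=
  ∃ G : ℕ → Submodule k M, IsModFiltration F G ∧
    ∃ C : ℕ, ∀ i, Module.finrank k (G i) ≤ C * (i + 1) ^ d

theorem eventually_bound_of_nat {V : Type*} [AddCommGroup V] [Module k V] {G : ℕ → Submodule k V}
    {C d : ℕ} (h : ∀ i, Module.finrank k (G i) ≤ C * (i + 1) ^ d) :
    ∀ᶠ i : ℕ in atTop, (Module.finrank k (G i) : ℝ) ≤
      (C * 2 ^ d : ℝ) * (i : ℝ) ^ (((d : ℝ≥0) : ℝ≥0) : ℝ) := by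
  filter_upwards [eventually_ge_atTop 1] with i hi
  have h1 : (Module.finrank k (G i) : ℝ) ≤ C * (i + 1) ^ d := by exact_mod_cast h i
  have hi' : (1 : ℝ) ≤ i := by exact_mod_cast hi
  rw [NNReal.coe_natCast, Real.rpow_natCast, mul_assoc, ← mul_pow]
  refine h1.trans ?_
  gcongr
  linarith

/-- Growth O(i^d) gives Dim G ≤ d and Bernstein's inequality gives the converse, so no lower bound
on a module has to be found by hand. The inequality needs a nonzero module; the zero module is
holonomic by definition. -/
theorem isHolonomic_of_hasGrowth {d : ℕ} (hF : IsHolonomicSetting F)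
    (hd : filtDim F = 2 * (d : ℝ≥0∞)) (h : HasGrowth F d M) : IsHolonomic F M := by
  refine ⟨hF, ?_⟩
  rcases subsingleton_or_nontrivial M with hM | hM
  · exact Or.inl hM
  obtain ⟨G, hG, C, hC⟩ := h
  have h1 := eventually_bound_of_nat hC
  have h2 : filtDim G = ((d : ℝ≥0) : ℝ≥0∞) := by
    refine le_antisymm (filtDim_le_of_bound h1) ?_
    have h3 := filtDim_le_two_mul hF.linearlySimple hG
    rw [hd] at h3
    exact (ENNReal.mul_le_mul_iff_right (a := 2) (by simp) (by simp)).1 (by simpa using h3)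
  refine Or.inr ⟨G, hG, ?_, filtMult_lt_top_of_bound h2 h1⟩
  rw [hd, h2, mul_comm, ENNReal.mul_div_cancel_right (by simp) (by simp)]
  simp

/-- This and the next two closure properties use the preimage, image and product filtrations. The
growth bound is demanded at every index, with i + 1 in place of i so that i = 0 is harmless, and
therefore passes on term by term. -/
theorem HasGrowth.of_injective {d : ℕ} {N : Type*} [AddCommGroup N] [Module k N] [Module A N]
    [IsScalarTower k A N] (f : N →ₗ[A] M) (hf : Function.Injective f)
    (h : HasGrowth F d M) : HasGrowth F d N := by
  obtain ⟨G, hG, C, hC⟩ := h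
  let g : N →ₗ[k] M := f.restrictScalars k
  have hg : ∀ i, Function.Injective (g.restrict (p := (G i).comap g) (q := G i)
      fun x (hx : x ∈ (G i).comap g) => hx) :=
    fun i x y hxy => Subtype.ext (hf (congrArg Subtype.val hxy))
  have := hG.finite
  refine ⟨fun i => (G i).comap g, ⟨fun i j h x hx => hG.mono h hx,
    fun x => hG.exhaustive (g x), fun i => Module.Finite.of_injective _ (hg i),
    fun i j a ha x hx => ?_⟩, C, fun i =>
      (LinearMap.finrank_le_finrank_of_injective (hg i)).trans (hC i)⟩
  change f (a • x) ∈ G (i + j)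
  rw [map_smul]
  exact hG.smul_mem i j a ha _ hx

theorem HasGrowth.of_surjective {d : ℕ} {N : Type*} [AddCommGroup N] [Module k N] [Module A N]
    [IsScalarTower k A N] (f : M →ₗ[A] N) (hf : Function.Surjective f)
    (h : HasGrowth F d M) : HasGrowth F d N := by
  obtain ⟨G, hG, C, hC⟩ := h
  let g : M →ₗ[k] N := f.restrictScalars k
  have := hG.finite
  refine ⟨fun i => (G i).map g, ⟨fun i j h => Submodule.map_mono (hG.mono h),
    fun x => ?_, fun i => inferInstance,
    fun i j a ha x hx => ?_⟩, C, fun i => (Submodule.finrank_map_le g (G i)).trans (hC i)⟩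
  · obtain ⟨y, rfl⟩ := hf x
    obtain ⟨i, hi⟩ := hG.exhaustive y
    exact ⟨i, y, hi, rfl⟩
  · obtain ⟨y, hy, rfl⟩ := hx
    exact ⟨a • y, hG.smul_mem i j a ha y hy, map_smul f a y⟩

theorem HasGrowth.pi {d : ℕ} {ι : Type*} [Fintype ι] {N : ι → Type*} [∀ t, AddCommGroup (N t)]
    [∀ t, Module k (N t)] [∀ t, Module A (N t)] [∀ t, IsScalarTower k A (N t)]
    (h : ∀ t, HasGrowth F d (N t)) : HasGrowth F d (∀ t, N t) := by
  choose G hG C hC using h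
  have := fun t => (hG t).finite
  let e : ∀ i, (Submodule.pi Set.univ fun t => G t i) →ₗ[k] ∀ t, G t i := fun i =>
    { toFun := fun x t => ⟨x.1 t, x.2 t trivial⟩
      map_add' := fun _ _ => rfl
      map_smul' := fun _ _ => rfl }
  have he : ∀ i, Function.Injective (e i) := fun i x y hxy => Subtype.ext (funext fun t =>
    congrArg Subtype.val (congrFun hxy t))
  refine ⟨fun i => Submodule.pi Set.univ fun t => G t i, ⟨fun i j h x hx t _ =>
    (hG t).mono h (hx t trivial), fun x => ?_, fun i => Module.Finite.of_injective _ (he i),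
    fun i j a ha x hx t _ => (hG t).smul_mem i j a ha _ (hx t trivial)⟩, ∑ t, C t, fun i => ?_⟩
  · choose n hn using fun t => (hG t).exhaustive (x t)
    exact ⟨Finset.univ.sup n, fun t _ => (hG t).mono (Finset.le_sup (Finset.mem_univ t)) (hn t)⟩
  · refine (LinearMap.finrank_le_finrank_of_injective (he i)).trans ?_
    rw [Module.finrank_pi_fintype, Finset.sum_mul]
    exact Finset.sum_le_sum fun t _ => hC t i

end Bernstein

/-! ### Krull dimension under integral extensions. -/

section KrullDim

/-- An injective integral extension of rings preserves the Krull dimension. -/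
theorem ringKrullDim_eq_of_integral_injective {A B : Type*} [CommRing A] [CommRing B] [Algebra A B]
    [Algebra.IsIntegral A B] (hinj : Function.Injective (algebraMap A B)) :
    ringKrullDim B = ringKrullDim A := by
  -- Incomparability: contraction of primes is strictly monotone.
  refine le_antisymm (Order.krullDim_le_of_strictMono (PrimeSpectrum.comap (algebraMap A B))
    fun P Q h => Ideal.IsIntegral.comap_lt_comap (R := A) (I := P.asIdeal) (J := Q.asIdeal) h) ?_
  have hfaith : FaithfulSMul A B := (faithfulSMul_iff_algebraMap_injective A B).2 hinj
  -- Chains of primes lift: lying over for the first prime, going up for each further one.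
  have key : ∀ n : ℕ, ∀ p : LTSeries (PrimeSpectrum A), p.length = n →
      ∃ q : LTSeries (PrimeSpectrum B), q.length = n ∧
        PrimeSpectrum.comap (algebraMap A B) q.last = p.last := by
    intro n
    induction n with
    | zero =>
      intro p _
      obtain ⟨Q, hQ⟩ := Ideal.nonempty_primesOver (S := B) p.last.asIdeal
      have := hQ.1
      exact ⟨RelSeries.singleton _ ⟨Q, hQ.1⟩, rfl, PrimeSpectrum.ext hQ.2.over.symm⟩
    | succ n ih =>
      intro p hp
      obtain ⟨q, hq, hql⟩ := ih p.eraseLast (by simp [hp])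
      have hlt : p.eraseLast.last < p.last := p.eraseLast_last_rel_last (by omega)
      have hqle : (q.last.asIdeal).comap (algebraMap A B) ≤ p.last.asIdeal := by
        have : (q.last.asIdeal).comap (algebraMap A B) = p.eraseLast.last.asIdeal :=
          congrArg PrimeSpectrum.asIdeal hql
        rw [this]
        exact hlt.le
      obtain ⟨Q, hQ1, hQ2, hQ3⟩ := Ideal.exists_ideal_over_prime_of_isIntegral_of_isPrime
        p.last.asIdeal q.last.asIdeal hqle
      have hQ : PrimeSpectrum.comap (algebraMap A B) ⟨Q, hQ2⟩ = p.last := PrimeSpectrum.ext hQ3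
      have hlt2 : q.last < ⟨Q, hQ2⟩ := by
        refine lt_of_le_of_ne hQ1 fun h => ?_
        rw [h, hQ] at hql
        exact hlt.ne' hql
      exact ⟨q.snoc ⟨Q, hQ2⟩ hlt2, by simp [hq], by simpa using hQ⟩
  refine iSup_le fun p => ?_
  obtain ⟨q, hq, -⟩ := key p.length p rfl
  rw [← hq]
  exact le_iSup (fun q : LTSeries (PrimeSpectrum B) => (q.length : WithBot ℕ∞)) q

end KrullDim

/-! ### Growth of finitely generated algebras by Noether normalization. -/

section Growth

variable {k R : Type*} [Field k] [CommRing R] [Algebra k R]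

theorem finrank_mul_le (U V : Submodule k R) [Module.Finite k U] [Module.Finite k V] :
    Module.finrank k (U * V : Submodule k R) ≤ Module.finrank k U * Module.finrank k V := by
  have h := LinearMap.finrank_range_le (Submodule.mulMap U V)
  rwa [Submodule.mulMap_range, Module.finrank_tensorProduct] at h

/-- Bounding each exponent separately, rather than the total degree, turns the monomials into a box
and makes the count an exact power. -/
theorem finrank_restrictDegree (s n : ℕ) :
    Module.finrank k (MvPolynomial.restrictDegree (Fin s) k n) = (n + 1) ^ s := by
  let e : {f : Fin s →₀ ℕ | ∀ i, f i ≤ n} ≃ (Fin s → Fin (n + 1)) :=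
    { toFun := fun f i => ⟨f.1 i, Nat.lt_succ_of_le (f.2 i)⟩
      invFun := fun f => ⟨Finsupp.equivFunOnFinite.symm fun i => (f i : ℕ),
        fun i => Nat.le_of_lt_succ (f i).2⟩
      left_inv := fun f => Subtype.ext (Finsupp.ext fun i => rfl)
      right_inv := fun f => rfl }
  have b := (MvPolynomial.basisRestrictSupport k {f : Fin s →₀ ℕ | ∀ i, f i ≤ n}).reindex e
  refine (Module.finrank_eq_card_basis b).trans ?_
  simp

theorem restrictDegree_mono (s : ℕ) : Monotone (MvPolynomial.restrictDegree (Fin s) k) := by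
  intro m n h p hp
  rw [MvPolynomial.mem_restrictDegree] at hp ⊢
  exact fun a ha i => (hp a ha i).trans h

theorem restrictDegree_mul_le (s m n : ℕ) :
    MvPolynomial.restrictDegree (Fin s) k m * MvPolynomial.restrictDegree (Fin s) k n
      ≤ MvPolynomial.restrictDegree (Fin s) k (m + n) := by
  classical
  rw [Submodule.mul_le]
  intro p hp q hq
  rw [MvPolynomial.mem_restrictDegree] at hp hq ⊢
  intro a ha i
  obtain ⟨b, hb, c, hc, rfl⟩ := Finset.mem_add.1 (MvPolynomial.support_mul p q ha)
  exact add_le_add (hp b hb i) (hq c hc i)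

theorem exists_mem_restrictDegree (s : ℕ) (p : MvPolynomial (Fin s) k) :
    ∃ n, p ∈ MvPolynomial.restrictDegree (Fin s) k n :=
  ⟨p.totalDegree, MvPolynomial.restrictTotalDegree_le_restrictDegree _ _ _
    ((MvPolynomial.mem_restrictTotalDegree _ _ _).2 le_rfl)⟩

/-- A finite-dimensional subspace is contained in some term of an exhaustive ascending filtration. -/
theorem exists_le_of_fg {M : Type*} [AddCommGroup M] [Module k M] {G : ℕ → Submodule k M}
    (hG : Monotone G) (hex : ∀ x, ∃ i, x ∈ G i) {V : Submodule k M} (hV : V.FG) :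
    ∃ i, V ≤ G i := by
  obtain ⟨S, rfl⟩ := hV
  choose n hn using hex
  exact ⟨S.sup n, Submodule.span_le.2 fun x hx => hG (Finset.le_sup hx) (hn x)⟩

/-- The powers of a finite-dimensional subspace of a finitely generated algebra of dimension `d` have
dimension `O(i ^ d)`, and a suitable one among them attains this growth. -/
theorem exists_growth [Nontrivial R] [Algebra.FiniteType k R] :
    (∀ V : Submodule k R, V.FG →
      ∃ C : ℕ, ∀ i, Module.finrank k (V ^ i : Submodule k R) ≤ C * (i + 1) ^ krullDim R) ∧
    ∃ U : Submodule k R, U.FG ∧ ∀ i,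
      (i + 1) ^ krullDim R ≤ Module.finrank k (U ^ i : Submodule k R) := by
  -- Noether normalization: R is finite over a polynomial ring in s variables, and s = dim R since
  -- the extension is integral and injective.
  obtain ⟨s, g, hinj, hfin⟩ := exists_finite_inj_algHom_of_fg k R
  have hs : s = krullDim R := by
    let _ : Algebra (MvPolynomial (Fin s) k) R := g.toRingHom.toAlgebra
    have _ : Module.Finite (MvPolynomial (Fin s) k) R := hfin
    have h1 := ringKrullDim_eq_of_integral_injective (A := MvPolynomial (Fin s) k) (B := R) hinj
    rw [coe_krullDim k R, MvPolynomial.ringKrullDim_of_isNoetherianRing] at h1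
    have h2 : (krullDim R : WithBot ℕ∞) = (s : WithBot ℕ∞) := by simpa using h1
    exact_mod_cast h2.symm
  rw [← hs]
  let P : ℕ → Submodule k R := fun n =>
    (MvPolynomial.restrictDegree (Fin s) k n).map g.toLinearMap
  have hPmul : ∀ m n, P m * P n ≤ P (m + n) := fun m n => by
    simp only [P]
    rw [← Submodule.map_mul]
    exact Submodule.map_mono (restrictDegree_mul_le s m n)
  have hPmono : Monotone P := fun m n h => Submodule.map_mono (restrictDegree_mono s h)
  have hPfin : ∀ n, Module.Finite k (P n) := fun n => inferInstance
  have hPrank : ∀ n, Module.finrank k (P n) = (n + 1) ^ s := fun n => by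
    rw [← finrank_restrictDegree (k := k) s n]
    exact (Submodule.equivMapOfInjective g.toLinearMap hinj _).finrank_eq.symm
  constructor
  · intro V hV
    obtain ⟨T, hT⟩ : ∃ T : Finset R, ∀ x : R, x ∈ @Submodule.span (MvPolynomial (Fin s) k) R _ _
        g.toRingHom.toAlgebra.toModule (T : Set R) := by
      let _ : Algebra (MvPolynomial (Fin s) k) R := g.toRingHom.toAlgebra
      have hfin' : Module.Finite (MvPolynomial (Fin s) k) R := hfin
      obtain ⟨T, hT⟩ := hfin'.fg_top
      exact ⟨T, fun x => by rw [hT]; trivial⟩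
    classical
    -- E is spanned by 1 and by generators of R as a module over the polynomial ring, so the P n * E
    -- exhaust R; since 1 ∈ E, V ^ i lies in V ^ i * E.
    let E : Submodule k R := Submodule.span k ((insert 1 T : Finset R) : Set R)
    have hE1 : (1 : R) ∈ E := Submodule.subset_span (by simp)
    have hEfg : E.FG := ⟨_, rfl⟩
    have hEfin : Module.Finite k E := Module.Finite.iff_fg.2 hEfg
    have hPEmono : Monotone fun n => P n * E := fun m n h => mul_le_mul' (hPmono h) le_rfl
    have h1P : (1 : R) ∈ P 0 := ⟨1, by
      refine (MvPolynomial.mem_restrictDegree _ _ _).2 fun a ha i => ?_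
      have : a = 0 := by
        by_contra h
        exact (MvPolynomial.mem_support_iff.1 ha) (by simp [MvPolynomial.coeff_one, Ne.symm h])
      simp [this], by simp⟩
    have hex : ∀ x : R, ∃ n, x ∈ P n * E := by
      intro x
      let _ : Algebra (MvPolynomial (Fin s) k) R := g.toRingHom.toAlgebra
      refine Submodule.span_induction (p := fun x _ => ∃ n, x ∈ P n * E) ?_ ⟨0, zero_mem _⟩ ?_ ?_
        (hT x)
      · intro y hy
        refine ⟨0, ?_⟩
        rw [← one_mul y]
        exact Submodule.mul_mem_mul h1P (Submodule.subset_span (by simp [Finset.mem_coe.1 hy]))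
      · rintro y z - - ⟨m, hm⟩ ⟨n, hn⟩
        exact ⟨max m n, add_mem (hPEmono (le_max_left m n) hm) (hPEmono (le_max_right m n) hn)⟩
      · rintro p y - ⟨n, hn⟩
        obtain ⟨m, hm⟩ := exists_mem_restrictDegree s p
        refine ⟨m + n, ?_⟩
        have h1 : p • y ∈ P m * (P n * E) := Submodule.mul_mem_mul (M := P m) ⟨p, hm, rfl⟩ hn
        rw [← mul_assoc] at h1
        exact mul_le_mul' (hPmul m n) le_rfl h1
    -- One c with V * E ≤ P c * E controls all powers of V: each further factor V costs one factor P
    -- c.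
    obtain ⟨c, hc⟩ := exists_le_of_fg hPEmono hex (hV.mul hEfg)
    have hpow : ∀ i, V ^ i * E ≤ P (c * i) * E := by
      intro i
      induction i with
      | zero =>
        rw [pow_zero, mul_zero]
        exact mul_le_mul' (Submodule.one_le.2 h1P) le_rfl
      | succ i ih =>
        calc V ^ (i + 1) * E = V * (V ^ i * E) := by rw [pow_succ', mul_assoc]
          _ ≤ V * (P (c * i) * E) := mul_le_mul' le_rfl ih
          _ = P (c * i) * (V * E) := by ring
          _ ≤ P (c * i) * (P c * E) := mul_le_mul' le_rfl hc
          _ = (P (c * i) * P c) * E := by ring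
          _ ≤ P (c * (i + 1)) * E := mul_le_mul' (hPmul _ _) le_rfl
    refine ⟨(c + 1) ^ s * Module.finrank k E, fun i => ?_⟩
    have hle : V ^ i ≤ P (c * i) * E := by
      refine le_trans ?_ (hpow i)
      intro x hx
      rw [← mul_one x]
      exact Submodule.mul_mem_mul hx hE1
    have : Module.Finite k (P (c * i) * E : Submodule k R) :=
      Module.Finite.iff_fg.2 ((Module.Finite.iff_fg.1 (hPfin _)).mul hEfg)
    calc Module.finrank k (V ^ i : Submodule k R)
        ≤ Module.finrank k (P (c * i) * E : Submodule k R) := Submodule.finrank_mono hle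
      _ ≤ Module.finrank k (P (c * i)) * Module.finrank k E := finrank_mul_le _ _
      _ = (c * i + 1) ^ s * Module.finrank k E := by rw [hPrank]
      _ ≤ ((c + 1) * (i + 1)) ^ s * Module.finrank k E := by
        gcongr
        nlinarith
      _ = _ := by rw [mul_pow]; ring
  -- U = P 1 attains the growth because P n ≤ P 1 ^ n and dim P n is exactly (n + 1) ^ s.
  · refine ⟨P 1, Module.Finite.iff_fg.1 (hPfin 1), fun i => ?_⟩
    have hstep : ∀ n, P (n + 1) ≤ P 1 * P n := by
      intro n
      simp only [P]
      rw [← Submodule.map_mul]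
      refine Submodule.map_mono fun p hp => ?_
      rw [MvPolynomial.mem_restrictDegree] at hp
      rw [← MvPolynomial.support_sum_monomial_coeff p]
      refine sum_mem fun a ha => ?_
      -- Splitting off one copy of each variable that occurs lowers every positive exponent by one,
      -- so the cofactor has exponents at most n.
      let b : Fin s →₀ ℕ := Finsupp.equivFunOnFinite.symm fun i => min (a i) 1
      have hb : ∀ i, b i = min (a i) 1 := fun i => rfl
      have hab : b + (a - b) = a := by
        ext i
        simp only [Finsupp.add_apply, Finsupp.tsub_apply, hb]
        omega
      have hmon : ∀ (e : Fin s →₀ ℕ) (r : k) (m : ℕ), (∀ i, e i ≤ m) →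
          MvPolynomial.monomial e r ∈ MvPolynomial.restrictDegree (Fin s) k m := by
        intro e r m he
        refine (MvPolynomial.mem_restrictDegree _ _ _).2 fun t ht i => ?_
        rw [Finset.mem_singleton.1 (MvPolynomial.support_monomial_subset ht)]
        exact he i
      have : MvPolynomial.monomial a (p.coeff a)
          = MvPolynomial.monomial b 1 * MvPolynomial.monomial (a - b) (p.coeff a) := by
        rw [MvPolynomial.monomial_mul, hab, one_mul]
      rw [this]
      refine Submodule.mul_mem_mul (hmon _ _ _ fun i => ?_) (hmon _ _ _ fun i => ?_)
      · rw [hb]; omega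
      · have := hp a ha i
        simp only [Finsupp.tsub_apply, hb]
        omega
    have hle : ∀ n, P n ≤ P 1 ^ n := by
      intro n
      induction n with
      | zero =>
        rintro _ ⟨p, hp, rfl⟩
        rw [pow_zero]
        have hp' := (MvPolynomial.mem_restrictDegree _ _ _).1 hp
        refine Submodule.mem_one.2 ⟨p.coeff 0, ?_⟩
        have : p = MvPolynomial.C (p.coeff 0) := by
          ext a
          rw [MvPolynomial.coeff_C]
          split_ifs with h
          · rw [h]
          · by_contra hne
            refine h (Finsupp.ext fun i => ?_)
            exact (Nat.le_zero.1 (hp' a (MvPolynomial.mem_support_iff.2 hne) i)).symm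
        conv_rhs => rw [this]
        exact (g.commutes _).symm
      | succ n ih =>
        rw [pow_succ']
        exact (hstep n).trans (mul_le_mul' le_rfl ih)
    have : Module.Finite k (P 1 ^ i : Submodule k R) :=
      Module.Finite.iff_fg.2 ((Module.Finite.iff_fg.1 (hPfin 1)).pow i)
    rw [← hPrank i]
    exact Submodule.finrank_mono (hle i)

end Growth

/-! ### The degree filtration of R and homogeneous generators. -/

section GradedPieces

variable {k R : Type*} [Field k] [CommRing R] [Algebra k R] (𝒜 : ℕ → Submodule k R)
  [GradedAlgebra 𝒜]

theorem proj_mem (i : ℕ) (x : R) : GradedAlgebra.proj 𝒜 i x ∈ 𝒜 i := by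
  rw [GradedAlgebra.proj_apply]
  exact SetLike.coe_mem _

variable {𝒜} in
theorem proj_same {i : ℕ} {x : R} (hx : x ∈ 𝒜 i) : GradedAlgebra.proj 𝒜 i x = x := by
  rw [GradedAlgebra.proj_apply, DirectSum.decompose_of_mem_same 𝒜 hx]

variable {𝒜} in
theorem proj_ne {i j : ℕ} {x : R} (hx : x ∈ 𝒜 i) (h : i ≠ j) : GradedAlgebra.proj 𝒜 j x = 0 := by
  rw [GradedAlgebra.proj_apply, DirectSum.decompose_of_mem_ne 𝒜 hx h]

theorem proj_mul (n : ℕ) (x y : R) : GradedAlgebra.proj 𝒜 n (x * y)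
    = ∑ ij ∈ Finset.HasAntidiagonal.antidiagonal n, GradedAlgebra.proj 𝒜 ij.1 x * GradedAlgebra.proj 𝒜 ij.2 y := by
  simp only [GradedAlgebra.proj_apply, DirectSum.decompose_mul]
  exact DirectSum.coe_mul_apply_eq_sum_antidiagonal 𝒜 _ _ n

/-- The elements all of whose components of degree `> j` vanish. -/
def degLE (j : ℤ) : Submodule k R :=
  ⨅ i ∈ {i : ℕ | j < i}, LinearMap.ker (GradedAlgebra.proj 𝒜 i)

variable {𝒜} in
theorem mem_degLE {j : ℤ} {x : R} :
    x ∈ degLE 𝒜 j ↔ ∀ i : ℕ, j < i → GradedAlgebra.proj 𝒜 i x = 0 := by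
  simp [degLE]

theorem degLE_mono : Monotone (degLE 𝒜) := fun _ _ h _ hx =>
  mem_degLE.2 fun i hi => mem_degLE.1 hx i (h.trans_lt hi)

variable {𝒜} in
theorem mem_degLE_of_mem {i : ℕ} {j : ℤ} (h : (i : ℤ) ≤ j) {x : R} (hx : x ∈ 𝒜 i) :
    x ∈ degLE 𝒜 j :=
  mem_degLE.2 fun l hl => proj_ne hx (by rintro rfl; omega)

theorem exists_mem_degLE (x : R) : ∃ n : ℕ, x ∈ degLE 𝒜 n := by
  classical
  refine ⟨(DirectSum.decompose 𝒜 x).support.sup id, mem_degLE.2 fun i hi => ?_⟩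
  by_contra h
  have := Finset.le_sup (f := id) ((GradedAlgebra.mem_support_iff 𝒜 x i).2 h)
  simp only [id] at this
  omega

variable {𝒜} in
theorem eq_zero_of_proj {x : R} (h : ∀ i, GradedAlgebra.proj 𝒜 i x = 0) : x = 0 := by
  classical
  rw [← DirectSum.sum_support_decompose 𝒜 x]
  exact Finset.sum_eq_zero fun i _ => h i

variable {𝒜} in
theorem sum_proj {n : ℕ} {x : R} (hx : x ∈ degLE 𝒜 n) :
    ∑ i ∈ Finset.range (n + 1), GradedAlgebra.proj 𝒜 i x = x := by
  refine sub_eq_zero.1 (eq_zero_of_proj (𝒜 := 𝒜) fun i => ?_)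
  rw [map_sub, map_sum]
  by_cases hi : i < n + 1
  · rw [Finset.sum_eq_single i, proj_same (proj_mem 𝒜 i x), sub_self]
    · exact fun j _ hj => proj_ne (proj_mem 𝒜 j x) hj
    · exact fun h => absurd (Finset.mem_range.2 hi) h
  · rw [mem_degLE.1 hx i (by omega), sub_zero]
    refine Finset.sum_eq_zero fun j hj => proj_ne (proj_mem 𝒜 j x) ?_
    have := Finset.mem_range.1 hj
    omega

-- The index is an integer so that operators of negative degree can shift it; this vanishing is what
-- makes operators of too low degree zero.
variable {𝒜} in
theorem degLE_neg {j : ℤ} (hj : j < 0) : degLE 𝒜 j = ⊥ :=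
  (Submodule.eq_bot_iff _).2 fun _ hx => eq_zero_of_proj fun i => mem_degLE.1 hx i (by omega)

variable {𝒜} in
theorem degLE_le {j : ℤ} {S : Submodule k R} (h : ∀ i : ℕ, (i : ℤ) ≤ j → 𝒜 i ≤ S) :
    degLE 𝒜 j ≤ S := by
  rcases lt_or_ge j 0 with hj | hj
  · rw [degLE_neg hj]
    exact bot_le
  · lift j to ℕ using hj
    intro x hx
    rw [← sum_proj hx]
    exact sum_mem fun i hi => h i (by have := Finset.mem_range.1 hi; omega) (proj_mem 𝒜 i x)

theorem degLE_zero : degLE 𝒜 0 = 𝒜 0 :=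
  le_antisymm (degLE_le fun i hi => by rw [show i = 0 by omega])
    fun _ hx => mem_degLE_of_mem (by simp) hx

theorem mul_mem_degLE {i j : ℤ} {x y : R} (hx : x ∈ degLE 𝒜 i) (hy : y ∈ degLE 𝒜 j) :
    x * y ∈ degLE 𝒜 (i + j) := by
  refine mem_degLE.2 fun n hn => ?_
  rw [proj_mul]
  refine Finset.sum_eq_zero fun pq hpq => ?_
  have := Finset.HasAntidiagonal.mem_antidiagonal.1 hpq
  rcases lt_or_ge i pq.1 with h | h
  · rw [mem_degLE.1 hx _ h, zero_mul]
  · rw [mem_degLE.1 hy _ (by omega), mul_zero]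

theorem pow_degLE_le (h0 : 𝒜 0 = 1) (w n : ℕ) : degLE 𝒜 (w : ℤ) ^ n ≤ degLE 𝒜 ((w * n : ℕ) : ℤ) := by
  induction n with
  | zero => rw [mul_zero, Nat.cast_zero, degLE_zero, h0, pow_zero]
  | succ n ih =>
    rw [pow_succ, Submodule.mul_le]
    intro x hx y hy
    have := mul_mem_degLE 𝒜 (ih hx) hy
    rwa [show ((w * n : ℕ) : ℤ) + w = ((w * (n + 1) : ℕ) : ℤ) by push_cast; ring] at this

theorem mem_maxIdeal_iff {x : R} : x ∈ maxIdeal 𝒜 ↔ GradedAlgebra.proj 𝒜 0 x = 0 := by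
  rw [maxIdeal, HomogeneousIdeal.mem_iff, HomogeneousIdeal.mem_irrelevant_iff]
  rfl

variable {𝒜} in
theorem mem_maxIdeal_of_pos {t : ℕ} (ht : 0 < t) {x : R} (hx : x ∈ 𝒜 t) : x ∈ maxIdeal 𝒜 :=
  (mem_maxIdeal_iff 𝒜).2 (proj_ne hx ht.ne')

variable {𝒜} in
theorem proj_mem_maxIdeal_sq {x : R} (hx : x ∈ maxIdeal 𝒜 ^ 2) (i : ℕ) :
    GradedAlgebra.proj 𝒜 i x ∈ maxIdeal 𝒜 ^ 2 := by
  have hm : (maxIdeal 𝒜).IsHomogeneous 𝒜 := (HomogeneousIdeal.irrelevant 𝒜).isHomogeneous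
  have h := hm.mul hm
  rw [← sq] at h
  exact h i hx

/-- The component of degree `t` of an element of `𝔪²` is a sum of products of homogeneous elements of
smaller degrees. -/
theorem proj_mem_of_mem_sq {t : ℕ} {Q : Submodule k R}
    (hQ : ∀ p q, 0 < p → 0 < q → p + q = t → 𝒜 p * 𝒜 q ≤ Q) {z : R} (hz : z ∈ maxIdeal 𝒜 ^ 2) :
    GradedAlgebra.proj 𝒜 t z ∈ Q := by
  rw [sq] at hz
  induction hz using Submodule.mul_induction_on' with
  | mem_mul_mem a ha b hb =>
    rw [proj_mul]
    refine sum_mem fun pq hpq => ?_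
    rcases Nat.eq_zero_or_pos pq.1 with h | h
    · rw [h, (mem_maxIdeal_iff 𝒜).1 ha, zero_mul]
      exact zero_mem _
    rcases Nat.eq_zero_or_pos pq.2 with h' | h'
    · rw [h', (mem_maxIdeal_iff 𝒜).1 hb, mul_zero]
      exact zero_mem _
    exact hQ _ _ h h' (Finset.HasAntidiagonal.mem_antidiagonal.1 hpq)
      (Submodule.mul_mem_mul (proj_mem 𝒜 _ a) (proj_mem 𝒜 _ b))
  | add x _ y _ hx hy => rw [map_add]; exact add_mem hx hy

/-- A subspace `U ∋ 1` that generates modulo `𝔪²` generates `R`. -/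
theorem piece_le_pow (h0 : 𝒜 0 = 1) {U : Submodule k R} (h1 : (1 : R) ∈ U)
    (hU : ∀ t, 0 < t → ∀ x ∈ 𝒜 t, ∃ v ∈ U, v ∈ 𝒜 t ∧ x - v ∈ maxIdeal 𝒜 ^ 2) (t : ℕ) :
    𝒜 t ≤ U ^ t := by
  induction t using Nat.strong_induction_on with
  | _ t ih =>
    rcases Nat.eq_zero_or_pos t with rfl | ht
    · rw [h0, pow_zero]
    intro x hx
    obtain ⟨v, hv, hvt, hxv⟩ := hU t ht x hx
    -- A graded Nakayama argument: x - v is homogeneous of degree t in 𝔪², hence a sum of products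
    -- of elements of positive degrees p + q = t, covered by induction through U ^ p * U ^ q = U ^
    -- t.
    have h2 : x - v ∈ U ^ t := by
      rw [← proj_same (sub_mem hx hvt)]
      refine proj_mem_of_mem_sq 𝒜 (fun p q hp hq hpq => ?_) hxv
      rw [← hpq, pow_add]
      exact mul_le_mul' (ih p (by omega)) (ih q (by omega))
    have h3 : v ∈ U ^ t := by
      have : U ^ 1 ≤ U ^ t := pow_le_pow_right₀ (Submodule.one_le.2 h1) ht
      rw [pow_one] at this
      exact this hv
    simpa using add_mem h2 h3

/-- V is spanned by 1 and the homogeneous components of finitely many algebra generators. Then V +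
𝔪² is closed under products and so is all of R, and since V is stable under projection to components
the approximant v can be taken homogeneous. -/
theorem exists_homogeneous_generators [Algebra.FiniteType k R] (h0 : 𝒜 0 = 1) :
    ∃ (M : ℕ) (V : Submodule k R), V.FG ∧ (1 : R) ∈ V ∧ V ≤ degLE 𝒜 M ∧
      ∀ t, 0 < t → ∀ x ∈ 𝒜 t, ∃ v ∈ V, v ∈ 𝒜 t ∧ x - v ∈ maxIdeal 𝒜 ^ 2 := by
  classical
  obtain ⟨S, hS⟩ := (inferInstance : Algebra.FiniteType k R).out
  choose n hn using exists_mem_degLE 𝒜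
  let M := S.sup n
  let B : Finset R := insert 1 ((S ×ˢ Finset.range (M + 1)).image
    fun p => GradedAlgebra.proj 𝒜 p.2 p.1)
  let V : Submodule k R := Submodule.span k (B : Set R)
  have hBhom : ∀ b ∈ B, ∃ t ≤ M, b ∈ 𝒜 t := by
    intro b hb
    rcases Finset.mem_insert.1 hb with rfl | hb
    · exact ⟨0, Nat.zero_le _, by rw [h0]; exact Submodule.one_le.1 le_rfl⟩
    · obtain ⟨p, hp, rfl⟩ := Finset.mem_image.1 hb
      have := Finset.mem_range.1 (Finset.mem_product.1 hp).2
      exact ⟨p.2, by omega, proj_mem 𝒜 _ _⟩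
  have h1V : (1 : R) ∈ V := Submodule.subset_span (by simp [B])
  have hVM : V ≤ degLE 𝒜 M := Submodule.span_le.2 fun b hb => by
    obtain ⟨t, ht, hbt⟩ := hBhom b hb
    exact mem_degLE_of_mem (by exact_mod_cast ht) hbt
  have hVproj : ∀ t, ∀ v ∈ V, GradedAlgebra.proj 𝒜 t v ∈ V := by
    intro t v hv
    induction hv using Submodule.span_induction with
    | mem b hb =>
      obtain ⟨s, -, hbs⟩ := hBhom b hb
      by_cases hst : s = t
      · subst hst
        rw [proj_same hbs]
        exact Submodule.subset_span hb
      · rw [proj_ne hbs hst]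
        exact zero_mem _
    | zero => simp
    | add x y _ _ hx hy => rw [map_add]; exact add_mem hx hy
    | smul c x _ hx => rw [map_smul]; exact Submodule.smul_mem _ c hx
  let T : Submodule k R := V ⊔ (maxIdeal 𝒜 ^ 2).restrictScalars k
  -- Spanning elements of degree zero are scalars, and two of positive degree multiply into 𝔪².
  have hVV : V * V ≤ T := by
    rw [Submodule.span_mul_span]
    refine Submodule.span_le.2 ?_
    rintro _ ⟨b, hb, c, hc, rfl⟩
    obtain ⟨s, -, hbs⟩ := hBhom b hb
    obtain ⟨t, -, hct⟩ := hBhom c hc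
    have key : ∀ b c : R, b ∈ 𝒜 0 → c ∈ B → b * c ∈ T := by
      intro b c hb hc
      rw [h0] at hb
      obtain ⟨r, rfl⟩ := Submodule.mem_one.1 hb
      rw [← Algebra.smul_def]
      exact Submodule.mem_sup_left (Submodule.smul_mem _ r (Submodule.subset_span hc))
    dsimp only
    rcases Nat.eq_zero_or_pos s with rfl | hs
    · exact key b c hbs hc
    rcases Nat.eq_zero_or_pos t with rfl | ht
    · rw [mul_comm]
      exact key c b hct hb
    · refine Submodule.mem_sup_right ?_
      rw [Submodule.restrictScalars_mem, sq]
      exact Ideal.mul_mem_mul (mem_maxIdeal_of_pos hs hbs) (mem_maxIdeal_of_pos ht hct)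
  have hTtop : ∀ x : R, x ∈ T := by
    intro x
    have hx : x ∈ Algebra.adjoin k (S : Set R) := by rw [hS]; trivial
    induction hx using Algebra.adjoin_induction with
    | mem s hs =>
      refine Submodule.mem_sup_left ?_
      have hsM : s ∈ degLE 𝒜 M :=
        degLE_mono 𝒜 (by exact_mod_cast Finset.le_sup (f := n) hs) (hn s)
      rw [← sum_proj hsM]
      refine sum_mem fun i hi => Submodule.subset_span ?_
      exact Finset.mem_coe.2 (Finset.mem_insert_of_mem (Finset.mem_image.2
        ⟨(s, i), Finset.mem_product.2 ⟨hs, hi⟩, rfl⟩))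
    | algebraMap r =>
      rw [Algebra.algebraMap_eq_smul_one]
      exact Submodule.mem_sup_left (Submodule.smul_mem _ r h1V)
    | add x y _ _ hx hy => exact add_mem hx hy
    | mul x y _ _ hx hy =>
      obtain ⟨v, hv, z, hz, rfl⟩ := Submodule.mem_sup.1 hx
      obtain ⟨v', hv', z', hz', rfl⟩ := Submodule.mem_sup.1 hy
      rw [show (v + z) * (v' + z') = v * v' + (v * z' + (v' + z') * z) by ring]
      refine add_mem (hVV (Submodule.mul_mem_mul hv hv')) (Submodule.mem_sup_right ?_)
      rw [Submodule.restrictScalars_mem] at hz hz' ⊢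
      exact add_mem (Ideal.mul_mem_left _ _ hz') (Ideal.mul_mem_left _ _ hz)
  refine ⟨M, V, ⟨B, rfl⟩, h1V, hVM, fun t ht x hx => ?_⟩
  obtain ⟨v, hv, z, hz, rfl⟩ := Submodule.mem_sup.1 (hTtop x)
  refine ⟨_, hVproj t v hv, proj_mem 𝒜 t v, ?_⟩
  have h := proj_mem_maxIdeal_sq (Submodule.restrictScalars_mem _ _ _ |>.1 hz) t
  rw [← proj_same hx, map_add, add_sub_cancel_left]
  exact h

/-- All homogeneous elements of degree `> w` lie in `𝔪²`. -/
theorem mem_maxIdeal_sq_of_genDegree_lt [Algebra.FiniteType k R] (h0 : 𝒜 0 = 1) {t : ℕ}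
    (ht : genDegree 𝒜 < t) {x : R} (hx : x ∈ 𝒜 t) : x ∈ maxIdeal 𝒜 ^ 2 := by
  obtain ⟨M, V, -, -, hVM, hV⟩ := exists_homogeneous_generators 𝒜 h0
  -- The supremum of an unbounded set of naturals would take the default value 0, so boundedness
  -- must be shown. In degrees above M the approximant v is zero, hence y itself lies in 𝔪².
  have hbdd : BddAbove {t | ∃ x ∈ 𝒜 t, x ∈ maxIdeal 𝒜 ∧ x ∉ maxIdeal 𝒜 ^ 2} := by
    refine ⟨M, ?_⟩
    rintro s ⟨y, hy, -, hy2⟩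
    by_contra! hs
    refine hy2 ?_
    obtain ⟨v, hv, hvs, hyv⟩ := hV s (by omega) y hy
    have : v = 0 := by
      rw [← proj_same hvs]
      exact mem_degLE.1 (hVM hv) s (by exact_mod_cast hs)
    rwa [this, sub_zero] at hyv
  by_contra h
  have := le_csSup hbdd ⟨x, hx, mem_maxIdeal_of_pos (by omega) hx, h⟩
  exact absurd this (not_le.2 ht)

theorem one_mem_degLE (h0 : 𝒜 0 = 1) (w : ℕ) : (1 : R) ∈ degLE 𝒜 (w : ℤ) :=
  mem_degLE_of_mem (i := 0) (by simp) (by rw [h0]; exact Submodule.one_le.1 le_rfl)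

/-- `R` is generated by its elements of degree at most `w`. -/
theorem exists_mem_pow_degLE [Algebra.FiniteType k R] (h0 : 𝒜 0 = 1) (x : R) :
    ∃ n : ℕ, x ∈ degLE 𝒜 (genDegree 𝒜 : ℤ) ^ n := by
  have hp := piece_le_pow 𝒜 h0 (one_mem_degLE 𝒜 h0 (genDegree 𝒜)) fun t ht x hx => by
    rcases le_or_gt t (genDegree 𝒜) with h | h
    · exact ⟨x, mem_degLE_of_mem (by exact_mod_cast h) hx, hx, by simp⟩
    · exact ⟨0, zero_mem _, zero_mem _, by
        rw [sub_zero]; exact mem_maxIdeal_sq_of_genDegree_lt 𝒜 h0 h hx⟩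
  obtain ⟨n, hn⟩ := exists_mem_degLE 𝒜 x
  refine ⟨n, ?_⟩
  refine degLE_le (fun i hi => ?_) hn
  exact (hp i).trans (pow_le_pow_right₀ (Submodule.one_le.2 (one_mem_degLE 𝒜 h0 _))
    (by exact_mod_cast hi))

theorem adjoin_degLE [Algebra.FiniteType k R] (h0 : 𝒜 0 = 1) (x : R) :
    x ∈ Algebra.adjoin k (degLE 𝒜 (genDegree 𝒜 : ℤ) : Set R) := by
  obtain ⟨n, hn⟩ := exists_mem_pow_degLE 𝒜 h0 x
  have : degLE 𝒜 (genDegree 𝒜 : ℤ) ^ n ≤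
      Subalgebra.toSubmodule (Algebra.adjoin k (degLE 𝒜 (genDegree 𝒜 : ℤ) : Set R)) := by
    clear hn
    induction n with
    | zero => rw [pow_zero, Submodule.one_le]; exact one_mem (Algebra.adjoin k _)
    | succ n ih =>
      rw [pow_succ, Submodule.mul_le]
      exact fun a ha b hb => Subalgebra.mul_mem _ (ih ha) (Algebra.subset_adjoin hb)
  exact this hn

/-- A finite-dimensional V built from the homogeneous generators gives both the finiteness of R_{≤n}
and, through the growth of powers of V, its polynomial bound. -/
theorem exists_fg_degLE_le_pow [Algebra.FiniteType k R] (h0 : 𝒜 0 = 1) :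
    ∃ V : Submodule k R, V.FG ∧ ∀ n : ℕ, degLE 𝒜 (n : ℤ) ≤ V ^ n := by
  obtain ⟨M, V, hVfg, h1, -, hV⟩ := exists_homogeneous_generators 𝒜 h0
  exact ⟨V, hVfg, fun n => degLE_le fun i hi => (piece_le_pow 𝒜 h0 h1 hV i).trans
    (pow_le_pow_right₀ (Submodule.one_le.2 h1) (by exact_mod_cast hi))⟩

theorem finite_degLE [Algebra.FiniteType k R] (h0 : 𝒜 0 = 1) (j : ℤ) :
    Module.Finite k (degLE 𝒜 j) := by
  obtain ⟨V, hV, hle⟩ := exists_fg_degLE_le_pow 𝒜 h0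
  have : Module.Finite k (V ^ j.toNat : Submodule k R) := Module.Finite.iff_fg.2 (hV.pow _)
  exact Submodule.finiteDimensional_of_le ((degLE_mono 𝒜 (Int.self_le_toNat j)).trans (hle _))

/-- `dim R_{≤ n} = O(n ^ d)`. -/
theorem exists_finrank_degLE_le [Nontrivial R] [Algebra.FiniteType k R] (h0 : 𝒜 0 = 1) :
    ∃ C : ℕ, ∀ n : ℕ, Module.finrank k (degLE 𝒜 (n : ℤ)) ≤ C * (n + 1) ^ krullDim R := by
  obtain ⟨V, hV, hle⟩ := exists_fg_degLE_le_pow 𝒜 h0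
  obtain ⟨C, hC⟩ := (exists_growth (k := k) (R := R)).1 V hV
  refine ⟨C, fun n => ?_⟩
  have : Module.Finite k (V ^ n : Submodule k R) := Module.Finite.iff_fg.2 (hV.pow _)
  exact (Submodule.finrank_mono (hle n)).trans (hC n)

/-- The subspace U whose powers attain maximal growth lies in some R_{≤c}, so U ^ n lies in R_{≤cn}.
-/
theorem exists_le_finrank_degLE [Nontrivial R] [Algebra.FiniteType k R] (h0 : 𝒜 0 = 1) :
    ∃ c : ℕ, ∀ n : ℕ, (n + 1) ^ krullDim R ≤ Module.finrank k (degLE 𝒜 ((c * n : ℕ) : ℤ)) := by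
  obtain ⟨U, hU, hle⟩ := (exists_growth (k := k) (R := R)).2
  obtain ⟨c, hc⟩ := exists_le_of_fg (G := fun n : ℕ => degLE 𝒜 (n : ℤ))
    (fun m n h => degLE_mono 𝒜 (by exact_mod_cast h)) (exists_mem_degLE 𝒜) hU
  refine ⟨c, fun n => (hle n).trans ?_⟩
  have := finite_degLE 𝒜 h0
  exact Submodule.finrank_mono ((pow_le_pow_left' hc n).trans (pow_degLE_le 𝒜 h0 c n))

end GradedPieces

/-! ### Order against degree, and the Bernstein filtrations. -/

section Operators

variable {k R : Type*} [Field k] [CommRing R] [Algebra k R]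

theorem bracket_add (r s : R) (P : Module.End k R) :
    bracket k R R (r + s) P = bracket k R R r P + bracket k R R s P := by
  ext x
  simp only [bracket_apply, LinearMap.add_apply, add_smul, map_add]
  abel

theorem bracket_zero (P : Module.End k R) : bracket k R R 0 P = 0 := by
  ext x
  simp

/-- A differential operator of order `≤ n` that vanishes on the products of `n` elements of a
generating subspace is zero. -/
theorem eq_zero_of_vanish_pow {W : Submodule k R} (h1 : (1 : R) ∈ W)
    (hW : ∀ x, x ∈ Algebra.adjoin k (W : Set R)) (n : ℕ) : ∀ P ∈ diffOpLE k R R n,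
    (∀ x ∈ W ^ n, P x = 0) → P = 0 := by
  -- Commuting with a generating set makes P linear over R, so P is multiplication by P 1.
  have key : ∀ P : Module.End k R, (∀ r ∈ W, bracket k R R r P = 0) → P 1 = 0 → P = 0 := by
    intro P hP hP1
    have hc : ∀ r : R, ∀ x, P (r * x) = r * P x := by
      intro r
      induction hW r using Algebra.adjoin_induction with
      | mem r hr =>
        intro x
        simpa [sub_eq_zero] using LinearMap.congr_fun (hP r hr) x
      | algebraMap c => intro x; rw [← Algebra.smul_def, ← Algebra.smul_def, map_smul]
      | add a b _ _ ha hb => intro x; rw [add_mul, map_add, ha, hb, add_mul]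
      | mul a b _ _ ha hb => intro x; rw [mul_assoc, ha, hb, mul_assoc]
    ext x
    have := hc x 1
    rwa [mul_one, hP1, mul_zero] at this
  induction n with
  | zero =>
    intro P hP h0
    exact key P (fun r _ => mem_zero.1 hP r)
      (h0 1 (by rw [pow_zero]; exact Submodule.one_le.1 le_rfl))
  | succ n ih =>
    intro P hP h0
    refine key P (fun r hr => ih _ (mem_succ.1 hP r) fun x hx => ?_)
      (h0 1 (Submodule.one_le.1 (one_le_pow_of_one_le' (Submodule.one_le.2 h1) _)))
    -- For r ∈ W the commutator [P, r] has order at most n and vanishes on W ^ n, because x and r x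
    -- both lie in W ^ (n + 1).
    have hx' : x ∈ W ^ (n + 1) :=
      pow_le_pow_right₀ (Submodule.one_le.2 h1) (Nat.le_succ n) hx
    rw [bracket_apply, smul_eq_mul, smul_eq_mul, h0 x hx', mul_zero, sub_zero]
    exact h0 _ (by rw [pow_succ']; exact Submodule.mul_mem_mul hr hx)

/-- The operator `P` raises the index of the filtration `Φ` by at most `e`. -/
def Raises (Φ : ℤ → Submodule k R) (P : Module.End k R) (e : ℤ) : Prop :=
  ∀ j, ∀ x ∈ Φ j, P x ∈ Φ (j + e)

variable (𝒜 : ℕ → Submodule k R)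

theorem IsHomogeneousOp.mul {δ ε : DRing k R} {d e : ℤ} (hδ : IsHomogeneousOp 𝒜 δ d)
    (hε : IsHomogeneousOp 𝒜 ε e) : IsHomogeneousOp 𝒜 (δ * ε) (d + e) := by
  intro i x hx
  have h := hε i x hx
  rw [map_mul, Module.End.mul_apply]
  unfold intPiece at h
  split_ifs at h with h1
  · have h2 := hδ _ _ h
    rwa [Int.toNat_of_nonneg h1, add_assoc, add_comm e d] at h2
  · rw [(Submodule.mem_bot k).1 h, map_zero]
    exact zero_mem _

theorem ord_mul_le (δ ε : DRing k R) : ord (δ * ε) ≤ ord δ + ord ε :=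
  ord_le (by rw [map_mul]; exact mul_mem_diffOpLE (mem_ord δ) (mem_ord ε))

theorem ord_one : ord (1 : DRing k R) = 0 :=
  Nat.le_zero.1 (ord_le (by rw [map_one, mem_zero]; intro r; ext x; simp))

theorem IsHomogeneousOp.one : IsHomogeneousOp 𝒜 (1 : DRing k R) 0 := by
  intro i x hx
  rw [map_one, Module.End.one_apply, add_zero, intPiece, if_pos (by omega), Int.toNat_natCast]
  exact hx

theorem genBernstein_mono (a : ℝ) : Monotone (genBernstein 𝒜 a) := by
  intro i j h
  refine Submodule.span_mono ?_
  rintro δ ⟨d, hd, hle⟩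
  exact ⟨d, hd, hle.trans (by exact_mod_cast h)⟩

theorem genBernstein_mul_le {a : ℝ} (ha : 0 ≤ a) (i j : ℕ) :
    genBernstein 𝒜 a i * genBernstein 𝒜 a j ≤ genBernstein 𝒜 a (i + j) := by
  rw [genBernstein, genBernstein, Submodule.span_mul_span]
  refine Submodule.span_le.2 ?_
  rintro _ ⟨δ, ⟨d, hd, hδ⟩, ε, ⟨e, he, hε⟩, rfl⟩
  refine Submodule.subset_span ⟨d + e, hd.mul 𝒜 he, ?_⟩
  have h : (ord (δ * ε) : ℝ) ≤ ord δ + ord ε := by exact_mod_cast ord_mul_le δ ε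
  have := mul_le_mul_of_nonneg_left h ha
  push_cast
  linarith

variable [GradedAlgebra 𝒜]

variable {𝒜} in
theorem intPiece_le_degLE (n : ℤ) : intPiece 𝒜 n ≤ degLE 𝒜 n := by
  unfold intPiece
  split_ifs with h
  · exact fun x hx => mem_degLE_of_mem (by omega) hx
  · exact bot_le

variable {𝒜} in
theorem IsHomogeneousOp.raises {δ : DRing k R} {d : ℤ} (hδ : IsHomogeneousOp 𝒜 δ d) :
    Raises (degLE 𝒜) δ.toEnd d := by
  intro j
  exact degLE_le (S := (degLE 𝒜 (j + d)).comap δ.toEnd) fun i hi x hx =>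
    degLE_mono 𝒜 (by omega) (intPiece_le_degLE _ (hδ i x hx))

theorem eq_zero_of_vanish_degLE [Algebra.FiniteType k R] (h0 : 𝒜 0 = 1) {n : ℕ}
    {P : Module.End k R} (hP : P ∈ diffOpLE k R R n)
    (h : ∀ x ∈ degLE 𝒜 ((genDegree 𝒜 * n : ℕ) : ℤ), P x = 0) : P = 0 :=
  eq_zero_of_vanish_pow (one_mem_degLE 𝒜 h0 _) (adjoin_degLE 𝒜 h0) n P hP
    fun x hx => h x (pow_degLE_le 𝒜 h0 _ n hx)

/-- A differential operator of order `≤ n` and degree `< - w n` is zero. -/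
theorem eq_zero_of_raises [Algebra.FiniteType k R] (h0 : 𝒜 0 = 1) {n : ℕ}
    {P : Module.End k R} (hP : P ∈ diffOpLE k R R n) {e : ℤ} (hPe : Raises (degLE 𝒜) P e)
    (he : (genDegree 𝒜 * n : ℕ) + e < 0) : P = 0 :=
  eq_zero_of_vanish_degLE 𝒜 h0 hP fun x hx => by
    have := hPe _ x hx
    rwa [degLE_neg he, Submodule.mem_bot] at this

/-- In a smaller degree δ would send R_{≤ w ord δ} into negative degrees, hence to zero, and would
vanish. This is where the requirement that slopes exceed w comes from. -/
theorem neg_le_degree [Algebra.FiniteType k R] (h0 : 𝒜 0 = 1) {δ : DRing k R} (hδ0 : δ ≠ 0)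
    {d : ℤ} (hδ : IsHomogeneousOp 𝒜 δ d) : -(genDegree 𝒜 * ord δ : ℕ) ≤ d := by
  by_contra! h
  exact hδ0 (DRing.toEnd_injective (by
    rw [eq_zero_of_raises 𝒜 h0 (mem_ord δ) hδ.raises (by omega), map_zero]))

/-- On the generators of `B_i` the order is bounded by a multiple of `i`. -/
theorem exists_ord_le [Algebra.FiniteType k R] (h0 : 𝒜 0 = 1) {b : ℝ}
    (hb : (genDegree 𝒜 : ℝ) < b) : ∃ c : ℕ, 0 < c ∧ ∀ (i : ℕ) (δ : DRing k R) (d : ℤ), δ ≠ 0 →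
      IsHomogeneousOp 𝒜 δ d → (d : ℝ) + b * (ord δ : ℝ) ≤ (i : ℝ) → ord δ ≤ c * i := by
  have hpos : 0 < b - genDegree 𝒜 := sub_pos.2 hb
  -- From d ≥ -w ord δ and d + b ord δ ≤ i follows (b - w) ord δ ≤ i.
  refine ⟨⌈1 / (b - genDegree 𝒜)⌉₊, Nat.ceil_pos.2 (by positivity), fun i δ d hδ hd hle => ?_⟩
  have h1 : -((genDegree 𝒜 : ℝ) * ord δ) ≤ d := by exact_mod_cast neg_le_degree 𝒜 h0 hδ hd
  have h2 : (b - genDegree 𝒜) * ord δ ≤ i := by nlinarith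
  have h3 : (ord δ : ℝ) ≤ 1 / (b - genDegree 𝒜) * i := by
    rw [one_div, ← div_eq_inv_mul, le_div_iff₀ hpos, mul_comm]
    exact h2
  have h4 := mul_le_mul_of_nonneg_right (Nat.le_ceil (1 / (b - genDegree 𝒜))) (Nat.cast_nonneg (α := ℝ) i)
  exact_mod_cast h3.trans h4

/-- The order is controlled because b > w, and the degree because b ord δ ≥ 0. These two bounds are
all that the module estimates use about the Bernstein filtration. -/
theorem genBernstein_bound [Algebra.FiniteType k R] (h0 : 𝒜 0 = 1) {b : ℝ}
    (hb : (genDegree 𝒜 : ℝ) < b) : ∃ c : ℕ, 0 < c ∧ ∀ i, ∀ δ ∈ genBernstein 𝒜 b i,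
      δ.toEnd ∈ diffOpLE k R R (c * i) ∧ Raises (degLE 𝒜) δ.toEnd i := by
  obtain ⟨c, hc0, hc⟩ := exists_ord_le 𝒜 h0 hb
  have hb0 : 0 ≤ b := (Nat.cast_nonneg _).trans hb.le
  refine ⟨c, hc0, fun i δ hδ => ?_⟩
  induction hδ using Submodule.span_induction with
  | mem δ hδ =>
    obtain ⟨d, hd, hle⟩ := hδ
    -- The zero operator is homogeneous of every degree, so the lower bound on degrees does not
    -- apply to it.
    by_cases h : δ = 0
    · subst h
      rw [map_zero]
      exact ⟨zero_mem _, fun j x _ => zero_mem _⟩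
    refine ⟨diffOpLE_mono (hc i δ d h hd hle) (mem_ord δ), fun j x hx => ?_⟩
    have h1 : 0 ≤ b * (ord δ : ℝ) := by positivity
    have h2 : (d : ℝ) ≤ (i : ℤ) := by
      rw [Int.cast_natCast]
      linarith
    have h3 : d ≤ i := by exact_mod_cast h2
    exact degLE_mono 𝒜 (by omega) (hd.raises j x hx)
  | zero =>
    rw [map_zero]
    exact ⟨zero_mem _, fun j x _ => zero_mem _⟩
  | add δ ε _ _ hδ hε =>
    rw [map_add]
    exact ⟨add_mem hδ.1 hε.1, fun j x hx => add_mem (hδ.2 j x hx) (hε.2 j x hx)⟩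
  | smul c δ _ hδ =>
    rw [map_smul]
    exact ⟨Submodule.smul_mem _ _ hδ.1, fun j x hx => Submodule.smul_mem _ _ (hδ.2 j x hx)⟩

/-- Operators of order at most n are determined by their restriction to the finite-dimensional space
R_{≤wn}. -/
theorem finite_of_raises [Algebra.FiniteType k R] (h0 : 𝒜 0 = 1) {n : ℕ} {e : ℤ}
    {B : Submodule k (DRing k R)}
    (hB : ∀ δ ∈ B, δ.toEnd ∈ diffOpLE k R R n ∧ Raises (degLE 𝒜) δ.toEnd e) :
    Module.Finite k B := by
  have h1 := finite_degLE 𝒜 h0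
  let j : ℤ := (genDegree 𝒜 * n : ℕ)
  let Θ : B →ₗ[k] degLE 𝒜 j →ₗ[k] degLE 𝒜 (j + e) :=
    LinearMap.mk₂ k (fun δ x => ⟨δ.1.toEnd x.1, (hB δ.1 δ.2).2 j x.1 x.2⟩)
      (fun δ ε x => Subtype.ext (by simp))
      (fun c δ x => Subtype.ext (by simp))
      (fun δ x y => Subtype.ext (by simp))
      (fun c δ x => Subtype.ext (by simp))
  refine Module.Finite.of_injective Θ ((injective_iff_map_eq_zero Θ).2 fun δ hδ => ?_)
  refine Subtype.ext (DRing.toEnd_injective ?_)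
  rw [Submodule.coe_zero, map_zero]
  exact eq_zero_of_vanish_degLE 𝒜 h0 (hB δ.1 δ.2).1 fun x hx =>
    congrArg Subtype.val (LinearMap.congr_fun hδ ⟨x, hx⟩)

/-! ### Homogeneous components of differential operators -/

/-- The projection to the component of degree `n ∈ ℤ`. -/
noncomputable def projInt (n : ℤ) : R →ₗ[k] R :=
  if 0 ≤ n then GradedAlgebra.proj 𝒜 n.toNat else 0

theorem projInt_mem (n : ℤ) (x : R) : projInt 𝒜 n x ∈ intPiece 𝒜 n := by
  unfold projInt intPiece
  split_ifs
  · exact proj_mem 𝒜 _ x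
  · exact zero_mem _

theorem projInt_natCast (n : ℕ) : projInt 𝒜 (n : ℤ) = GradedAlgebra.proj 𝒜 n := by
  rw [projInt, if_pos (by omega), Int.toNat_natCast]

theorem mul_projInt {t : ℕ} {r : R} (hr : r ∈ 𝒜 t) (n : ℤ) (y : R) :
    r * projInt 𝒜 n y = projInt 𝒜 (t + n) (r * y) := by
  unfold projInt
  by_cases hn : 0 ≤ n
  · lift n to ℕ using hn
    rw [if_pos (by omega), if_pos (by omega), ← Nat.cast_add, Int.toNat_natCast,
      Int.toNat_natCast, GradedAlgebra.proj_apply, GradedAlgebra.proj_apply,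
      DirectSum.coe_decompose_mul_add_of_left_mem 𝒜 hr]
  · rw [if_neg hn, LinearMap.zero_apply, mul_zero]
    split_ifs with h
    · rw [GradedAlgebra.proj_apply,
        DirectSum.coe_decompose_mul_of_left_mem_of_not_le 𝒜 hr (by omega)]
    · rfl

/-- The component of degree `e` of a linear endomorphism. -/
noncomputable def homComp (P : Module.End k R) (e : ℤ) : Module.End k R :=
  (DirectSum.toModule k ℕ R fun i => (projInt 𝒜 ((i : ℤ) + e)).comp (P.comp (𝒜 i).subtype)).comp
    (DirectSum.decomposeLinearEquiv 𝒜).toLinearMap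

variable {𝒜} in
theorem homComp_of_mem (P : Module.End k R) (e : ℤ) {i : ℕ} {x : R} (hx : x ∈ 𝒜 i) :
    homComp 𝒜 P e x = projInt 𝒜 ((i : ℤ) + e) (P x) := by
  have : DirectSum.decomposeLinearEquiv 𝒜 x = DirectSum.lof k ℕ (fun i => 𝒜 i) i ⟨x, hx⟩ :=
    DirectSum.decompose_of_mem 𝒜 hx
  rw [homComp, LinearMap.comp_apply, LinearEquiv.coe_coe, this, DirectSum.toModule_lof]
  rfl

theorem end_ext {P Q : Module.End k R} (h : ∀ i, ∀ x ∈ 𝒜 i, P x = Q x) : P = Q := by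
  ext x
  obtain ⟨n, hn⟩ := exists_mem_degLE 𝒜 x
  rw [← sum_proj hn, map_sum, map_sum]
  exact Finset.sum_congr rfl fun i _ => h i _ (proj_mem 𝒜 i x)

/-- A commutator with an element of degree t only shifts the component by t. By induction on the
order, homogeneous components of a differential operator are again differential operators of no
larger order; homogeneous r suffice, since the commutator is additive in r. -/
theorem bracket_homComp {t : ℕ} {r : R} (hr : r ∈ 𝒜 t) (P : Module.End k R) (e : ℤ) :
    bracket k R R r (homComp 𝒜 P e) = homComp 𝒜 (bracket k R R r P) (t + e) := by
  refine end_ext 𝒜 fun i x hx => ?_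
  have hrx : r * x ∈ 𝒜 (t + i) := SetLike.mul_mem_graded hr hx
  rw [bracket_apply, smul_eq_mul, smul_eq_mul, homComp_of_mem _ _ hrx, homComp_of_mem _ _ hx,
    homComp_of_mem _ _ hx, mul_projInt 𝒜 hr, bracket_apply, map_sub, smul_eq_mul, smul_eq_mul,
    Nat.cast_add, add_assoc, show (i : ℤ) + (t + e) = t + (i + e) by ring]

theorem bracket_mem_of_homogeneous {S : Submodule k (Module.End k R)} {P : Module.End k R}
    (h : ∀ t, ∀ r ∈ 𝒜 t, bracket k R R r P ∈ S) (r : R) : bracket k R R r P ∈ S := by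
  let T : Submodule k R :=
    { carrier := {r | bracket k R R r P ∈ S}
      zero_mem' := by
        change bracket k R R 0 P ∈ S
        rw [bracket_zero]
        exact zero_mem _
      add_mem' := fun {a b} ha hb => by
        change bracket k R R (a + b) P ∈ S
        rw [bracket_add]
        exact add_mem ha hb
      smul_mem' := fun c a ha => by
        change bracket k R R (c • a) P ∈ S
        have : bracket k R R (c • a) P = c • bracket k R R a P := by
          ext x
          simp [smul_sub]
        rw [this]
        exact Submodule.smul_mem _ c ha }
  obtain ⟨n, hn⟩ := exists_mem_degLE 𝒜 r
  exact degLE_le (S := T) (fun i _ x hx => h i x hx) hn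

theorem homComp_mem (n : ℕ) : ∀ P ∈ diffOpLE k R R n, ∀ e,
    homComp 𝒜 P e ∈ diffOpLE k R R n := by
  induction n with
  | zero =>
    intro P hP e
    rw [mem_zero] at hP ⊢
    intro r
    refine (Submodule.mem_bot k).1 (bracket_mem_of_homogeneous 𝒜 (fun t r hr => ?_) r)
    rw [Submodule.mem_bot, bracket_homComp 𝒜 hr, hP]
    exact end_ext 𝒜 fun i x hx => by simp [homComp_of_mem _ _ hx]
  | succ n ih =>
    intro P hP e
    rw [mem_succ] at hP ⊢
    refine bracket_mem_of_homogeneous 𝒜 fun t r hr => ?_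
    rw [bracket_homComp 𝒜 hr]
    exact ih _ (hP r) _

/-- The homogeneous component of degree `e` of a differential operator. -/
noncomputable def DRing.homComp (δ : DRing k R) (e : ℤ) : DRing k R :=
  DRing.mk (BernsteinAlg.homComp 𝒜 δ.toEnd e) (ord δ) (homComp_mem 𝒜 _ _ (mem_ord δ) e)

theorem DRing.isHomogeneousOp_homComp (δ : DRing k R) (e : ℤ) :
    IsHomogeneousOp 𝒜 (δ.homComp 𝒜 e) e := by
  intro i x hx
  rw [DRing.homComp, DRing.toEnd_mk, homComp_of_mem _ _ hx]
  exact projInt_mem 𝒜 _ _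

/-- A differential operator is the sum of its homogeneous components. -/
theorem DRing.exists_sum_homComp [Algebra.FiniteType k R] (h0 : 𝒜 0 = 1) (δ : DRing k R) :
    ∃ E : Finset ℤ, ∑ e ∈ E, δ.homComp 𝒜 e = δ := by
  have hfin := finite_degLE 𝒜 h0
  let N : ℕ := genDegree 𝒜 * ord δ
  obtain ⟨M, hM⟩ := exists_le_of_fg (G := fun n : ℕ => degLE 𝒜 (n : ℤ))
    (fun m n h => degLE_mono 𝒜 (by exact_mod_cast h)) (exists_mem_degLE 𝒜)
    ((Module.Finite.iff_fg.1 (hfin N)).map δ.toEnd)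
  -- Below -N a component vanishes by the degree bound. Above M it vanishes on R_{≤N}, because δ
  -- maps this space into R_{≤M}, and an operator of order at most ord δ that is zero on R_{≤N} is
  -- zero.
  have hzero : ∀ e : ℤ, e ∉ Finset.Icc (-(N : ℤ)) M → BernsteinAlg.homComp 𝒜 δ.toEnd e = 0 := by
    intro e he
    rw [Finset.mem_Icc, not_and_or, not_le, not_le] at he
    have hmem := homComp_mem 𝒜 _ _ (mem_ord δ) e
    rcases he with he | he
    · exact eq_zero_of_raises 𝒜 h0 hmem (δ.isHomogeneousOp_homComp 𝒜 e).raises (by omega)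
    · refine eq_zero_of_vanish_degLE 𝒜 h0 hmem fun x hx => ?_
      refine degLE_le (S := LinearMap.ker (BernsteinAlg.homComp 𝒜 δ.toEnd e))
        (fun i hi y hy => ?_) hx
      rw [LinearMap.mem_ker, homComp_of_mem _ _ hy]
      lift e to ℕ using by omega
      rw [← Nat.cast_add, projInt_natCast]
      exact mem_degLE.1 (hM ⟨y, mem_degLE_of_mem hi hy, rfl⟩) _ (by push_cast; omega)
  refine ⟨Finset.Icc (-(N : ℤ)) M, DRing.toEnd_injective (end_ext 𝒜 fun i x hx => ?_)⟩
  rw [map_sum, LinearMap.sum_apply]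
  have h1 : ∀ e, (δ.homComp 𝒜 e).toEnd x = projInt 𝒜 ((i : ℤ) + e) (δ.toEnd x) := fun e => by
    rw [DRing.homComp, DRing.toEnd_mk, homComp_of_mem _ _ hx]
  simp only [h1]
  -- In degree t only the summand e = t - i contributes; if that e lies outside the interval, the
  -- component is zero anyway.
  refine sub_eq_zero.1 (eq_zero_of_proj (𝒜 := 𝒜) fun t => ?_)
  have h2 : ∀ e, GradedAlgebra.proj 𝒜 t (projInt 𝒜 ((i : ℤ) + e) (δ.toEnd x))
      = if (t : ℤ) - i = e then GradedAlgebra.proj 𝒜 t (δ.toEnd x) else 0 := by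
    intro e
    split_ifs with h
    · rw [show (i : ℤ) + e = t by omega, projInt_natCast, proj_same (proj_mem 𝒜 _ _)]
    · unfold projInt
      split_ifs with h3
      · exact proj_ne (proj_mem 𝒜 _ _) (by omega)
      · rw [LinearMap.zero_apply, map_zero]
  rw [map_sub, map_sum]
  simp only [h2, Finset.sum_ite_eq]
  split_ifs with h
  · exact sub_self _
  · rw [zero_sub, neg_eq_zero, ← projInt_natCast, show (t : ℤ) = i + (t - i) by ring,
      ← homComp_of_mem δ.toEnd _ hx, hzero _ h, LinearMap.zero_apply]

theorem isAlgFiltration_genBernstein [Algebra.FiniteType k R] (h0 : 𝒜 0 = 1) {b : ℝ}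
    (hb : (genDegree 𝒜 : ℝ) < b) : IsAlgFiltration (genBernstein 𝒜 b) := by
  have hb0 : 0 ≤ b := (Nat.cast_nonneg _).trans hb.le
  obtain ⟨c, -, hc⟩ := genBernstein_bound 𝒜 h0 hb
  have h1 : ∀ i, (1 : DRing k R) ∈ genBernstein 𝒜 b i := fun i =>
    Submodule.subset_span ⟨0, IsHomogeneousOp.one 𝒜, by simp [ord_one]⟩
  refine ⟨genBernstein_mono 𝒜 b, fun δ => ?_, fun i => finite_of_raises 𝒜 h0 (hc i), ?_,
    genBernstein_mul_le 𝒜 hb0⟩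
  · obtain ⟨E, hE⟩ := δ.exists_sum_homComp 𝒜 h0
    have hex : ∀ e : ℤ, ∃ n : ℕ, δ.homComp 𝒜 e ∈ genBernstein 𝒜 b n := fun e => by
      obtain ⟨n, hn⟩ := exists_nat_ge ((e : ℝ) + b * ord (δ.homComp 𝒜 e))
      exact ⟨n, Submodule.subset_span ⟨e, δ.isHomogeneousOp_homComp 𝒜 e, hn⟩⟩
    choose n hn using hex
    refine ⟨E.sup n, ?_⟩
    rw [← hE]
    exact sum_mem fun e he => genBernstein_mono 𝒜 b (Finset.le_sup he) (hn e)
  -- An operator in the zeroth term has order 0, so it is multiplication by r = δ(1); it does not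
  -- raise degrees, so r ∈ 𝒜 0 = k.
  · refine le_antisymm (fun δ hδ => ?_) (Submodule.one_le.2 (h1 0))
    obtain ⟨h2, h3⟩ := hc 0 δ hδ
    rw [mul_zero, mem_diffOpLE_zero_iff] at h2
    obtain ⟨r, hr⟩ := h2
    have h4 := h3 0 1 (one_mem_degLE 𝒜 h0 0)
    rw [Nat.cast_zero, add_zero, degLE_zero, h0, hr, mul_one] at h4
    obtain ⟨s, rfl⟩ := Submodule.mem_one.1 h4
    refine Submodule.mem_one.2 ⟨s, DRing.toEnd_injective (LinearMap.ext fun x => ?_)⟩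
    rw [hr, AlgHom.commutes, Module.algebraMap_end_apply, Algebra.smul_def]

/-- Changing the slope alters the weight of a generator by at most |b - a| ord δ, and its order is
O(i) because a > w. -/
theorem genBernstein_le_slope [Algebra.FiniteType k R] (h0 : 𝒜 0 = 1) {a b : ℝ}
    (ha : (genDegree 𝒜 : ℝ) < a) : ∃ c : ℕ, 0 < c ∧
      ∀ i, genBernstein 𝒜 a i ≤ genBernstein 𝒜 b (c * i) := by
  obtain ⟨c, -, hc⟩ := exists_ord_le 𝒜 h0 ha
  refine ⟨1 + ⌈|b - a|⌉₊ * c, by omega, fun i => Submodule.span_le.2 ?_⟩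
  rintro δ ⟨d, hd, hle⟩
  by_cases h : δ = 0
  · rw [h]
    exact zero_mem _
  refine Submodule.subset_span ⟨d, hd, ?_⟩
  have h1 : (ord δ : ℝ) ≤ c * i := by exact_mod_cast hc i δ d h hd hle
  have h2 : (b - a) * ord δ ≤ ⌈|b - a|⌉₊ * (c * i) :=
    mul_le_mul ((le_abs_self _).trans (Nat.le_ceil _)) h1 (by positivity) (by positivity)
  push_cast
  nlinarith

end Operators

/-! ### Linear simplicity under linearly equivalent filtrations. -/

section Simple

variable {k : Type*} [Field k] {A : Type*} [Ring A] [Algebra k A] {F F' : ℕ → Submodule k A}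

/-- For δ ∈ F' i ≤ F (c' i), the factors from F (C c' i) lie in F' (c C c' i), whence the new
constant. -/
theorem IsLinearlySimple.of_le {c c' : ℕ} (hc : 0 < c) (hc' : 0 < c')
    (h : ∀ i, F i ≤ F' (c * i)) (h' : ∀ i, F' i ≤ F (c' * i)) (hF : IsLinearlySimple F) :
    IsLinearlySimple F' := by
  obtain ⟨C, hC0, hC⟩ := hF
  refine ⟨c * (C * c'), by positivity, fun i δ hδ h0 => ?_⟩
  have h1 := hC (c' * i) δ (h' i hδ) h0
  have h2 : F (C * (c' * i)) ≤ F' (c * (C * c') * i) := by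
    convert h (C * (c' * i)) using 2
    ring
  exact mul_le_mul' (mul_le_mul' h2 le_rfl) h2 h1

end Simple

/-! ### The lower bound from the differential signature. -/

section Signature

variable {k R : Type*} [Field k] [CommRing R] [Algebra k R] (𝒜 : ℕ → Submodule k R)

theorem mulOp_mul_toEnd (r : R) (δ : DRing k R) (x : R) :
    (mulOp k r * δ).toEnd x = r * δ.toEnd x := rfl

/-- The map `r ↦ r δ` for a differential operator `δ`. -/
noncomputable def mulOpMul (δ : DRing k R) : R →ₗ[k] DRing k R where
  toFun r := mulOp k r * δ
  map_add' a b := DRing.toEnd_injective (LinearMap.ext fun z => by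
    simp only [map_add, LinearMap.add_apply, mulOp_mul_toEnd, add_mul])
  map_smul' c a := DRing.toEnd_injective (LinearMap.ext fun z => by
    simp only [RingHom.id_apply, map_smul, LinearMap.smul_apply, mulOp_mul_toEnd,
      smul_mul_assoc])

theorem isHomogeneousOp_mulOp [SetLike.GradedMonoid 𝒜] {t : ℕ} {r : R} (hr : r ∈ 𝒜 t) :
    IsHomogeneousOp 𝒜 (mulOp k r) t := by
  intro i x hx
  rw [intPiece, if_pos (by omega), show ((i : ℤ) + t).toNat = t + i by omega]
  exact SetLike.mul_mem_graded hr hx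

theorem ord_mulOp (r : R) : ord (mulOp k r) = 0 := Nat.le_zero.1 (ord_le (lsmul_mem r))

variable [GradedAlgebra 𝒜]

/-- Whether P f lies in 𝔪 depends only on the degree-zero component of P f, which is the degree -e
component of P applied to f. -/
theorem mem_differentialPower_of_homogeneous {n e : ℕ} {f : R} (hf : f ∈ 𝒜 e)
    (h : ∀ δ : DRing k R, IsHomogeneousOp 𝒜 δ (-(e : ℤ)) → δ.toEnd ∈ diffOpLE k R R (n - 1) →
      δ.toEnd f = 0) : f ∈ differentialPower k (maxIdeal 𝒜) n := by
  intro P hP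
  rw [mem_maxIdeal_iff]
  have h1 := h (DRing.mk (homComp 𝒜 P (-(e : ℤ))) (n - 1) (homComp_mem 𝒜 _ P hP _)) (by
    intro i x hx
    rw [DRing.toEnd_mk, homComp_of_mem _ _ hx]
    exact projInt_mem 𝒜 _ _) (homComp_mem 𝒜 _ P hP _)
  rw [DRing.toEnd_mk, homComp_of_mem _ _ hf, add_neg_cancel] at h1
  exact (projInt_natCast 𝒜 0 ▸ h1 :)

/-- Homogeneous elements `f_y` of degree `e` that are linearly independent modulo `𝔪⟨n⟩` have a dual
family of differential operators. -/
theorem exists_dual_operator [Nontrivial R] (h0 : 𝒜 0 = 1) {n e : ℕ} {ι : Type*} [Fintype ι]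
    {f : ι → R} (hf : ∀ y, f y ∈ 𝒜 e)
    (hli : ∀ c : ι → k, ∑ y, c y • f y ∈ differentialPower k (maxIdeal 𝒜) n → c = 0)
    [DecidableEq ι] (x : ι) :
    ∃ δ : DRing k R, IsHomogeneousOp 𝒜 δ (-(e : ℤ)) ∧ δ.toEnd ∈ diffOpLE k R R (n - 1) ∧
      ∀ y, δ.toEnd (f y) = if x = y then 1 else 0 := by
  -- ε is any k-linear retraction of R onto k; it only reads off values that already lie in 𝒜 0 = k.
  obtain ⟨ε, hε⟩ := LinearMap.exists_leftInverse_of_injective (Algebra.linearMap k R)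
    (LinearMap.ker_eq_bot.2 (algebraMap k R).injective)
  have hε' : ∀ c : k, ε (algebraMap k R c) = c := fun c => LinearMap.congr_fun hε c
  let V : Submodule k (DRing k R) :=
    { carrier := {δ | IsHomogeneousOp 𝒜 δ (-(e : ℤ)) ∧ δ.toEnd ∈ diffOpLE k R R (n - 1)}
      zero_mem' := ⟨fun i x _ => by simp, by simp⟩
      add_mem' := fun {a b} ha hb => ⟨fun i x hx => by
        rw [map_add, LinearMap.add_apply]
        exact add_mem (ha.1 i x hx) (hb.1 i x hx), by rw [map_add]; exact add_mem ha.2 hb.2⟩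
      smul_mem' := fun c a ha => ⟨fun i x hx => by
        rw [map_smul, LinearMap.smul_apply]
        exact Submodule.smul_mem _ c (ha.1 i x hx), by
          rw [map_smul]; exact Submodule.smul_mem _ c ha.2⟩ }
  have hval : ∀ δ : V, ∀ z ∈ 𝒜 e, algebraMap k R (ε (δ.1.toEnd z)) = δ.1.toEnd z := by
    intro δ z hz
    have h1 := δ.2.1 e z hz
    rw [add_neg_cancel, intPiece, if_pos le_rfl, Int.toNat_zero, h0] at h1
    obtain ⟨c, hc⟩ := Submodule.mem_one.1 h1
    rw [← hc, hε']
  let Ψ : V →ₗ[k] ι → k := LinearMap.pi fun y =>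
    ε.comp ((LinearMap.applyₗ (f y)).comp (DRing.toEnd.toLinearMap.comp V.subtype))
  have hΨ : ∀ δ y, Ψ δ y = ε (δ.1.toEnd (f y)) := fun _ _ => rfl
  -- A functional φ ≠ 0 vanishing on the range of Ψ gives a nontrivial combination of the f y killed
  -- by every operator in V. That combination lies in 𝔪⟨n⟩, against independence.
  have hsurj : LinearMap.range Ψ = ⊤ := by
    by_contra hne
    obtain ⟨φ, hφ0, hφ⟩ := Submodule.exists_le_ker_of_lt_top _ (lt_top_iff_ne_top.2 hne)
    have hφsum : ∀ g : ι → k, φ g = ∑ y, g y * φ (Pi.single y 1) := fun g => by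
      conv_lhs => rw [← Finset.univ_sum_single g]
      rw [map_sum]
      refine Finset.sum_congr rfl fun y _ => ?_
      rw [← smul_eq_mul, ← map_smul, ← Pi.single_smul, smul_eq_mul, mul_one]
    have hz : (fun y => φ (Pi.single y 1)) = 0 := by
      refine hli _ (mem_differentialPower_of_homogeneous 𝒜
        (sum_mem fun y _ => Submodule.smul_mem _ _ (hf y)) fun δ h1 h2 => ?_)
      let δ' : V := ⟨δ, h1, h2⟩
      have h3 : φ (Ψ δ') = 0 := hφ ⟨δ', rfl⟩
      rw [hφsum] at h3
      have h4 := congrArg (algebraMap k R) h3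
      rw [map_sum, map_zero] at h4
      rw [map_sum, ← h4]
      refine Finset.sum_congr rfl fun y _ => ?_
      rw [hΨ, map_mul, hval δ' _ (hf y), map_smul, Algebra.smul_def, mul_comm]
    refine hφ0 (LinearMap.ext fun g => ?_)
    rw [hφsum, LinearMap.zero_apply]
    exact Finset.sum_eq_zero fun y _ => by rw [congrFun hz y, Pi.zero_apply, mul_zero]
  obtain ⟨δ, hδ⟩ := LinearMap.range_eq_top.1 hsurj (Pi.single x 1)
  refine ⟨δ.1, δ.2.1, δ.2.2, fun y => ?_⟩
  rw [← hval δ _ (hf y), ← hΨ, hδ, Pi.single_apply]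
  simp only [eq_comm (a := y)]
  split_ifs <;> simp

/-- A lower bound for the Bernstein filtration by the length of `R / 𝔪⟨n⟩`. -/
theorem finrank_mul_le_finrank_genBernstein [Nontrivial R] [Algebra.FiniteType k R]
    (h0 : 𝒜 0 = 1) {b : ℝ} (hb : (genDegree 𝒜 : ℝ) < b) {A : ℕ} (hA : b ≤ A) (n L : ℕ) :
    Module.finrank k (R ⧸ differentialPower k (maxIdeal 𝒜) n) * Module.finrank k (degLE 𝒜 (L : ℤ))
      ≤ Module.finrank k (genBernstein 𝒜 b (L + A * n)) := by
  classical
  have hb0 : 0 ≤ b := (Nat.cast_nonneg _).trans hb.le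
  let J := differentialPower k (maxIdeal 𝒜) n
  let q : R →ₗ[k] R ⧸ J := (Ideal.Quotient.mkₐ k J).toLinearMap
  have hq : ∀ z, q z = 0 ↔ z ∈ J := fun z => Ideal.Quotient.eq_zero_iff_mem
  -- An infinite-dimensional quotient would have `finrank` 0 and fall under the trivial case, so
  -- finiteness need not be known beforehand.
  rcases Nat.eq_zero_or_pos (Module.finrank k (R ⧸ J)) with hN | hN
  · simp only [J] at hN
    rw [hN, zero_mul]
    exact Nat.zero_le _
  have hQfin : Module.Finite k (R ⧸ J) := Module.finite_of_finrank_pos hN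
  obtain ⟨B, hBsub, hBspan, hBli⟩ := exists_linearIndependent k (⋃ i, q '' (𝒜 i : Set R))
  have hBfin : Fintype B := @Fintype.ofFinite _ (hBli.finite)
  have hspan : (⊤ : Submodule k (R ⧸ J)) ≤ Submodule.span k (Set.range ((↑) : B → R ⧸ J)) := by
    rw [Subtype.range_coe, hBspan]
    rintro z -
    obtain ⟨x, rfl⟩ := Ideal.Quotient.mk_surjective z
    change q x ∈ _
    obtain ⟨m, hm⟩ := exists_mem_degLE 𝒜 x
    rw [← sum_proj hm, map_sum]
    exact sum_mem fun i _ => Submodule.subset_span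
      (Set.mem_iUnion.2 ⟨i, _, proj_mem 𝒜 i x, rfl⟩)
  have hcard : Module.finrank k (R ⧸ J) = Fintype.card B :=
    Module.finrank_eq_card_basis (Module.Basis.mk hBli hspan)
  have hrep : ∀ y : B, ∃ (e : ℕ) (f : R), f ∈ 𝒜 e ∧ q f = y := fun y => by
    obtain ⟨e, f, hf, hfy⟩ := Set.mem_iUnion.1 (hBsub y.2)
    exact ⟨e, f, hf, hfy⟩
  choose e f hf hqf using hrep
  have hdual : ∀ x : B, ∃ δ : DRing k R, IsHomogeneousOp 𝒜 δ (-(e x : ℤ)) ∧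
      δ.toEnd ∈ diffOpLE k R R (n - 1) ∧
      ∀ y, e y = e x → δ.toEnd (f y) = if x = y then 1 else 0 := by
    intro x
    obtain ⟨δ, h1, h2, h3⟩ := exists_dual_operator 𝒜 h0 (n := n) (e := e x)
      (ι := {y : B // e y = e x}) (f := fun y => f y.1) (fun y => by
        have h := hf y.1
        rwa [y.2] at h) (fun c hc => by
        have hli := hBli.comp (Subtype.val : {y : B // e y = e x} → B) Subtype.val_injective
        rw [Fintype.linearIndependent_iff] at hli
        refine funext (hli c ?_)
        have h := (hq _).2 hc
        rw [map_sum] at h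
        rw [← h]
        exact Finset.sum_congr rfl fun y _ => by rw [map_smul, hqf]; rfl) ⟨x, rfl⟩
    refine ⟨δ, h1, h2, fun y hy => ?_⟩
    rw [h3 ⟨y, hy⟩]
    simp
  choose δ hδ1 hδ2 hδ3 using hdual
  -- The operators form a triangular system. At f x, those with e y > e x land in negative degree,
  -- those with e y < e x have zero coefficient by induction, and within one degree duality isolates
  -- r x.
  have hindep : ∀ r : B → R, (∑ y, mulOp k (r y) * δ y) = 0 → r = 0 := by
    intro r hr
    have : ∀ m : ℕ, ∀ x, e x = m → r x = 0 := by
      intro m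
      induction m using Nat.strong_induction_on with
      | _ m ih =>
        intro x hx
        have h1 := congrArg (fun P => (DRing.toEnd P) (f x)) hr
        simp only [map_sum, LinearMap.sum_apply, map_zero, LinearMap.zero_apply,
          mulOp_mul_toEnd] at h1
        rw [Finset.sum_eq_single x] at h1
        · rwa [hδ3 x x rfl, if_pos rfl, mul_one] at h1
        · intro y _ hyx
          rcases lt_trichotomy (e y) (e x) with h | h | h
          · rw [ih (e y) (by omega) y rfl, zero_mul]
          · rw [hδ3 y x h.symm, if_neg hyx, mul_zero]
          · have h2 := hδ1 y (e x) (f x) (hf x)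
            rw [intPiece, if_neg (by omega), Submodule.mem_bot] at h2
            rw [h2, mul_zero]
        · exact fun h => absurd (Finset.mem_univ x) h
    exact funext fun x => this _ x rfl
  -- For r of degree t ≤ L the product has degree t - e x ≤ L and order at most n, hence weight at
  -- most L + b n ≤ L + A n.
  have hmem : ∀ r ∈ degLE 𝒜 (L : ℤ), ∀ x, mulOp k r * δ x ∈ genBernstein 𝒜 b (L + A * n) := by
    intro r hr x
    refine degLE_le (S := (genBernstein 𝒜 b (L + A * n)).comap
      (mulOpMul (δ x))) (fun t ht r hr => ?_) hr
    change mulOp k r * δ x ∈ genBernstein 𝒜 b (L + A * n)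
    refine Submodule.subset_span ⟨t + -(e x : ℤ), (isHomogeneousOp_mulOp 𝒜 hr).mul 𝒜 (hδ1 x), ?_⟩
    have h1 : ord (mulOp k r * δ x) ≤ n := by
      have h2 := ord_mul_le (mulOp k r) (δ x)
      have h3 := ord_le (hδ2 x)
      rw [ord_mulOp] at h2
      omega
    have h2 : b * ord (mulOp k r * δ x) ≤ A * n :=
      mul_le_mul hA (by exact_mod_cast h1) (by positivity) (by positivity)
    have h3 : (t : ℝ) ≤ L := by exact_mod_cast ht
    have h4 : (0 : ℝ) ≤ e x := by positivity
    push_cast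
    linarith
  have hfin := finite_degLE 𝒜 h0
  have hBfin2 := (isAlgFiltration_genBernstein 𝒜 h0 hb).finite (L + A * n)
  let Θ : (B → degLE 𝒜 (L : ℤ)) →ₗ[k] genBernstein 𝒜 b (L + A * n) :=
    LinearMap.codRestrict _ (∑ y, (mulOpMul (δ y)).comp ((degLE 𝒜 (L : ℤ)).subtype.comp
      (LinearMap.proj y))) fun r => by
        rw [LinearMap.sum_apply]
        exact sum_mem fun y _ => hmem _ (r y).2 y
  have hΘ : Function.Injective Θ := (injective_iff_map_eq_zero Θ).2 fun r hr => by
    have h0 := congrArg Subtype.val hr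
    rw [LinearMap.codRestrict_apply, LinearMap.sum_apply] at h0
    have h1 := hindep (fun y => (r y).1) h0
    exact funext fun y => Subtype.ext (congrFun h1 y)
  have h1 := LinearMap.finrank_le_finrank_of_injective hΘ
  rw [Module.finrank_pi_fintype, Finset.sum_const, Finset.card_univ, smul_eq_mul, ← hcard] at h1
  exact h1

theorem frequently_le_finrank_genBernstein [Nontrivial R] [Algebra.FiniteType k R]
    (h0 : 𝒜 0 = 1) (hsig : 0 < diffSignature 𝒜) {b : ℝ} (hb : (genDegree 𝒜 : ℝ) < b) :
    ∃ c : ℝ, 0 < c ∧ ∃ᶠ i : ℕ in atTop, c * (i : ℝ) ^ ((2 * (krullDim R : ℝ≥0) : ℝ≥0) : ℝ)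
      ≤ (Module.finrank k (genBernstein 𝒜 b i) : ℝ) := by
  set d := krullDim R with hd
  obtain ⟨c, hc⟩ := exists_le_finrank_degLE 𝒜 h0
  obtain ⟨A, hA⟩ := exists_nat_ge (max b 1)
  have hA1 : b ≤ A := (le_max_left _ _).trans hA
  have hA0 : 1 ≤ A := by exact_mod_cast (le_max_right b 1).trans hA
  obtain ⟨ε, hε0, hε⟩ := ENNReal.lt_iff_exists_nnreal_btwn.1 hsig
  have hε0' : (0 : ℝ) < ε := by exact_mod_cast hε0
  have hfreq := frequently_lt_of_lt_limsup (by isBoundedDefault) hε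
  have hB0 : 0 < c + A := by omega
  have hfac : (0 : ℝ) < d.factorial := by exact_mod_cast d.factorial_pos
  -- With n = i and L = c i the Bernstein index is (c + A) i. Infinitely often dim R/𝔪⟨i⟩ ≥ ε i^d /
  -- d!, and dim R_{≤ci} ≥ i^d; the last factor of the constant compensates for rescaling the index.
  refine ⟨ε / d.factorial / ((c + A : ℕ) : ℝ) ^ (2 * d), by positivity, ?_⟩
  refine (tendsto_mul_add_atTop hB0 0).frequently
    ((hfreq.and_eventually (eventually_gt_atTop 0)).mono ?_)
  rintro i ⟨hi, hi0⟩
  have hi0' : (0 : ℝ) < i := by exact_mod_cast hi0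
  rw [add_zero]
  set N := Module.finrank k (R ⧸ differentialPower k (maxIdeal 𝒜) i) with hN
  have h1 : (ε : ℝ) * i ^ d ≤ d.factorial * N := by
    rw [ENNReal.lt_div_iff_mul_lt (by left; simp [hi0.ne']) (by left; simp)] at hi
    have h2 : ((ε * (i : ℝ≥0) ^ d : ℝ≥0) : ℝ≥0∞) < ((d.factorial * N : ℝ≥0) : ℝ≥0∞) := by
      push_cast
      exact hi
    exact_mod_cast (ENNReal.coe_lt_coe.1 h2).le
  have h2 : (N : ℝ) * (i : ℝ) ^ d ≤ Module.finrank k (genBernstein 𝒜 b ((c + A) * i)) := by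
    have h3 := finrank_mul_le_finrank_genBernstein 𝒜 h0 hb hA1 i (c * i)
    have h4 : i ^ d ≤ Module.finrank k (degLE 𝒜 ((c * i : ℕ) : ℤ)) :=
      (Nat.pow_le_pow_left (Nat.le_succ i) d).trans (hc i)
    rw [← add_mul] at h3
    exact_mod_cast (Nat.mul_le_mul_left N h4).trans h3
  have h3 : (((c + A) * i : ℕ) : ℝ) ^ ((2 * (d : ℝ≥0) : ℝ≥0) : ℝ)
      = ((c + A : ℕ) : ℝ) ^ (2 * d) * ((i : ℝ) ^ d * (i : ℝ) ^ d) := by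
    rw [NNReal.coe_mul, NNReal.coe_ofNat, NNReal.coe_natCast]
    rw [show (2 * (d : ℝ)) = ((2 * d : ℕ) : ℝ) by push_cast; ring, Real.rpow_natCast, Nat.cast_mul,
      mul_pow, ← pow_add, two_mul]
  have hBpos : (0 : ℝ) < ((c + A : ℕ) : ℝ) ^ (2 * d) := by positivity
  rw [h3, ← mul_assoc, div_mul_cancel₀ _ hBpos.ne', ← mul_assoc]
  refine le_trans ?_ h2
  gcongr
  rw [div_mul_eq_mul_div, div_le_iff₀ hfac]
  linarith

/-- `R` itself has a compatible filtration of growth `dim R`. -/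
theorem exists_modFiltration [Nontrivial R] [Algebra.FiniteType k R] (h0 : 𝒜 0 = 1) {b : ℝ}
    (hb : (genDegree 𝒜 : ℝ) < b) : HasGrowth (genBernstein 𝒜 b) (krullDim R) R := by
  obtain ⟨C, hC⟩ := exists_finrank_degLE_le 𝒜 h0
  obtain ⟨c, -, hc⟩ := genBernstein_bound 𝒜 h0 hb
  refine ⟨fun i => degLE 𝒜 (i : ℤ), ⟨fun i j h => degLE_mono 𝒜 (by exact_mod_cast h),
    exists_mem_degLE 𝒜, fun i => finite_degLE 𝒜 h0 i, fun i j δ hδ x hx => ?_⟩, C, hC⟩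
  have := (hc i δ hδ).2 j x hx
  rw [Nat.cast_add, add_comm]
  exact this

/-- The conditions on the Bernstein filtrations in the definition of a Bernstein algebra. -/
theorem genBernstein_setting [Nontrivial R] [Algebra.FiniteType k R]
    (h0 : 𝒜 0 = 1) {a : ℝ} (ha : (genDegree 𝒜 : ℝ) < a) (hsig : 0 < diffSignature 𝒜)
    (hsimple : IsLinearlySimple (genBernstein 𝒜 a)) {b : ℝ} (hb : (genDegree 𝒜 : ℝ) < b) :
    IsHolonomicSetting (genBernstein 𝒜 b) ∧
      filtDim (genBernstein 𝒜 b) = 2 * (krullDim R : ℝ≥0∞) := by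
  obtain ⟨c, hc0, hc⟩ := genBernstein_le_slope 𝒜 h0 (b := b) ha
  obtain ⟨c', hc0', hc'⟩ := genBernstein_le_slope 𝒜 h0 (b := a) hb
  have hs : IsLinearlySimple (genBernstein 𝒜 b) := hsimple.of_le hc0 hc0' hc hc'
  obtain ⟨G, hG, C, hC⟩ := exists_modFiltration 𝒜 h0 hb
  -- The module R itself, filtered by degree with growth i^d, yields the upper bound i^(2d) for the
  -- operators.
  obtain ⟨K, hK⟩ := exists_bound_sq_of_linearlySimple hs hG (eventually_bound_of_nat hC)
  obtain ⟨ε, hε, hlow⟩ := frequently_le_finrank_genBernstein 𝒜 h0 hsig hb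
  have hdim : filtDim (genBernstein 𝒜 b) = ((2 * (krullDim R : ℝ≥0) : ℝ≥0) : ℝ≥0∞) :=
    le_antisymm (filtDim_le_of_bound hK) (le_filtDim_of_frequently hε hlow)
  refine ⟨⟨isAlgFiltration_genBernstein 𝒜 h0 hb, hs, ?_, filtMult_pos_of_frequently hε hdim hlow,
    filtMult_lt_top_of_bound hdim hK⟩, by rw [hdim]; simp⟩
  rw [hdim]
  exact ENNReal.coe_lt_top

end Signature

/-! ### Growth of localizations, of R_f f^s and of Čech cohomology. -/

section LocalizationGrowth

variable {K A : Type*} [Field K] [CommRing A] [Algebra K A]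

/-- A filtration `Φ` of `A` of growth `d`, stable under multiplication by elements of `A` up to a
bounded shift, such that the operators in `F i` have order at most `c i` and raise `Φ` by `i`. -/
structure IsTame (F : ℕ → Submodule K (DRing K A)) (Φ : ℤ → Submodule K A) (c d : ℕ) : Prop where
  mono : Monotone Φ
  exhaustive : ∀ x, ∃ n : ℕ, x ∈ Φ n
  finite : ∀ n : ℕ, Module.Finite K (Φ n)
  growth : ∃ C : ℕ, ∀ n : ℕ, Module.finrank K (Φ n) ≤ C * (n + 1) ^ d
  mul : ∀ f : A, ∃ u : ℕ, Raises Φ (Algebra.lsmul K K A f) u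
  pos : 0 < c
  bound : ∀ i, ∀ δ ∈ F i, δ.toEnd ∈ diffOpLE K A A (c * i) ∧ Raises Φ δ.toEnd i

variable {Φ : ℤ → Submodule K A} {f : A} {u : ℕ}

theorem Raises.pow_mul (hf : Raises Φ (Algebra.lsmul K K A f) u) (p : ℕ) {j : ℤ} {x : A}
    (hx : x ∈ Φ j) : f ^ p * x ∈ Φ (j + p * u) := by
  induction p with
  | zero => simpa using hx
  | succ p ih =>
    have h : f * (f ^ p * x) ∈ Φ (j + p * u + u) := hf _ _ ih
    rw [← mul_assoc, ← pow_succ'] at h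
    convert h using 2
    push_cast
    ring

theorem Raises.comm (hf : Raises Φ (Algebra.lsmul K K A f) u) {δ : DRing K A} {e : ℤ}
    (hδ : Raises Φ δ.toEnd e) :
    Raises Φ (δ * mulOp K f - mulOp K f * δ).toEnd (e + u) := by
  intro j x hx
  rw [toEnd_bracket, bracket_apply]
  refine sub_mem ?_ ?_
  · have := hδ _ _ (hf _ _ hx)
    rwa [Algebra.lsmul_coe, add_assoc, add_comm (u : ℤ)] at this
  · have := hf _ _ (hδ _ _ hx)
    rwa [Algebra.lsmul_coe, add_assoc] at this

theorem Raises.iterComm (hf : Raises Φ (Algebra.lsmul K K A f) u) {δ : DRing K A} {e : ℤ}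
    (hδ : Raises Φ δ.toEnd e) (i : ℕ) :
    Raises Φ (BernsteinAlg.iterComm f δ i).toEnd (e + i * u) := by
  induction i with
  | zero => simpa [BernsteinAlg.iterComm] using hδ
  | succ i ih =>
    have := hf.comm ih
    rw [BernsteinAlg.iterComm]
    convert this using 1
    push_cast
    ring

theorem iterComm_mem {n : ℕ} (i : ℕ) : ∀ δ : DRing K A, δ.toEnd ∈ diffOpLE K A A (n + i) →
    (iterComm f δ i).toEnd ∈ diffOpLE K A A n := by
  induction i with
  | zero => exact fun δ hδ => hδ
  | succ i ih =>
    intro δ hδ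
    rw [iterComm_succ']
    refine ih _ ?_
    rw [toEnd_bracket]
    exact mem_succ.1 hδ f

theorem invAway_mul (f : A) :
    invAway f * algebraMap A (Localization (Submonoid.powers f)) f = 1 := by
  rw [mul_comm]
  exact IsLocalization.Away.mul_invSelf f

theorem invAway_pow_mul (f x : A) (m p : ℕ) :
    invAway f ^ (m + p) * algebraMap A (Localization (Submonoid.powers f)) (f ^ p * x)
      = invAway f ^ m * algebraMap A _ x := by
  have h : invAway f ^ p * algebraMap A (Localization (Submonoid.powers f)) f ^ p = 1 := by
    rw [← mul_pow, invAway_mul, one_pow]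
  rw [map_mul, map_pow, pow_add]
  linear_combination (invAway f ^ m * algebraMap A _ x) * h

/-- The numerator of `δ (x / f ^ m)`, written with denominator `f ^ (m + n)`. -/
theorem extend_bound (hf : Raises Φ (Algebra.lsmul K K A f) u) (n : ℕ) : ∀ (δ : DRing K A) (e : ℤ),
    δ.toEnd ∈ diffOpLE K A A n → Raises Φ δ.toEnd e → ∀ (m : ℕ) (j : ℤ), ∀ x ∈ Φ j,
    ∃ z ∈ Φ (j + e + n * u), extend (Submonoid.powers f) (Localization (Submonoid.powers f)) δ
      (invAway f ^ m * algebraMap A _ x) = invAway f ^ (m + n) * algebraMap A _ z := by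
  -- The quotient rule for a pole of order m + 1: it reduces either the pole or, through [δ, f], the
  -- order of the operator, which drives the double induction below.
  have step : ∀ (δ : DRing K A) (m : ℕ) (x : A),
      extend (Submonoid.powers f) (Localization (Submonoid.powers f)) δ
        (invAway f ^ (m + 1) * algebraMap A _ x) = invAway f *
      (extend (Submonoid.powers f) (Localization (Submonoid.powers f)) δ
        (invAway f ^ m * algebraMap A _ x) -
      extend (Submonoid.powers f) (Localization (Submonoid.powers f))
        (δ * mulOp K f - mulOp K f * δ) (invAway f ^ (m + 1) * algebraMap A _ x)) := by
    intro δ m x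
    have h := invAway_mul f
    have h1 : algebraMap A (Localization (Submonoid.powers f)) f *
        (invAway f ^ (m + 1) * algebraMap A _ x) = invAway f ^ m * algebraMap A _ x := by
      rw [pow_succ]
      linear_combination (invAway f ^ m * algebraMap A _ x) * h
    have h2 : ∀ y, extend (Submonoid.powers f) (Localization (Submonoid.powers f))
        (δ * mulOp K f - mulOp K f * δ) y
        = extend (Submonoid.powers f) (Localization (Submonoid.powers f)) δ
            (algebraMap A (Localization (Submonoid.powers f)) f * y)
          - algebraMap A (Localization (Submonoid.powers f)) f *
            extend (Submonoid.powers f) (Localization (Submonoid.powers f)) δ y := fun y => by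
      rw [map_sub, map_mul, map_mul, extend_mulOp, ← Algebra.smul_def, ← Algebra.smul_def]
      rfl
    rw [h2, h1, sub_sub_cancel, ← mul_assoc, h, one_mul]
  induction n with
  | zero =>
    intro δ e hδ he m
    have hc : δ * mulOp K f - mulOp K f * δ = 0 := DRing.toEnd_injective (by
      rw [toEnd_bracket, mem_zero.1 hδ f, map_zero])
    induction m with
    | zero =>
      intro j x hx
      refine ⟨δ.toEnd x, by simpa using he j x hx, ?_⟩
      simp [extend_algebraMap]
    | succ m ih =>
      intro j x hx
      obtain ⟨z, hz, hzx⟩ := ih j x hx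
      refine ⟨z, hz, ?_⟩
      rw [step, hc, map_zero, LinearMap.zero_apply, sub_zero, hzx]
      ring
  | succ n ihn =>
    intro δ e hδ he m
    induction m with
    | zero =>
      intro j x hx
      refine ⟨f ^ (n + 1) * δ.toEnd x, hf.pow_mul (n + 1) (he j x hx), ?_⟩
      rw [invAway_pow_mul, pow_zero, one_mul, one_mul, extend_algebraMap]
    | succ m ihm =>
      intro j x hx
      obtain ⟨z, hz, hzx⟩ := ihm j x hx
      obtain ⟨z', hz', hzx'⟩ := ihn _ (e + u) (by rw [toEnd_bracket]; exact mem_succ.1 hδ f)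
        (hf.comm he) (m + 1) j x hx
      -- Both numerators lie in the same term of Φ: the commutator costs one more u but has order
      -- one less. So the shift does not depend on m, which keeps the growth at O(i^d).
      refine ⟨z - z', sub_mem hz ?_, ?_⟩
      · convert hz' using 2
        push_cast
        ring
      · rw [step, hzx, hzx', map_sub]
        ring

/-- In the i-th summand, i further powers of f appear in the denominator and i u in the degree,
while the order drops by i. The estimate is therefore the same as for the untwisted action. -/
theorem fsAct_bound (hf : Raises Φ (Algebra.lsmul K K A f) u) (s : K) (δ : DRing K A) {e : ℤ}
    (he : Raises Φ δ.toEnd e) (m : ℕ) (j : ℤ) {x : A} (hx : x ∈ Φ j) :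
    ∃ z ∈ Φ (j + e + ord δ * u), fsAct f s δ (invAway f ^ m * algebraMap A _ x)
      = invAway f ^ (m + ord δ) * algebraMap A (Localization (Submonoid.powers f)) z := by
  have hterm : ∀ i ∈ Finset.range (ord δ + 1), ∃ z ∈ Φ (j + e + ord δ * u),
      ((Algebra.lsmul K K (Localization (Submonoid.powers f)) (invAway f ^ i)) *
      extend (Submonoid.powers f) (Localization (Submonoid.powers f)) (iterComm f δ i))
        (invAway f ^ m * algebraMap A _ x)
      = invAway f ^ (m + ord δ) * algebraMap A (Localization (Submonoid.powers f)) z := by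
    intro i hi
    have hi' : ord δ - i + i = ord δ := Nat.sub_add_cancel (by
      have := Finset.mem_range.1 hi
      omega)
    obtain ⟨z, hz, hzx⟩ := extend_bound hf (ord δ - i) (iterComm f δ i) (e + i * u)
      (iterComm_mem i δ (by rw [hi']; exact mem_ord δ)) (hf.iterComm he i) m j x hx
    refine ⟨z, ?_, ?_⟩
    · convert hz using 2
      have h : (ord δ : ℤ) = (ord δ - i : ℕ) + i := by exact_mod_cast hi'.symm
      rw [h]
      ring
    · have h : i + (m + (ord δ - i)) = m + ord δ := by omega
      rw [Module.End.mul_apply, hzx, ← h, pow_add _ i, mul_assoc]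
      rfl
  choose! z hz hzx using hterm
  refine ⟨∑ i ∈ Finset.range (ord δ + 1), binom s i • z i,
    sum_mem fun i hi => Submodule.smul_mem _ _ (hz i hi), ?_⟩
  rw [fsAct, LinearMap.sum_apply, map_sum, Finset.mul_sum]
  refine Finset.sum_congr rfl fun i hi => ?_
  rw [LinearMap.smul_apply, hzx i hi, algebraMap_smul', mul_smul_comm]

/-- G i consists of the fractions with denominator f^(c i) and numerator in Φ (c' i), so its
dimension is at most that of Φ (c' i). The action ρ is kept abstract to serve both R_f and R_f f^s.
-/
theorem exists_localization_filtration {F : ℕ → Submodule K (DRing K A)} {c d : ℕ}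
    (h : IsTame F Φ c d) (hf : Raises Φ (Algebra.lsmul K K A f) u)
    (ρ : DRing K A → Module.End K (Localization (Submonoid.powers f)))
    (hρ : ∀ (δ : DRing K A) (e : ℤ), Raises Φ δ.toEnd e → ∀ (m : ℕ) (j : ℤ), ∀ x ∈ Φ j,
      ∃ z ∈ Φ (j + e + ord δ * u), ρ δ (invAway f ^ m * algebraMap A _ x)
        = invAway f ^ (m + ord δ) * algebraMap A _ z) :
    ∃ G : ℕ → Submodule K (Localization (Submonoid.powers f)), Monotone G ∧
      (∀ x, ∃ i, x ∈ G i) ∧ (∀ i, Module.Finite K (G i)) ∧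
      (∀ i j, ∀ δ ∈ F i, ∀ x ∈ G j, ρ δ x ∈ G (i + j)) ∧
      ∃ C : ℕ, ∀ i, Module.finrank K (G i) ≤ C * (i + 1) ^ d := by
  let ι : A →ₗ[K] Localization (Submonoid.powers f) :=
    (IsScalarTower.toAlgHom K A (Localization (Submonoid.powers f))).toLinearMap
  -- Per unit of the index, the numerator moves by 1 through the operator and by c u through the c
  -- powers of f added to the denominator.
  let c' : ℕ := 1 + c * u
  let G : ℕ → Submodule K (Localization (Submonoid.powers f)) := fun i =>
    (Φ ((c' * i : ℕ) : ℤ)).map ((LinearMap.mulLeft K (invAway f ^ (c * i))).comp ι)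
  -- A fraction with the smaller denominator f^m is brought to f^(c i) by multiplying its numerator
  -- by f^p.
  have hmem : ∀ (i m p : ℕ) (j : ℤ) (x : A), m + p = c * i → j + p * u ≤ ((c' * i : ℕ) : ℤ) →
      x ∈ Φ j → invAway f ^ m * algebraMap A (Localization (Submonoid.powers f)) x ∈ G i := by
    intro i m p j x hm hj hx
    refine ⟨f ^ p * x, h.mono hj (hf.pow_mul p hx), ?_⟩
    rw [← invAway_pow_mul f x m p, hm]
    rfl
  have hfin := h.finite
  refine ⟨G, ?_, fun y => ?_, fun i => inferInstance, ?_, ?_⟩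
  · rintro i j hij _ ⟨x, hx, rfl⟩
    obtain ⟨l, rfl⟩ := Nat.exists_eq_add_of_le hij
    refine hmem (i + l) (c * i) (c * l) _ x (by ring) ?_ hx
    have : c' * i + c * l * u ≤ c' * (i + l) := by
      simp only [c']
      nlinarith
    exact_mod_cast this
  · obtain ⟨⟨x, s⟩, hx⟩ := IsLocalization.surj (Submonoid.powers f) y
    obtain ⟨m, hm⟩ := s.2
    simp only [← hm, map_pow] at hx
    have hy : y = invAway f ^ m * algebraMap A _ x := by
      have h1 : invAway f ^ m * algebraMap A (Localization (Submonoid.powers f)) f ^ m = 1 := by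
        rw [← mul_pow, invAway_mul, one_pow]
      linear_combination (-y) * h1 + invAway f ^ m * hx
    obtain ⟨n, hn⟩ := h.exhaustive x
    have hc := h.pos
    -- Since c > 0, index m + n leaves room for a pole of order m and a numerator in Φ n.
    have h1 : m ≤ c * (m + n) := by nlinarith
    refine ⟨m + n, ?_⟩
    rw [hy]
    refine hmem (m + n) m (c * (m + n) - m) n x (by omega) ?_ hn
    have h2 : (c * (m + n) - m) * u ≤ c * (m + n) * u := Nat.mul_le_mul_right _ (Nat.sub_le _ _)
    have h3 : n + (c * (m + n) - m) * u ≤ c' * (m + n) := by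
      simp only [c']
      nlinarith
    exact_mod_cast h3
  · rintro i j δ hδ _ ⟨x, hx, rfl⟩
    obtain ⟨h1, h2⟩ := h.bound i δ hδ
    obtain ⟨z, hz, hzx⟩ := hρ δ i h2 (c * j) _ x hx
    have ho := ord_le h1
    change ρ δ (invAway f ^ (c * j) * algebraMap A _ x) ∈ G (i + j)
    rw [hzx]
    -- The missing c i - ord δ powers of f and the ord δ already spent cost c i u together, so the
    -- total shift is i + c u i = c' i.
    refine hmem (i + j) _ (c * i - ord δ) _ z (by rw [mul_add]; omega) ?_ hz
    have h3 : c' * j + i + ord δ * u + (c * i - ord δ) * u ≤ c' * (i + j) := by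
      rw [add_assoc, ← add_mul, Nat.add_sub_cancel' ho]
      simp only [c']
      nlinarith
    exact_mod_cast h3
  · obtain ⟨C, hC⟩ := h.growth
    refine ⟨C * (c' + 1) ^ d, fun i => (Submodule.finrank_map_le _ _).trans ((hC _).trans ?_)⟩
    rw [mul_assoc, ← mul_pow]
    gcongr
    nlinarith

theorem hasGrowth_locModule {F : ℕ → Submodule K (DRing K A)} {c d : ℕ}
    (h : IsTame F Φ c d) (f : A) : HasGrowth F d (LocModule K (Submonoid.powers f)) := by
  obtain ⟨u, hu⟩ := h.mul f
  obtain ⟨G, h1, h2, h3, h4, h5⟩ := exists_localization_filtration h hu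
    (fun δ => extend (Submonoid.powers f) (Localization (Submonoid.powers f)) δ)
    fun δ e he m j x hx => extend_bound hu (ord δ) δ e (mem_ord δ) he m j x hx
  exact ⟨G, ⟨h1, h2, h3, h4⟩, h5⟩

theorem hasGrowth_fsModule [CharZero K] {F : ℕ → Submodule K (DRing K A)} {c d : ℕ}
    (h : IsTame F Φ c d) (f : A) (s : K) : HasGrowth F d (FsModule f s) := by
  obtain ⟨u, hu⟩ := h.mul f
  obtain ⟨G, h1, h2, h3, h4, h5⟩ := exists_localization_filtration h hu (fsAct f s)
    fun δ e he m j x hx => fsAct_bound hu s δ he m j hx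
  exact ⟨G, ⟨h1, h2, h3, h4⟩, h5⟩

/-- Cohomology is a subquotient of a finite product of localizations. -/
theorem hasGrowth_cechCohomology {F : ℕ → Submodule K (DRing K A)} {c d : ℕ}
    (h : IsTame F Φ c d) {ℓ : ℕ} (g : Fin ℓ → A) (p : ℕ) :
    HasGrowth F d (CechCohomology K g p) := by
  have h1 : HasGrowth F d (CechObj K g p) := HasGrowth.pi fun T => hasGrowth_locModule h _
  have h2 : HasGrowth F d (LinearMap.ker (cechD K g p)) :=
    h1.of_injective (Submodule.subtype _) (Submodule.subtype_injective _)
  exact h2.of_surjective (Submodule.mkQ _) (Submodule.mkQ_surjective _)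

theorem isTame_genBernstein {k R : Type*} [Field k] [CommRing R] [Algebra k R]
    (𝒜 : ℕ → Submodule k R) [GradedAlgebra 𝒜] [Nontrivial R] [Algebra.FiniteType k R]
    (h0 : 𝒜 0 = 1) {b : ℝ} (hb : (genDegree 𝒜 : ℝ) < b) :
    ∃ c, IsTame (genBernstein 𝒜 b) (degLE 𝒜) c (krullDim R) := by
  obtain ⟨c, hc0, hc⟩ := genBernstein_bound 𝒜 h0 hb
  refine ⟨c, degLE_mono 𝒜, exists_mem_degLE 𝒜, fun n => finite_degLE 𝒜 h0 n,
    exists_finrank_degLE_le 𝒜 h0, fun f => ?_, hc0, hc⟩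
  obtain ⟨u, hu⟩ := exists_mem_degLE 𝒜 f
  refine ⟨u, fun j x hx => ?_⟩
  rw [add_comm]
  exact mul_mem_degLE 𝒜 hu hx

end LocalizationGrowth

/-! ### Differential operators and their filtrations after extension of scalars. -/

section BaseChangeOps

variable {k R : Type*} [Field k] [CommRing R] [Algebra k R] (K : Type*) [Field K] [Algebra k K]

theorem DRing.toEnd_baseChange (δ : DRing k R) :
    (δ.baseChange K).toEnd = δ.toEnd.baseChange K := rfl

theorem DRing.baseChange_add (δ ε : DRing k R) :
    (δ + ε).baseChange K = δ.baseChange K + ε.baseChange K :=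
  DRing.toEnd_injective (by simp only [toEnd_baseChange, map_add, LinearMap.baseChange_add])

theorem DRing.baseChange_smul (c : k) (δ : DRing k R) :
    (c • δ).baseChange K = algebraMap k K c • δ.baseChange K :=
  DRing.toEnd_injective (by
    simp only [toEnd_baseChange, map_smul, LinearMap.baseChange_smul, algebraMap_smul])

theorem DRing.baseChange_mul (δ ε : DRing k R) :
    (δ * ε).baseChange K = δ.baseChange K * ε.baseChange K :=
  DRing.toEnd_injective (by simp only [toEnd_baseChange, map_mul, LinearMap.baseChange_mul])

theorem DRing.baseChange_one : (1 : DRing k R).baseChange K = 1 :=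
  DRing.toEnd_injective (by simp only [toEnd_baseChange, map_one, LinearMap.baseChange_one])

theorem DRing.baseChange_sum {ι : Type*} (s : Finset ι) (δ : ι → DRing k R) :
    (∑ i ∈ s, δ i).baseChange K = ∑ i ∈ s, (δ i).baseChange K :=
  DRing.toEnd_injective (by
    simp only [toEnd_baseChange, map_sum]
    exact map_sum (LinearMap.baseChangeHom k K R R) _ _)

/-- Base change preserves linear independence. -/
theorem DRing.linearIndependent_baseChange {ι : Type*} [Fintype ι] {δ : ι → DRing k R}
    (hδ : LinearIndependent k δ) : LinearIndependent K fun i => (δ i).baseChange K := by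
  rw [Fintype.linearIndependent_iff] at hδ ⊢
  intro c hc i
  -- Evaluating a relation over K at 1 ⊗ x and applying φ to the coefficients gives a relation over
  -- k among the δ i.
  rw [← Module.forall_dual_apply_eq_zero_iff k]
  intro φ
  refine hδ (fun i => φ (c i)) (DRing.toEnd_injective (LinearMap.ext fun x => ?_)) i
  have h1 := LinearMap.congr_fun (congrArg DRing.toEnd hc) ((1 : K) ⊗ₜ[k] x)
  have h2 := congrArg (fun y => TensorProduct.lid k R (φ.rTensor R y)) h1
  simp only [map_sum, map_smul, LinearMap.sum_apply, LinearMap.smul_apply, toEnd_baseChange,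
    LinearMap.baseChange_tmul, TensorProduct.smul_tmul', smul_eq_mul, mul_one,
    LinearMap.rTensor_tmul, TensorProduct.lid_tmul, map_zero, LinearMap.zero_apply] at h2 ⊢
  exact h2

variable {F : ℕ → Submodule k (DRing k R)}

theorem DRing.baseChange_mem {i : ℕ} {δ : DRing k R} (hδ : δ ∈ F i) :
    δ.baseChange K ∈ baseChangeFilt K F i :=
  Submodule.subset_span ⟨δ, hδ, rfl⟩

theorem baseChangeFilt_eq_span_range {i : ℕ} {ι : Type*} [Fintype ι]
    (b : Module.Basis ι k (F i)) : baseChangeFilt K F i =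
      Submodule.span K (Set.range fun j => ((b j : F i) : DRing k R).baseChange K) := by
  refine le_antisymm (Submodule.span_le.2 ?_) (Submodule.span_le.2 ?_)
  · rintro _ ⟨δ, hδ, rfl⟩
    have h := congrArg Subtype.val (b.sum_repr ⟨δ, hδ⟩)
    rw [AddSubmonoidClass.coe_finsetSum] at h
    dsimp only at h
    rw [← h, DRing.baseChange_sum]
    refine sum_mem fun j _ => ?_
    rw [Submodule.coe_smul, DRing.baseChange_smul]
    exact Submodule.smul_mem _ _ (Submodule.subset_span ⟨j, rfl⟩)
  · rintro _ ⟨j, rfl⟩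
    exact DRing.baseChange_mem K (b j).2

theorem finite_baseChangeFilt (i : ℕ) [Module.Finite k (F i)] :
    Module.Finite K (baseChangeFilt K F i) := by
  rw [baseChangeFilt_eq_span_range K (Module.finBasis k (F i))]
  exact Module.Finite.span_of_finite K (Set.finite_range _)

/-- A basis of F i stays independent over K, so dimension and multiplicity of the filtration are
unchanged. -/
theorem finrank_baseChangeFilt (i : ℕ) [Module.Finite k (F i)] :
    Module.finrank K (baseChangeFilt K F i) = Module.finrank k (F i) := by
  let b := Module.finBasis k (F i)
  have hli : LinearIndependent k fun j => ((b j : F i) : DRing k R) :=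
    b.linearIndependent.map' (F i).subtype (Submodule.ker_subtype _)
  rw [baseChangeFilt_eq_span_range K b,
    finrank_span_eq_card (DRing.linearIndependent_baseChange K hli), Fintype.card_fin]

/-- This extracts a coefficient of P along a functional φ on K. As φ ⊗ id is R-linear, commutators
with r correspond to commutators of P with 1 ⊗ r, and the order does not grow. -/
theorem bracket_tmul_mem_of_mem {n : ℕ} {P : Module.End K (K ⊗[k] R)}
    (hP : P ∈ diffOpLE K (K ⊗[k] R) (K ⊗[k] R) n) (φ : K →ₗ[k] k) :
    ((TensorProduct.lid k R).toLinearMap.comp (φ.rTensor R)).comp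
      ((P.restrictScalars k).comp (TensorProduct.mk k K R 1)) ∈ diffOpLE k R R n := by
  have hmul : ∀ (r : R) (y : K ⊗[k] R), TensorProduct.lid k R (φ.rTensor R (((1 : K) ⊗ₜ[k] r) * y))
      = r * TensorProduct.lid k R (φ.rTensor R y) := by
    intro r y
    induction y with
    | zero => simp
    | tmul c s => simp
    | add y z hy hz => rw [mul_add, map_add, map_add, map_add, map_add, hy, hz, mul_add]
  have key : ∀ (P : Module.End K (K ⊗[k] R)) (r : R), bracket k R R r
      (((TensorProduct.lid k R).toLinearMap.comp (φ.rTensor R)).comp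
        ((P.restrictScalars k).comp (TensorProduct.mk k K R 1)))
      = ((TensorProduct.lid k R).toLinearMap.comp (φ.rTensor R)).comp
        (((bracket K (K ⊗[k] R) (K ⊗[k] R) ((1 : K) ⊗ₜ[k] r) P).restrictScalars k).comp
          (TensorProduct.mk k K R 1)) := by
    intro P r
    ext x
    simp only [bracket_apply, LinearMap.comp_apply, TensorProduct.mk_apply, LinearEquiv.coe_coe,
      LinearMap.restrictScalars_apply, smul_eq_mul, map_sub, hmul,
      Algebra.TensorProduct.tmul_mul_tmul, mul_one]
  induction n generalizing P with
  | zero =>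
    rw [mem_zero] at hP ⊢
    intro r
    rw [key, hP]
    ext x
    simp
  | succ n ih =>
    rw [mem_succ] at hP ⊢
    intro r
    rw [key]
    exact ih (hP _)

/-- Every differential operator on `K ⊗ R` is a `K`-linear combination of operators `id ⊗ δ`. -/
theorem exists_sum_baseChange (𝒜 : ℕ → Submodule k R) [GradedAlgebra 𝒜] [Algebra.FiniteType k R]
    (h0 : 𝒜 0 = 1) (P : DRing K (K ⊗[k] R)) :
    ∃ (s : Finset (Module.Basis.ofVectorSpaceIndex k K)) (c : Module.Basis.ofVectorSpaceIndex k K → K)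
      (δ : Module.Basis.ofVectorSpaceIndex k K → DRing k R),
      P = ∑ i ∈ s, c i • (δ i).baseChange K := by
  classical
  let β := Module.Basis.ofVectorSpace k K
  have hmem := fun i => bracket_tmul_mem_of_mem K (mem_ord P) (β.coord i)
  let Q := fun i => ((TensorProduct.lid k R).toLinearMap.comp ((β.coord i).rTensor R)).comp
      ((P.toEnd.restrictScalars k).comp (TensorProduct.mk k K R 1))
  have hQ : ∀ i x, Q i x = TensorProduct.equivFinsuppOfBasisLeft β (P.toEnd ((1 : K) ⊗ₜ[k] x)) i :=
    fun i x => (TensorProduct.equivFinsuppOfBasisLeft_apply β _ i).symm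
  obtain ⟨T, hT⟩ := Module.Finite.iff_fg.1 (finite_degLE 𝒜 h0 ((genDegree 𝒜 * ord P : ℕ) : ℤ))
  -- Only finitely many coordinates Q i are nonzero: each has order at most ord P, so it is
  -- determined by its values on the finite set T spanning R_{≤ w ord P}.
  let s := T.biUnion fun x =>
    (TensorProduct.equivFinsuppOfBasisLeft β (P.toEnd ((1 : K) ⊗ₜ[k] x))).support
  have hs : ∀ i, i ∉ s → Q i = 0 := by
    intro i hi
    refine eq_zero_of_vanish_degLE 𝒜 h0 (hmem i) fun x hx => ?_
    rw [← hT] at hx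
    refine (Submodule.span_le (p := LinearMap.ker (Q i))).2 (fun y hy => ?_) hx
    rw [SetLike.mem_coe, LinearMap.mem_ker, hQ]
    by_contra hne
    exact hi (Finset.mem_biUnion.2 ⟨y, hy, Finsupp.mem_support_iff.2 hne⟩)
  refine ⟨s, β, fun i => DRing.mk (Q i) (ord P) (hmem i), DRing.toEnd_injective ?_⟩
  rw [map_sum]
  refine TensorProduct.AlgebraTensorModule.curry_injective (LinearMap.ext_ring (LinearMap.ext
    fun x => ?_))
  simp only [TensorProduct.AlgebraTensorModule.curry_apply, TensorProduct.curry_apply,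
    LinearMap.coe_restrictScalars, LinearMap.sum_apply, map_smul,
    LinearMap.smul_apply, DRing.toEnd_baseChange, DRing.toEnd_mk, LinearMap.baseChange_tmul,
    TensorProduct.smul_tmul', smul_eq_mul, mul_one]
  have h1 := (TensorProduct.equivFinsuppOfBasisLeft β).symm_apply_apply
    (P.toEnd ((1 : K) ⊗ₜ[k] x))
  rw [TensorProduct.equivFinsuppOfBasisLeft_symm_apply] at h1
  rw [← h1, Finsupp.sum_of_support_subset (s := s)]
  · exact Finset.sum_congr rfl fun i _ => by rw [hQ]
  · intro i hi
    by_contra hne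
    refine Finsupp.mem_support_iff.1 hi ?_
    rw [← hQ, hs i hne, LinearMap.zero_apply]
  · intro i _
    rw [TensorProduct.tmul_zero]

theorem isAlgFiltration_baseChangeFilt (𝒜 : ℕ → Submodule k R) [GradedAlgebra 𝒜]
    [Algebra.FiniteType k R] (h0 : 𝒜 0 = 1) (hF : IsAlgFiltration F) :
    IsAlgFiltration (baseChangeFilt K F) := by
  have hmono : Monotone (baseChangeFilt K F) := fun i j h =>
    Submodule.span_mono (Set.image_mono (hF.mono h))
  have hfin := hF.finite
  refine ⟨hmono, fun P => ?_, fun i => finite_baseChangeFilt K i, ?_, fun i j => ?_⟩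
  · obtain ⟨s, c, δ, rfl⟩ := exists_sum_baseChange K 𝒜 h0 P
    choose n hn using fun i => hF.exhaustive (δ i)
    exact ⟨s.sup n, sum_mem fun i hi => Submodule.smul_mem _ _
      (hmono (Finset.le_sup hi) (DRing.baseChange_mem K (hn i)))⟩
  · refine le_antisymm (Submodule.span_le.2 ?_) (Submodule.one_le.2 ?_)
    · rintro _ ⟨δ, hδ, rfl⟩
      rw [hF.zero] at hδ
      obtain ⟨c, rfl⟩ := Submodule.mem_one.1 hδ
      rw [Algebra.algebraMap_eq_smul_one, DRing.baseChange_smul, DRing.baseChange_one]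
      exact Submodule.smul_mem _ _ (Submodule.one_le.1 le_rfl)
    · rw [← DRing.baseChange_one]
      exact DRing.baseChange_mem K (by rw [hF.zero]; exact Submodule.one_le.1 le_rfl)
  · rw [baseChangeFilt, baseChangeFilt, Submodule.span_mul_span]
    refine Submodule.span_le.2 ?_
    rintro _ ⟨_, ⟨δ, hδ, rfl⟩, _, ⟨ε, hε, rfl⟩, rfl⟩
    dsimp only
    rw [← DRing.baseChange_mul]
    exact DRing.baseChange_mem K (hF.mul_le i j (Submodule.mul_mem_mul hδ hε))

theorem filtDim_baseChangeFilt (hF : ∀ i, Module.Finite k (F i)) :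
    filtDim (baseChangeFilt K F) = filtDim F := by
  simp only [filtDim, finrank_baseChangeFilt]

theorem filtMult_baseChangeFilt (hF : ∀ i, Module.Finite k (F i)) :
    filtMult (baseChangeFilt K F) = filtMult F := by
  simp only [filtMult, filtDim_baseChangeFilt K hF, finrank_baseChangeFilt]

/-- Tameness refers to Φ and not to a grading, so it transfers along base change with the same d;
the Krull dimension of K ⊗ R never enters. -/
theorem isTame_baseChangeFilt {Φ : ℤ → Submodule k R} {c d : ℕ} (h : IsTame F Φ c d) :
    IsTame (baseChangeFilt K F) (fun j => (Φ j).baseChange K) c d := by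
  have hfin := h.finite
  have hraise : ∀ (P : Module.End K (K ⊗[k] R)) (e : ℤ),
      (∀ j, ∀ x ∈ Φ j, P ((1 : K) ⊗ₜ[k] x) ∈ (Φ (j + e)).baseChange K) →
      Raises (fun j => (Φ j).baseChange K) P e := by
    intro P e hP j
    change (Φ j).baseChange K ≤ ((Φ (j + e)).baseChange K).comap P
    rw [Submodule.baseChange_eq_span]
    refine Submodule.span_le.2 ?_
    rintro _ ⟨x, hx, rfl⟩
    exact hP j x hx
  have hmono : Monotone fun j => (Φ j).baseChange K := by
    intro i j hij
    change (Φ i).baseChange K ≤ (Φ j).baseChange K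
    rw [Submodule.baseChange_eq_span]
    refine Submodule.span_le.2 ?_
    rintro _ ⟨x, hx, rfl⟩
    exact Submodule.tmul_mem_baseChange_of_mem 1 (h.mono hij hx)
  refine ⟨hmono, fun y => ?_, fun n => ?_, ?_, fun f => ?_, h.pos, fun i P hP => ?_⟩
  · induction y with
    | zero => exact ⟨0, zero_mem _⟩
    | tmul c x =>
      obtain ⟨n, hn⟩ := h.exhaustive x
      exact ⟨n, Submodule.tmul_mem_baseChange_of_mem c hn⟩
    | add y z hy hz =>
      obtain ⟨m, hm⟩ := hy
      obtain ⟨n, hn⟩ := hz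
      exact ⟨max m n, add_mem (hmono (by exact_mod_cast le_max_left m n) hm)
        (hmono (by exact_mod_cast le_max_right m n) hn)⟩
  · exact Module.Finite.range _
  · obtain ⟨C, hC⟩ := h.growth
    refine ⟨C, fun n => le_trans ?_ (hC n)⟩
    rw [← Module.finrank_baseChange (R := K) (S := k) (M' := Φ n)]
    exact LinearMap.finrank_range_le _
  · induction f with
    | zero => exact ⟨0, fun j x _ => by simp⟩
    | tmul c r =>
      obtain ⟨u, hu⟩ := h.mul r
      refine ⟨u, hraise _ _ fun j x hx => ?_⟩
      change c ⊗ₜ[k] r * (1 : K) ⊗ₜ[k] x ∈ (Φ (j + u)).baseChange K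
      rw [Algebra.TensorProduct.tmul_mul_tmul]
      exact Submodule.tmul_mem_baseChange_of_mem _ (hu j x hx)
    | add f g hf hg =>
      obtain ⟨u, hu⟩ := hf
      obtain ⟨v, hv⟩ := hg
      refine ⟨max u v, fun j x hx => ?_⟩
      rw [map_add, LinearMap.add_apply]
      exact add_mem (hmono (by push_cast; omega) (hu j x hx))
        (hmono (by push_cast; omega) (hv j x hx))
  · induction hP using Submodule.span_induction with
    | mem P hP =>
      obtain ⟨δ, hδ, rfl⟩ := hP
      obtain ⟨h1, h2⟩ := h.bound i δ hδ
      refine ⟨baseChange_mem K _ _ h1, hraise _ _ fun j x hx => ?_⟩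
      rw [DRing.toEnd_baseChange, LinearMap.baseChange_tmul]
      exact Submodule.tmul_mem_baseChange_of_mem _ (h2 j x hx)
    | zero =>
      rw [map_zero]
      exact ⟨zero_mem _, fun j x _ => zero_mem _⟩
    | add δ ε _ _ hδ hε =>
      rw [map_add]
      exact ⟨add_mem hδ.1 hε.1, fun j x hx => add_mem (hδ.2 j x hx) (hε.2 j x hx)⟩
    | smul c δ _ hδ =>
      rw [map_smul]
      exact ⟨Submodule.smul_mem _ _ hδ.1, fun j x hx => Submodule.smul_mem _ _ (hδ.2 j x hx)⟩

end BaseChangeOps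

/-! ### Linear simplicity over k(s) by specialization. -/

section Specialization

open Polynomial

variable {k : Type*} [Field k] {K : Type*} [Field K] [Algebra k K] [Algebra k[X] K]
  [IsScalarTower k k[X] K] [IsFractionRing k[X] K]

/-- Clearing the denominators of a linear map to the field of fractions. -/
theorem exists_clear_denominators {V : Type*} [AddCommGroup V] [Module k V] [Module.Finite k V]
    (ψ : V →ₗ[k] K) : ∃ (E : k[X]) (ψ' : V →ₗ[k] k[X]), E ≠ 0 ∧
      ∀ v, algebraMap k[X] K (ψ' v) = algebraMap k[X] K E * ψ v := by
  let b := Module.finBasis k V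
  obtain ⟨E, hE⟩ := IsLocalization.exist_integer_multiples_of_finite (nonZeroDivisors k[X])
    fun i => ψ (b i)
  choose q hq using hE
  refine ⟨E, b.constr k q, nonZeroDivisors.coe_ne_zero E, fun v => ?_⟩
  have : (IsScalarTower.toAlgHom k k[X] K).toLinearMap.comp (b.constr k q)
      = (LinearMap.mulLeft k (algebraMap k[X] K E)).comp ψ := by
    refine b.ext fun i => ?_
    rw [LinearMap.comp_apply, Module.Basis.constr_basis, LinearMap.comp_apply,
      LinearMap.mulLeft_apply, ← Algebra.smul_def]
    exact hq i
  exact LinearMap.congr_fun this v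

/-- Linear simplicity is inherited by the base change to `K = k(s)`. -/
theorem isLinearlySimple_baseChangeFilt [Infinite k] {R : Type*} [CommRing R] [Algebra k R]
    {F : ℕ → Submodule k (DRing k R)} (hF : IsAlgFiltration F) (hs : IsLinearlySimple F) :
    IsLinearlySimple (baseChangeFilt K F) := by
  obtain ⟨C, hC0, hC⟩ := hs
  have hfin := hF.finite
  refine ⟨C, hC0, fun i δ hδ hδ0 => ?_⟩
  by_contra hnot
  -- A failure over K is witnessed by a functional that kills F (C i) δ F (C i) but not 1. The plan
  -- is to specialize both δ and φ to k.
  obtain ⟨φ, hφ1, hφ⟩ := Submodule.exists_le_ker_of_notMem hnot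
  -- H is a finite-dimensional space over k containing 1 and all products to be tested; finiteness
  -- allows one common denominator E for the values of φ.
  let H := F (C * i + i + C * i)
  have hH : ∀ p ∈ F (C * i), ∀ e ∈ F i, ∀ q ∈ F (C * i), p * e * q ∈ H := fun p hp e he q hq =>
    hF.mul_le _ _ (Submodule.mul_mem_mul (hF.mul_le _ _ (Submodule.mul_mem_mul hp he)) hq)
  have h1H : (1 : DRing k R) ∈ H := hF.mono (Nat.zero_le _) (by
    rw [hF.zero]; exact Submodule.one_le.1 le_rfl)
  let ψ : H →ₗ[k] K :=
    { toFun := fun z => φ (z.1.baseChange K)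
      map_add' := fun y z => by
        rw [Submodule.coe_add, DRing.baseChange_add, map_add]
      map_smul' := fun c z => by
        rw [Submodule.coe_smul, DRing.baseChange_smul, map_smul, RingHom.id_apply, algebraMap_smul] }
  have hψ : ∀ z, ψ z = φ (z.1.baseChange K) := fun _ => rfl
  obtain ⟨E, ψ', hE, hψ'⟩ := exists_clear_denominators ψ
  let b := Module.finBasis k (F i)
  rw [baseChangeFilt_eq_span_range K b] at hδ
  obtain ⟨c, hc⟩ := (Submodule.mem_span_range_iff_exists_fun K).1 hδ
  obtain ⟨D, hD⟩ := IsLocalization.exist_integer_multiples_of_finite (nonZeroDivisors k[X]) c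
  choose q hq using hD
  obtain ⟨j, hj⟩ : ∃ j, c j ≠ 0 := by
    by_contra! h
    exact hδ0 (by rw [← hc]; exact Finset.sum_eq_zero fun j _ => by rw [h j, zero_smul])
  have hinj := IsFractionRing.injective k[X] K
  have hqj : q j ≠ 0 := by
    intro h
    have h1 := hq j
    rw [h, map_zero, Algebra.smul_def] at h1
    rcases mul_eq_zero.1 h1.symm with h2 | h2
    · exact nonZeroDivisors.coe_ne_zero D ((map_eq_zero_iff _ hinj).1 h2)
    · exact hj h2
  have hp : ψ' ⟨1, h1H⟩ ≠ 0 := by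
    intro h
    have h1 := hψ' ⟨1, h1H⟩
    rw [h, map_zero, hψ, DRing.baseChange_one] at h1
    rcases mul_eq_zero.1 h1.symm with h2 | h2
    · exact hE ((map_eq_zero_iff _ hinj).1 h2)
    · exact hφ1 h2
  -- Since k is infinite, some t ∈ k is a root of neither polynomial: q j keeps the specialized
  -- operator nonzero, and the other keeps the functional nonzero at 1.
  obtain ⟨t, ht⟩ : ∃ t, (q j * ψ' ⟨1, h1H⟩).eval t ≠ 0 := by
    by_contra! h
    exact mul_ne_zero hqj hp (Polynomial.funext fun t => by rw [h t, eval_zero])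
  rw [eval_mul] at ht
  -- The operator D δ has polynomial coefficients q l; ε is its value at s = t.
  let ε : F i := ∑ l, (q l).eval t • b l
  have hε : ε.1 ≠ 0 := by
    intro h
    have h1 : ε = 0 := Subtype.ext h
    have h2 := Fintype.linearIndependent_iff.1 b.linearIndependent _ h1 j
    exact left_ne_zero_of_mul ht h2
  let φt : H →ₗ[k] k := (Polynomial.leval t).comp ψ'
  have hsum : ∀ u ∈ F (C * i), ∀ v ∈ F (C * i),
      ∃ z ∈ LinearMap.ker φt, (z : DRing k R) = u * ε.1 * v := by
    intro u hu v hv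
    let z : Fin (Module.finrank k (F i)) → H := fun l => ⟨u * (b l).1 * v, hH u hu _ (b l).2 v hv⟩
    refine ⟨∑ l, (q l).eval t • z l, ?_, ?_⟩
    -- In K this sum is D E φ(u δ v) = 0, and polynomials embed into K. Evaluation at t then shows
    -- that φt kills u ε v.
    · have h1 : ∑ l, q l * ψ' (z l) = 0 := by
        refine hinj ?_
        have h2 : φ (u.baseChange K * δ * v.baseChange K) = 0 :=
          hφ (Submodule.mul_mem_mul (Submodule.mul_mem_mul (DRing.baseChange_mem K hu)
            (Submodule.mem_span_singleton_self δ)) (DRing.baseChange_mem K hv))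
        rw [← hc, Finset.mul_sum, Finset.sum_mul, map_sum] at h2
        rw [map_sum, map_zero]
        have h3 : ∀ l, algebraMap k[X] K (q l * ψ' (z l)) = algebraMap k[X] K D *
            algebraMap k[X] K E *
              φ (u.baseChange K * c l • (b l).1.baseChange K * v.baseChange K) := by
          intro l
          have h4 : u.baseChange K * c l • (b l).1.baseChange K * v.baseChange K
              = c l • (z l).1.baseChange K := by
            rw [mul_smul_comm, smul_mul_assoc, DRing.baseChange_mul, DRing.baseChange_mul]
          rw [h4, map_smul, map_mul, hψ', hq, hψ, Algebra.smul_def, smul_eq_mul]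
          ring
        simp only [h3]
        rw [← Finset.mul_sum, h2, mul_zero]
      rw [LinearMap.mem_ker, map_sum, ← eval_zero (x := t), ← h1, eval_finsetSum]
      refine Finset.sum_congr rfl fun l _ => ?_
      rw [map_smul, eval_mul, smul_eq_mul]
      rfl
    · simp only [ε, z, AddSubmonoidClass.coe_finsetSum, Submodule.coe_smul, Finset.mul_sum,
        Finset.sum_mul, mul_smul_comm, smul_mul_assoc]
  have hle : F (C * i) * Submodule.span k {ε.1} * F (C * i)
      ≤ (LinearMap.ker φt).map H.subtype := by
    rw [Submodule.mul_le]
    intro y hy v hv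
    induction hy using Submodule.mul_induction_on' with
    | mem_mul_mem u hu e he =>
      obtain ⟨r, rfl⟩ := Submodule.mem_span_singleton.1 he
      obtain ⟨z, hz, hzu⟩ := hsum u hu v hv
      exact ⟨r • z, Submodule.smul_mem _ r hz, by
        rw [map_smul, mul_smul_comm, smul_mul_assoc, ← hzu]; rfl⟩
    | add x _ y _ hx hy => rw [add_mul]; exact add_mem hx hy
  -- Linear simplicity over k puts 1 into F (C i) ε F (C i), so φt would kill 1, against the choice
  -- of t. The constant C is the same over K.
  obtain ⟨z, hz, hz1⟩ := hle (hC i ε.1 ε.2 hε)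
  have hz2 : z = ⟨1, h1H⟩ := Subtype.ext hz1
  rw [hz2] at hz
  exact right_ne_zero_of_mul ht hz

end Specialization

/-! ### The standing conditions over k(s), and the main theorem. -/

theorem baseChangeFilt_setting {k R : Type*} [Field k] [CharZero k] [CommRing R] [Algebra k R]
    [Algebra.FiniteType k R] (𝒜 : ℕ → Submodule k R) [GradedAlgebra 𝒜] (h0 : 𝒜 0 = 1)
    {F : ℕ → Submodule k (DRing k R)} (hF : IsHolonomicSetting F) :
    IsHolonomicSetting (baseChangeFilt (RatFunc k) F) := by
  have hfin := hF.filtration.finite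
  exact ⟨isAlgFiltration_baseChangeFilt _ 𝒜 h0 hF.filtration,
    isLinearlySimple_baseChangeFilt hF.filtration hF.linearlySimple,
    by rw [filtDim_baseChangeFilt _ hfin]; exact hF.dim_lt_top,
    by rw [filtMult_baseChangeFilt _ hfin]; exact hF.mult_pos,
    by rw [filtMult_baseChangeFilt _ hfin]; exact hF.mult_lt_top⟩

end BernsteinAlg

theorem mainTheorem7 {k R : Type*} [Field k] [CommRing R] [Nontrivial R] [Algebra k R]
    [Algebra.FiniteType k R] (𝒜 : ℕ → Submodule k R) [GradedAlgebra 𝒜] (h0 : 𝒜 0 = 1)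
    (a : ℝ) (ha : (BernsteinAlg.genDegree 𝒜 : ℝ) < a)
    (hsig : 0 < BernsteinAlg.diffSignature 𝒜)
    (hsimple : BernsteinAlg.IsLinearlySimple (BernsteinAlg.genBernstein 𝒜 a)) :
    BernsteinAlg.IsBernsteinAlgebra 𝒜 ∧
    ∀ b : ℝ, (BernsteinAlg.genDegree 𝒜 : ℝ) < b →
      BernsteinAlg.IsHolonomic (BernsteinAlg.genBernstein 𝒜 b) R ∧
      (∀ f : R, BernsteinAlg.IsHolonomic (BernsteinAlg.genBernstein 𝒜 b)
        (BernsteinAlg.LocModule k (Submonoid.powers f))) ∧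
      (∀ (I : Ideal R) (ℓ : ℕ) (g : Fin ℓ → R), Ideal.span (Set.range g) = I → ∀ j : ℕ,
        BernsteinAlg.IsHolonomic (BernsteinAlg.genBernstein 𝒜 b)
          (BernsteinAlg.CechCohomology k g j)) ∧
      (∀ _ : CharZero k, ∀ f : R, f ≠ 0 →
        BernsteinAlg.IsHolonomic
          (BernsteinAlg.baseChangeFilt (RatFunc k) (BernsteinAlg.genBernstein 𝒜 b))
          (BernsteinAlg.FsModule (TensorProduct.tmul k (1 : RatFunc k) f)
            (RatFunc.X : RatFunc k))) := by
  refine ⟨fun b hb => ?_, fun b hb => ?_⟩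
  · obtain ⟨hset, hdim⟩ := BernsteinAlg.genBernstein_setting 𝒜 h0 ha hsig hsimple hb
    exact ⟨hset.linearlySimple, hdim, hset.mult_pos, hset.mult_lt_top⟩
  · obtain ⟨hset, hdim⟩ := BernsteinAlg.genBernstein_setting 𝒜 h0 ha hsig hsimple hb
    obtain ⟨c, htame⟩ := BernsteinAlg.isTame_genBernstein 𝒜 h0 hb
    refine ⟨BernsteinAlg.isHolonomic_of_hasGrowth hset hdim (BernsteinAlg.exists_modFiltration 𝒜 h0 hb),
      fun f => BernsteinAlg.isHolonomic_of_hasGrowth hset hdim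
        (BernsteinAlg.hasGrowth_locModule htame f),
      fun _ _ g _ j => BernsteinAlg.isHolonomic_of_hasGrowth hset hdim
        (BernsteinAlg.hasGrowth_cechCohomology htame g j), fun _ f _ => ?_⟩
    exact BernsteinAlg.isHolonomic_of_hasGrowth (BernsteinAlg.baseChangeFilt_setting 𝒜 h0 hset)
      ((BernsteinAlg.filtDim_baseChangeFilt _ hset.filtration.finite).trans hdim)
      (BernsteinAlg.hasGrowth_fsModule (BernsteinAlg.isTame_baseChangeFilt _ htame) _ _)
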